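/- **Model.** Let $V$ be a finite set of nodes with distinct identifiers from a linearly ordered set $I$; write $u<v$ ("$u$ is left of $v$") if $id(u)<id(v)$. A node $u$ has a mode (staying or leaving), finite sets $Left,Right,TempLeft,TempRight$ of node references, a partial map $uniqueValues$ on its neighbours with a counter that generates fresh values, and search data: for each $D\in I$ the number $WaitingFor[D]$ of pending own search requests and a number $seq[D]$, and a counter $seq$. Each node has a channel, a finite multiset of messages. A node may be *gone* (it executed **exit**), otherwise it is *present*. In an atomic step a present node executes its Timeout action, or takes a message out of its channel and executes the action named by it, or, if it is staying, initiates a search or decides to become leaving (irrevocably). A *computation* is an infinite sequence of states related by such steps (the state repeats once all nodes are gone) in which every node that is present from some point on executes Timeout infinitely often, and every message in the channel of a present node is eventually processed. **Protocol** (Build-List* with its search part Search*). The rules are written for references on the left of $self$; the right side is symmetric, except where a direction is named. Where a rule depends on the side of a reference $v$, nothing is done for $v=self$. Before each action a sanity check moves every stored reference to the correct side, drops a reference to $self$ and satellite data of references no longer stored, and moves references of a staying node from $TempLeft,TempRight$ to $Left,Right$. "Save $v$" means: add $v$ to $Left$ if $self$ is staying, to $TempLeft$ if $self$ is leaving. *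 *Timeout, staying.* For each $D$ with $WaitingFor[D]>0$ send $ForwardProbe(self,D,\{self\},seq)$ to $self$. For $Left=\{v_1<\dots<v_k\}$ send $Introduce(v_i,self)$ to $v_{i+1}$ for $i<k$, and $Introduce(self,\bot)$ to the closest left neighbour $v_k$. * *Timeout, leaving.* If the oracle $\mathcal{NIDEC}$ holds (own channel empty, and no other node has a reference to $self$ in memory or channel), send, for all pairs $v,w$ of stored neighbours, $Introduce(w,\bot)$ to $v$ and $Introduce(v,\bot)$ to $w$, and **exit** (all edges of the node are deleted). Otherwise send $RevAndLinREQ(right)$ to all of $Left\cup TempLeft$ and $RevAndLinREQ(left)$ to all of $Right\cup TempRight$. * $Introduce(v,w)$, $v<self$. Staying, $w\ne\bot$: add $v$ to $Left$, send $Linearize(v)$ to $w$ and $TempDelegate(w)$ to $self$. Staying, $w=\bot$: send $TempDelegate(v)$ to $self$. Leaving: add $v$ and $w$ (if $\neq\bot$) to $TempLeft$ unless they are in $Left$. * $Linearize(v)$, $v<self$. Staying: send $TempDelegate(v)$ to $self$; if $Left\neq\emptyset$ and $v\ne\max Left$, remove $v$ from $Left$ and send $TempDelegate(v)$ to $\min\{w\in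 Left: w>v\}$, if it exists. Leaving: add $v$ to $TempLeft$. * $TempDelegate(v)$, $v<self$. If $Left=\emptyset$ or $\max Left<v$, save $v$; otherwise send $TempDelegate(v)$ to $\max Left$. * $RevAndLinREQ(dir)$. If $dir=right$ or $self$ is staying: give each neighbour $v$ in direction $dir$ (in $Left$/$Right$ or $TempLeft$/$TempRight$) that has no value a fresh $uniqueValues[v]$, and send $RevAndLinACK(self,uniqueValues[v])$ to each such $v$. * $RevAndLinACK(v,x)$, $v<self$. Leaving: add $v$ to $TempLeft$ and send $RevAndLin(Right,x)$ to $v$. Staying: send $TempDelegate(v)$ to $self$. * $RevAndLin(N,x)$. If some neighbour $v$ has $uniqueValues[v]=x$ and the nodes of $N$ are not from both sides of $self$: a staying node replaces its $Left$ (if $v<self$; else $Right$) by that set $\cup N\setminus\{v\}$ and sends $Introduce(self,\bot)$ to $v$; a leaving node with $v<self$ adds $N$ to $TempLeft$; a leaving node with $v>self$ replaces $Right$ (if $v\in Right$; else $TempRight$) by that set $\cup N\setminus\{v\}$ and sends $Introduce(self,\bot)$ to $v$. In all other cases send $TempDelegate(y)$ to $self$ for all $y\in N$. * $InitSearch(D)$,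 staying only. If $WaitingFor[D]=0$, increase $seq$ by $1$ and set $seq[D]:=seq$; then increase $WaitingFor[D]$ by $1$. * $ForwardProbe(s,D,Next,q)$. If $D=id(self)$: send $TempDelegate(y)$ to $self$ for all $y\in Next\cup\{s\}$, and to $s$ send $ProbeSuccess(D,q,self)$ if staying, $ProbeFail(D,q)$ if leaving. If $D>id(self)$ (symmetrically for $<$): put $Next:=(Next\setminus\{self\})\cup\{w\in Right: id(w)\le D\}$. If $Next=\emptyset$, send $ProbeFail(D,q)$ to $s$ and $TempDelegate(s)$ to $self$. Otherwise let $u=\min Next$; if $u<self$, send $TempDelegate(u)$ to $self$; else if $u$ is smaller than all elements of $Right$, save $u$; in any case send $ForwardProbe(s,D,Next,q)$ to $u$. * $ProbeSuccess(D,q,v)$. Send $TempDelegate(v)$ to $self$; if staying and $q\ge seq[D]$, first send $WaitingFor[D]$ requests $Search(self,D)$ to $v$ and set $WaitingFor[D]:=0$. $ProbeFail(D,q)$: if staying and $q\ge seq[D]$, set $WaitingFor[D]:=0$. A delivered $Search$ request is consumed. **Initial states.** All nodes are present, each unique value is stored at no more than one neighbour of a node, and everything else (modes, variables, messages) is arbitrary,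 subject to the following: the graph on $V$ with an edge $(a,b)$ whenever $a$ stores a reference to $b$ (in $Left,Right,TempLeft,TempRight$) or a message in $a$'s channel carries a reference to $b$ is weakly connected. Here the references in the following messages are not counted: $Search$ requests; messages $Introduce(a,w)$ in the channel of $a$ itself; probes $ForwardProbe(s,D,Next,q)$ in the channel of $a$ such that $id(a)<D$ and some $v\in Next$ has $id(v)>D$, or $id(a)>D$ and some $v\in Next$ has $id(v)<D$. **Legitimate states.** The present nodes are exactly the staying ones; each of them has $Left$ and $Right$ equal to the set consisting of its closest staying predecessor and successor, respectively (empty if there is none), and $TempLeft=TempRight=\emptyset$ (so the explicit edges form the sorted line); and the channels of present nodes contain no message $Introduce(v,w)$ with $w\neq\bot$, no $RevAndLin$ message, and no reference to a node that is not present. **Theorem.** Build-List* is a self-stabilizing solution to the linearization problem: 1. (Convergence) Every computation that starts in an initial state as above has a suffix in which every state is legitimate. In particular, eventually all leaving nodes are gone and the staying nodes form the sorted line forever. 2. (Closure) Every step from a legitimate state, other than a decision of a staying node to leave, leads to a legitimate state. -/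

import Mathlib

namespace BuildList

/-- The mode of a node. -/
inductive Mode
  | staying
  | leaving

/-- The two sides of a node: `left` are the smaller identifiers, `right` the larger ones. -/
inductive Side
  | left
  | right

/-- The opposite side. -/
def Side.other : Side → Side
  | .left => .right
  | .right => .left

/-- The messages. A message `label (parameters)` asks the receiver to execute the action `label`.
`V` is the set of nodes (and of node references), `I` the set of identifiers; the identifier in a
search request need not belong to a node. `none` plays the role of `⊥`. -/
inductive Msg (V I : Type*)
  | introduce (v : V) (w : Option V)
  | linearize (v : V)
  | tempDelegate (v : V)
  | revAndLinReq (dir : Side)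
  | revAndLinAck (v : V) (value : ℕ)
  | revAndLin (nodeList : Finset V) (value : ℕ)
  | initSearch (dest : I)
  | forwardProbe (source : V) (dest : I) (next : Finset V) (seq : ℕ)
  | probeSuccess (dest : I) (seq : ℕ) (node : V)
  | probeFail (dest : I) (seq : ℕ)
  | search (source : V) (dest : I)

/-- The variables of a node. -/
structure NodeState (V I : Type*) where
  mode : Mode
  /-- `true` once the node has executed `exit`. -/
  gone : Bool
  /-- `nbr left` and `nbr right` are the variables `Left` and `Right`. -/
  nbr : Side → Finset V
  /-- `tmp left` and `tmp right` are the variables `TempLeft` and `TempRight`. -/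
  tmp : Side → Finset V
  /-- The unique value that is stored as satellite data at a neighbour. -/
  uniqueValues : V → Option ℕ
  /-- The local counter that generates unique values. -/
  counter : ℕ
  /-- The number of own search requests that wait for an answer, for each destination. -/
  waitingFor : I →₀ ℕ
  /-- The sequence number counter. -/
  seq : ℕ
  /-- The sequence number stored for each destination. -/
  seqOf : I → ℕ

/-- A system state: the variables of all nodes and the contents of all channels. -/
structure State (V I : Type*) where
  loc : V → NodeState V I
  ch : V → Multiset (Msg V I)

/-- The messages that an action sends, together with their receivers. -/
abbrev Outbox (V I : Type*) := Multiset (V × Msg V I)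

section Order

variable {V : Type*} [LinearOrder V]

/-- `v` lies on side `d` of `u`. -/
def OnSide : Side → V → V → Prop
  | .left, u, v => v < u
  | .right, u, v => u < v

instance (d : Side) (u v : V) : Decidable (OnSide d u v) := by
  cases d <;> unfold OnSide <;> infer_instance

/-- The side of `u` on which `v` lies. -/
def sideOf (u v : V) : Option Side :=
  if v < u then some .left else if u < v then some .right else none

/-- The element of `S` with the largest identifier for `d = left`, and with the smallest one for
`d = right`: for a set `S` of nodes on side `d` of a node this is the closest one. -/
def nearest (d : Side) (S : Finset V) : Option V :=
  if h : S.Nonempty then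
    match d with
    | .left => some (S.max' h)
    | .right => some (S.min' h)
  else none

/-- For a set `S` of nodes on side `d` of a node `u`: the element of `S` that follows `v` on the
way from `v` to `u`. -/
def nextInward (d : Side) (S : Finset V) (v : V) : Option V :=
  nearest d.other (S.filter fun w => OnSide d.other v w)

end Order

section Local

variable {V I : Type*} [LinearOrder V]

/-- All references in the local memory. -/
def NodeState.refs (x : NodeState V I) : Finset V :=
  x.nbr .left ∪ x.nbr .right ∪ (x.tmp .left ∪ x.tmp .right)

instance : DecidableEq Side := fun a b => by
  cases a <;> cases b <;> first | exact isTrue rfl | exact isFalse (fun h => nomatch h)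

/-- Replace `Left` or `Right`. -/
def NodeState.setNbr (x : NodeState V I) (d : Side) (S : Finset V) : NodeState V I :=
  { x with nbr := Function.update x.nbr d S }

/-- Replace `TempLeft` or `TempRight`. -/
def NodeState.setTmp (x : NodeState V I) (d : Side) (S : Finset V) : NodeState V I :=
  { x with tmp := Function.update x.tmp d S }

/-- Save `S` on side `d`: a staying node uses `Left`/`Right`, a leaving one
`TempLeft`/`TempRight`. -/
def NodeState.save (x : NodeState V I) (d : Side) (S : Finset V) : NodeState V I :=
  match x.mode with
  | .staying => x.setNbr d (x.nbr d ∪ S)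
  | .leaving => x.setTmp d (x.tmp d ∪ S)

/-- The sanity check that precedes every action: each stored reference is rearranged to the side on
which it belongs (a reference of the node to itself belongs to none), references that a staying node
holds in `TempLeft`/`TempRight` are rearranged to `Left`/`Right`, and satellite data without a
reference is dropped. -/
def sanitize (self : V) (x : NodeState V I) : NodeState V I :=
  { x with
    nbr := fun d => match x.mode with
      | .staying => x.refs.filter fun v => OnSide d self v
      | .leaving => (x.nbr .left ∪ x.nbr .right).filter fun v => OnSide d self v
    tmp := fun d => match x.mode with
      | .staying => ∅
      | .leaving => (x.tmp .left ∪ x.tmp .right).filter fun v => OnSide d self v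
    uniqueValues := fun v => if v ∈ x.refs then x.uniqueValues v else none }

/-- Send `m` to `o`, if there is such a node. -/
def sendOpt (o : Option V) (m : Msg V I) : Outbox V I :=
  match o with
  | some v => {(v, m)}
  | none => 0

/-- Send `m v` to `self`, for all `v ∈ S`. -/
def sendAllTo (self : V) (S : Finset V) (m : V → Msg V I) : Outbox V I :=
  S.val.map fun v => (self, m v)

/-! ### Timeout -/

/-- Introduce every neighbour on side `d` to the next closer one, and the node itself to the closest
neighbour. -/
def introductions (self : V) (d : Side) (S : Finset V) : Outbox V I :=
  (S.val.bind fun v => sendOpt (nextInward d S v) (.introduce v (some self))) +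
    sendOpt (nearest d S) (.introduce self none)

/-- Timeout of a staying node. -/
def timeoutStaying (self : V) (x : NodeState V I) : NodeState V I × Outbox V I :=
  (x, (x.waitingFor.support.val.map fun dest => (self, Msg.forwardProbe self dest {self} x.seq)) +
    introductions self .left (x.nbr .left) + introductions self .right (x.nbr .right))

/-- Timeout of a leaving node to which the oracle does not permit to exit. -/
def timeoutLeaving (x : NodeState V I) : NodeState V I × Outbox V I :=
  (x, ((x.nbr .left ∪ x.tmp .left).val.map fun v => (v, Msg.revAndLinReq .right)) +
    ((x.nbr .right ∪ x.tmp .right).val.map fun v => (v, Msg.revAndLinReq .left)))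

/-- Timeout of a leaving node to which the oracle permits to exit: all neighbours are introduced to
each other, and all edges from the node are deleted. -/
def exit (x : NodeState V I) : NodeState V I × Outbox V I :=
  ({ x with gone := true, nbr := fun _ => ∅, tmp := fun _ => ∅, uniqueValues := fun _ => none },
    (x.refs ×ˢ x.refs).val.bind fun p =>
      {(p.1, Msg.introduce p.2 none), (p.2, Msg.introduce p.1 none)})

/-! ### Actions that are triggered by messages -/

def introduce (self v : V) (w : Option V) (x : NodeState V I) : NodeState V I × Outbox V I :=
  match sideOf self v with
  | none => (x, 0)
  | some d =>
    match x.mode, w with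
    | .staying, some w =>
        (x.setNbr d (x.nbr d ∪ {v}), {(w, .linearize v), (self, .tempDelegate w)})
    | .staying, none => (x, {(self, .tempDelegate v)})
    | .leaving, w => (x.setTmp d (x.tmp d ∪ (({v} ∪ w.toFinset) \ x.nbr d)), 0)

def linearize (self v : V) (x : NodeState V I) : NodeState V I × Outbox V I :=
  match sideOf self v with
  | none => (x, 0)
  | some d =>
    match x.mode with
    | .leaving => (x.setTmp d (x.tmp d ∪ {v}), 0)
    | .staying =>
      match nearest d (x.nbr d) with
      | none => (x, {(self, .tempDelegate v)})
      | some y =>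
        if v = y then (x, {(self, .tempDelegate v)})
        else (x.setNbr d (x.nbr d \ {v}),
          {(self, .tempDelegate v)} + sendOpt (nextInward d (x.nbr d) v) (.tempDelegate v))

/-- `u` is strictly closer than all elements of `Left` (`d = left`) or `Right` (`d = right`). -/
def NodeState.Closer (x : NodeState V I) (d : Side) (u : V) : Prop :=
  ∀ y ∈ x.nbr d, OnSide d.other y u

instance (x : NodeState V I) (d : Side) (u : V) : Decidable (x.Closer d u) :=
  inferInstanceAs (Decidable (∀ y ∈ x.nbr d, OnSide d.other y u))

def tempDelegate (self u : V) (x : NodeState V I) : NodeState V I × Outbox V I :=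
  match sideOf self u with
  | none => (x, 0)
  | some d =>
    if x.Closer d u then (x.save d {u}, 0)
    else (x, sendOpt (nearest d (x.nbr d)) (.tempDelegate u))

/-- Generate a unique value for each element of `S` that does not have one. The new values are
distinct and larger than all values that are stored or have been generated before. -/
def assignValues [Fintype V] (S : Finset V) (x : NodeState V I) : NodeState V I :=
  let base := max x.counter (Finset.univ.sup fun v => (x.uniqueValues v).getD 0)
  { x with
    uniqueValues := fun v =>
      if v ∈ S ∧ x.uniqueValues v = none then some (base + 1 + (S.filter (· < v)).card)
      else x.uniqueValues v
    counter := base + S.card }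

/-- A leaving node reacts to `dir = right` only. -/
def revAndLinReq [Fintype V] (self : V) (dir : Side) (x : NodeState V I) :
    NodeState V I × Outbox V I :=
  match dir, x.mode with
  | .left, .leaving => (x, 0)
  | _, _ =>
    let S := x.nbr dir ∪ x.tmp dir
    let x' := assignValues S x
    (x', S.val.map fun v => (v, .revAndLinAck self ((x'.uniqueValues v).getD 0)))

def revAndLinAck (self v : V) (value : ℕ) (x : NodeState V I) : NodeState V I × Outbox V I :=
  match sideOf self v with
  | none => (x, 0)
  | some d =>
    match x.mode with
    | .leaving => (x.setTmp d (x.tmp d ∪ {v}), {(v, .revAndLin (x.nbr d.other) value)})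
    | .staying => (x, {(self, .tempDelegate v)})

/-- The neighbour at which `value` is stored. -/
def owner (value : ℕ) (x : NodeState V I) : Option V :=
  nearest .left (x.refs.filter fun v => x.uniqueValues v = some value)

/-- The list passes the sanity check: its nodes are not from two different sides of `self`. -/
def OneSided (self : V) (nodeList : Finset V) : Prop :=
  (∀ v ∈ nodeList, v ≤ self) ∨ (∀ v ∈ nodeList, self ≤ v)

instance (self : V) (nodeList : Finset V) : Decidable (OneSided self nodeList) := by
  unfold OneSided; infer_instance

def revAndLin (self : V) (nodeList : Finset V) (value : ℕ) (x : NodeState V I) :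
    NodeState V I × Outbox V I :=
  let reject : NodeState V I × Outbox V I := (x, sendAllTo self nodeList .tempDelegate)
  if OneSided self nodeList then
    match owner value x with
    | none => reject
    | some v =>
      match x.mode, sideOf self v with
      | _, none => reject
      | .staying, some d =>
          (x.setNbr d ((x.nbr d ∪ nodeList) \ {v}), {(v, .introduce self none)})
      | .leaving, some .left => (x.setTmp .left (x.tmp .left ∪ nodeList), 0)
      | .leaving, some .right =>
          (if v ∈ x.nbr .right then x.setNbr .right ((x.nbr .right ∪ nodeList) \ {v})
            else x.setTmp .right ((x.tmp .right ∪ nodeList) \ {v}),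
            {(v, .introduce self none)})
  else reject

variable [LinearOrder I]

/-- Initiate a search request. Leaving nodes do not. -/
noncomputable def initSearch (dest : I) (x : NodeState V I) : NodeState V I :=
  match x.mode with
  | .leaving => x
  | .staying =>
    if x.waitingFor dest = 0 then
      { x with
        waitingFor := x.waitingFor.update dest 1
        seq := x.seq + 1
        seqOf := Function.update x.seqOf dest (x.seq + 1) }
    else { x with waitingFor := x.waitingFor.update dest (x.waitingFor dest + 1) }

/-- A probe that travels to side `d` collects only neighbours that do not lie beyond `dest`. -/
def NotBeyond (d : Side) (dest i : I) : Prop :=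
  match d with
  | .left => dest ≤ i
  | .right => i ≤ dest

instance (d : Side) (dest i : I) : Decidable (NotBeyond d dest i) := by
  cases d <;> unfold NotBeyond <;> infer_instance

/-- The side of the node with identifier `i` to which a probe with destination `dest` travels. -/
def probeSide (i dest : I) : Side := if i < dest then .right else .left

def forwardProbe (ident : V ↪o I) (self source : V) (dest : I) (next : Finset V) (seq : ℕ)
    (x : NodeState V I) : NodeState V I × Outbox V I :=
  if dest = ident self then
    let answer : Msg V I := match x.mode with
      | .staying => .probeSuccess dest seq self
      | .leaving => .probeFail dest seq
    (x, sendAllTo self next .tempDelegate + {(source, answer), (self, .tempDelegate source)})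
  else
    let d := probeSide (ident self) dest
    let next' := (next \ {self}) ∪ (x.nbr d).filter fun w => NotBeyond d dest (ident w)
    match nearest d next' with
    | none => (x, {(source, .probeFail dest seq), (self, .tempDelegate source)})
    | some u =>
      if OnSide d.other self u then
        (x, {(self, .tempDelegate u), (u, .forwardProbe source dest next' seq)})
      else if x.Closer d u then
        (x.save d {u}, {(u, .forwardProbe source dest next' seq)})
      else (x, {(u, .forwardProbe source dest next' seq)})

noncomputable def probeSuccess (self : V) (dest : I) (seq : ℕ) (node : V) (x : NodeState V I) :
    NodeState V I × Outbox V I :=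
  match x.mode with
  | .leaving => (x, {(self, .tempDelegate node)})
  | .staying =>
    if x.seqOf dest ≤ seq then
      ({ x with waitingFor := x.waitingFor.erase dest },
        Multiset.replicate (x.waitingFor dest) (node, .search self dest) +
          {(self, .tempDelegate node)})
    else (x, {(self, .tempDelegate node)})

noncomputable def probeFail (dest : I) (seq : ℕ) (x : NodeState V I) : NodeState V I :=
  match x.mode with
  | .leaving => x
  | .staying =>
    if x.seqOf dest ≤ seq then { x with waitingFor := x.waitingFor.erase dest } else x

/-- The action that a message triggers. A delivered search request is consumed. -/
noncomputable def act [Fintype V] (ident : V ↪o I) (self : V) (m : Msg V I) (x : NodeState V I) :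
    NodeState V I × Outbox V I :=
  match m with
  | .introduce v w => introduce self v w x
  | .linearize v => linearize self v x
  | .tempDelegate v => tempDelegate self v x
  | .revAndLinReq dir => revAndLinReq self dir x
  | .revAndLinAck v value => revAndLinAck self v value x
  | .revAndLin nodeList value => revAndLin self nodeList value x
  | .initSearch dest => (initSearch dest x, 0)
  | .forwardProbe source dest next seq => forwardProbe ident self source dest next seq x
  | .probeSuccess dest seq node => probeSuccess self dest seq node x
  | .probeFail dest seq => (probeFail dest seq x, 0)
  | .search _ _ => (x, 0)

end Local

section Global

variable {V I : Type*} [LinearOrder V]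

/-- The references that a message carries. -/
def Msg.refs : Msg V I → Finset V
  | .introduce v w => {v} ∪ w.toFinset
  | .linearize v => {v}
  | .tempDelegate v => {v}
  | .revAndLinReq _ => ∅
  | .revAndLinAck v _ => {v}
  | .revAndLin nodeList _ => nodeList
  | .initSearch _ => ∅
  | .forwardProbe source _ next _ => {source} ∪ next
  | .probeSuccess _ _ node => {node}
  | .probeFail _ _ => ∅
  | .search source _ => {source}

/-- A node is present if it is not gone. -/
def State.Present (s : State V I) (u : V) : Prop := (s.loc u).gone = false

/-- The oracle: the channel of `u` is empty, and no other node has a reference to `u` in its local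
memory or in its channel. -/
def State.Nidec (s : State V I) (u : V) : Prop :=
  s.ch u = 0 ∧ ∀ v, v ≠ u → u ∉ (s.loc v).refs ∧ ∀ m ∈ s.ch v, u ∉ m.refs

/-- The state after node `u` has changed its variables and sent messages; `rest` are the messages
that remain in its channel. -/
def State.update (s : State V I) (u : V) (rest : Multiset (Msg V I))
    (r : NodeState V I × Outbox V I) : State V I where
  loc := Function.update s.loc u r.1
  ch := fun w => Function.update s.ch u rest w + (r.2.filter fun p => p.1 = w).map Prod.snd

/-- The events of a computation. -/
inductive Event (V I : Type*)
  | timeout (u : V)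
  | receive (u : V) (m : Msg V I)
  | initSearch (u : V) (dest : I)
  | leave (u : V)
  | idle

variable [Fintype V] [LinearOrder I]

/-- The atomic steps. Only present nodes act. Besides executing the protocol, staying nodes initiate
search requests and decide to leave at will. When all nodes are gone nothing is enabled, and the
state repeats. -/
inductive Step (ident : V ↪o I) : State V I → Event V I → State V I → Prop
  | timeoutStaying (s : State V I) (u : V) (hp : s.Present u) (hm : (s.loc u).mode = .staying) :
      Step ident s (.timeout u)
        (s.update u (s.ch u) (timeoutStaying u (sanitize u (s.loc u))))
  | timeoutLeaving (s : State V I) (u : V) (hp : s.Present u) (hm : (s.loc u).mode = .leaving)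
      (ho : ¬ s.Nidec u) :
      Step ident s (.timeout u)
        (s.update u (s.ch u) (timeoutLeaving (sanitize u (s.loc u))))
  | exit (s : State V I) (u : V) (hp : s.Present u) (hm : (s.loc u).mode = .leaving)
      (ho : s.Nidec u) :
      Step ident s (.timeout u)
        (s.update u (s.ch u) (exit (sanitize u (s.loc u))))
  | receive (s : State V I) (u : V) (m : Msg V I) (rest : Multiset (Msg V I)) (hp : s.Present u)
      (hc : s.ch u = m ::ₘ rest) :
      Step ident s (.receive u m)
        (s.update u rest (act ident u m (sanitize u (s.loc u))))
  | initSearch (s : State V I) (u : V) (dest : I) (hp : s.Present u)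
      (hm : (s.loc u).mode = .staying) :
      Step ident s (.initSearch u dest)
        (s.update u (s.ch u) (initSearch dest (sanitize u (s.loc u)), 0))
  | leave (s : State V I) (u : V) (hp : s.Present u) (hm : (s.loc u).mode = .staying) :
      Step ident s (.leave u)
        (s.update u (s.ch u) ({ s.loc u with mode := .leaving }, 0))
  | idle (s : State V I) (hg : ∀ u, ¬ s.Present u) : Step ident s .idle s

/-- A computation: an infinite sequence of steps with weakly fair execution of the timeout actions
and fair message receipt. -/
structure IsComputation (ident : V ↪o I) (σ : ℕ → State V I) (e : ℕ → Event V I) : Prop where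
  step : ∀ n, Step ident (σ n) (e n) (σ (n + 1))
  timeout_fair : ∀ u, (∃ N, ∀ k ≥ N, (σ k).Present u) → ∀ n, ∃ k ≥ n, e k = .timeout u
  receipt_fair : ∀ n u m, (σ n).Present u → m ∈ (σ n).ch u → ∃ k ≥ n, e k = .receive u m

/-- Initial states: all nodes are present, and each unique value is stored at no more than one
neighbour of a node. Everything else, including the channels, is arbitrary. -/
structure State.IsInitial (s : State V I) : Prop where
  present : ∀ u, s.Present u
  unique : ∀ u, ∀ v ∈ (s.loc u).refs, ∀ w ∈ (s.loc u).refs, ∀ k,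
    (s.loc u).uniqueValues v = some k → (s.loc u).uniqueValues w = some k → v = w

/-- The references in a message in the channel of `a` that give rise to implicit edges from `a`.
These are all references, except those in delivered search requests (which call no action) and in
two kinds of malformed messages that the protocol never generates: a message to `a` that introduces
`a` itself, and a probe that is already to visit nodes beyond its destination. -/
def Msg.edgeRefs (ident : V ↪o I) (a : V) : Msg V I → Finset V
  | .introduce v w => if v = a then ∅ else {v} ∪ w.toFinset
  | .forwardProbe source dest next _ =>
      if dest = ident a ∨ ∀ v ∈ next, NotBeyond (probeSide (ident a) dest) dest (ident v) then
        {source} ∪ next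
      else ∅
  | .search _ _ => ∅
  | m => m.refs

/-- `(a, b)` is an edge of the network graph, explicit or implicit. -/
def State.Edge (ident : V ↪o I) (s : State V I) (a b : V) : Prop :=
  b ∈ (s.loc a).refs ∨ ∃ m ∈ s.ch a, b ∈ m.edgeRefs ident a

/-- The network graph is weakly connected. -/
def State.WeaklyConnected (ident : V ↪o I) (s : State V I) : Prop :=
  (SimpleGraph.fromRel (s.Edge ident)).Preconnected

/-- The nodes that are present are exactly the staying ones, and the explicit edges form the sorted
line: every staying node stores its closest staying neighbour on each side, in `Left` and `Right`,
and no other reference. -/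
structure State.IsSortedLine (s : State V I) : Prop where
  present_iff : ∀ u, s.Present u ↔ (s.loc u).mode = .staying
  nbr_iff : ∀ u, s.Present u → ∀ d v, v ∈ (s.loc u).nbr d ↔
    s.Present v ∧ OnSide d u v ∧ ∀ w, s.Present w → OnSide d u w → ¬ OnSide d.other v w
  tmp_empty : ∀ u, s.Present u → ∀ d, (s.loc u).tmp d = ∅

/-- Messages that make a staying receiver save references without comparing them with its closest
neighbours. -/
def Msg.SavesUnconditionally : Msg V I → Prop
  | .introduce _ (some _) => True
  | .revAndLin _ _ => True
  | _ => False

/-- Legitimate states of the linearization problem: the topology is the sorted line, no message in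
transit can add an edge to it unconditionally, and all references in transit belong to present
nodes. -/
structure State.IsLegitimate (s : State V I) : Prop where
  line : s.IsSortedLine
  no_save : ∀ u, s.Present u → ∀ m ∈ s.ch u, ¬ m.SavesUnconditionally
  refs_present : ∀ u, s.Present u → ∀ m ∈ s.ch u, ∀ v ∈ m.refs, s.Present v

end Global

end BuildList

set_option linter.unusedSectionVars false
set_option linter.unnecessarySeqFocus false

/-! Leaving and exiting are irreversible and there are finitely many nodes, so a computation has a
suffix in which no node changes its mode or exits (`IsComputation.exists_settled`). Two invariants
hold throughout. References point to present nodes only (`Step.clean`), since the oracle permits an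
exit only when nobody else knows the node. The present nodes stay weakly connected
(`Step.connected`), since no action loses a reference: an edge persists, is reversed, or is split at
a node strictly between its ends (`Step.link`), and an exiting node introduces its neighbours to
each other. The main tool in a settled suffix is `Settled.flush`: a class of messages dies out if
its members are created only in response to members of larger rank. It removes the arbitrary initial
messages and everything that the protocol has stopped generating.

Leaving nodes. Suppose that a present leaving node remains. Let `g` be the leftmost among those that
no leaving node on their right ever stores (`Settled.exists_exposed`). Every leaving node left of
`g` is stored by a leaving node on its own right; left references of leaving nodes are never
dropped, so it is asked forever to reverse its right edges. Hence no leaving node keeps `g`. A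
staying node does not keep `g` either (`Settled.not_forever`): it keeps introducing `g` inward, or
itself to `g`, so that either a leaving node learns of it and requests reversals forever, or a
staying node answers with a Linearize that deletes `g`. As delegation moves references to `g` only
towards `g`, an induction starting at the nodes farthest from `g` silences all nodes
(`Settled.quiet`). Then the channel of `g` drains, the oracle holds at its next Timeout, and `g`
exits, a contradiction (`Settled.no_leaves`).

Staying nodes. Eventually the edges that do not come from probes connect the present nodes
(`Settled.link_connected`). For any cut, a crossing edge with the fewest nodes between its ends,
over all late times, can never be split, so both ends end up storing each other forever
(`Settled.exists_permanent`). On each side a node has at most one such permanent neighbour, so the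
permanent edges form a path that visits all staying nodes in order (`Settled.permanent_of_lt`). All
longer edges die out, again from the outside inward (`Settled.not_mem_of_btw`), which gives
legitimacy.

Closure (`Step.isLegitimate`) holds because, in a legitimate state, a comparison with the closest
neighbours rejects every new present reference, and no message that saves without comparison is in
transit or generated. -/

namespace BuildList

/-! ### Sides, betweenness and the sanity check. -/

section LocalFacts

variable {V I : Type*} [LinearOrder V]

/-- `y` lies strictly between `a` and `b`. -/
def Btw (a y b : V) : Prop := (a < y ∧ y < b) ∨ (b < y ∧ y < a)

/-- `b` is a reference other than `u` in the local memory `x` of `u`. -/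
def NodeState.Mem (u : V) (x : NodeState V I) (b : V) : Prop := b ∈ x.refs ∧ b ≠ u

/-- After the sanity check, `u` stores `b` in `Left` or `Right`. -/
def NodeState.Nb (u : V) (x : NodeState V I) (b : V) : Prop :=
  b ∈ (sanitize u x).nbr .left ∨ b ∈ (sanitize u x).nbr .right

theorem sideOf_eq_some {u v : V} {d : Side} : sideOf u v = some d ↔ OnSide d u v := by
  cases d <;> simp only [sideOf, OnSide] <;> grind

theorem sideOf_eq_none {u v : V} : sideOf u v = none ↔ v = u := by
  simp only [sideOf]; grind

theorem OnSide.ne {d : Side} {u v : V} (h : OnSide d u v) : v ≠ u := by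
  cases d <;> simp only [OnSide] at h <;> grind

theorem exists_onSide {u v : V} (h : v ≠ u) : ∃ d, OnSide d u v := by
  rcases lt_or_gt_of_ne h with h | h
  exacts [⟨.left, h⟩, ⟨.right, h⟩]

theorem OnSide.unique {d d' : Side} {u v : V} (h : OnSide d u v) (h' : OnSide d' u v) :
    d = d' := by
  cases d <;> cases d' <;> simp only [OnSide] at * <;> grind

theorem other_other (d : Side) : d.other.other = d := by cases d <;> rfl

theorem onSide_other {d : Side} {u v : V} : OnSide d.other u v ↔ OnSide d v u := by
  cases d <;> rfl

/-- Bridge from the directed code to the symmetric relation `Btw`, which lets the later arguments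
treat both sides at once. -/
theorem onSide_other_iff_btw {d : Side} {u y v : V} (h : OnSide d u y) (h2 : OnSide d u v) :
    OnSide d.other v y ↔ Btw u y v := by
  cases d <;> simp only [OnSide, Side.other, Btw] at * <;> grind

theorem Btw.onSide {d : Side} {u y v : V} (h : Btw u y v) : OnSide d u y ↔ OnSide d u v := by
  cases d <;> simp only [OnSide, Btw] at * <;> grind

theorem Btw.ne_left {a y b : V} (h : Btw a y b) : y ≠ a := by unfold Btw at h; grind

theorem Btw.ne_right {a y b : V} (h : Btw a y b) : y ≠ b := by unfold Btw at h; grind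

theorem Btw.ne {a y b : V} (h : Btw a y b) : b ≠ a := by unfold Btw at h; grind

theorem Btw.symm {a y b : V} (h : Btw a y b) : Btw b y a := by unfold Btw at *; grind

theorem nearest_eq_some {d : Side} {S : Finset V} {y : V} :
    nearest d S = some y ↔ y ∈ S ∧ ∀ w ∈ S, ¬ OnSide d.other y w := by
  unfold nearest
  split_ifs with h
  · cases d <;> simp only [Option.some.injEq, Side.other, OnSide, not_lt]
    · rw [Finset.max'_eq_iff]
    · rw [Finset.min'_eq_iff]
  · simp only [false_iff, not_and]
    exact fun hy => absurd ⟨y, hy⟩ h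

theorem nearest_eq_none {d : Side} {S : Finset V} : nearest d S = none ↔ S = ∅ := by
  unfold nearest
  split_ifs with h
  · cases d <;> simp [h.ne_empty]
  · simpa [Finset.not_nonempty_iff_eq_empty] using h

theorem nextInward_eq_some {d : Side} {S : Finset V} {v z : V} :
    nextInward d S v = some z ↔
      (z ∈ S ∧ OnSide d.other v z) ∧ ∀ w ∈ S, OnSide d.other v w → ¬ OnSide d z w := by
  unfold nextInward
  rw [nearest_eq_some]
  simp only [Finset.mem_filter, other_other, and_imp]

theorem mem_sendOpt {o : Option V} {m m' : Msg V I} {a : V} :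
    (a, m') ∈ sendOpt o m ↔ o = some a ∧ m' = m := by
  cases o <;> simp [sendOpt, eq_comm]

theorem mem_sendAllTo {u a : V} {S : Finset V} {f : V → Msg V I} {m' : Msg V I} :
    (a, m') ∈ sendAllTo u S f ↔ a = u ∧ ∃ v ∈ S, m' = f v := by
  simp only [sendAllTo, Multiset.mem_map, Finset.mem_val, Prod.mk.injEq]
  grind

theorem mem_refs {x : NodeState V I} {b : V} :
    b ∈ x.refs ↔ ∃ d, b ∈ x.nbr d ∨ b ∈ x.tmp d := by
  simp only [NodeState.refs, Finset.mem_union]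
  constructor
  · rintro ((h | h) | (h | h))
    exacts [⟨_, .inl h⟩, ⟨_, .inl h⟩, ⟨_, .inr h⟩, ⟨_, .inr h⟩]
  · rintro ⟨_ | _, h | h⟩ <;> simp [h]

theorem mem_nbr_sanitize {u : V} {x : NodeState V I} {b : V} {d : Side} :
    b ∈ (sanitize u x).nbr d ↔ x.Nb u b ∧ OnSide d u b := by
  unfold NodeState.Nb sanitize
  rcases hm : x.mode <;> cases d <;> simp only [OnSide] <;> grind

/-- The sanity check of a staying node merges the temporary sets into `Left` and `Right`. For a
leaving node `Nb` can be strictly smaller than `Mem`, and the proof depends on this difference. -/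
theorem Nb_of_staying {u : V} {x : NodeState V I} {b : V} (h : x.mode = .staying) :
    x.Nb u b ↔ x.Mem u b := by
  unfold NodeState.Nb sanitize NodeState.Mem
  simp only [h, OnSide]; grind

theorem Nb_of_leaving {u : V} {x : NodeState V I} {b : V} (h : x.mode = .leaving) :
    x.Nb u b ↔ (b ∈ x.nbr .left ∨ b ∈ x.nbr .right) ∧ b ≠ u := by
  unfold NodeState.Nb sanitize
  simp only [h, OnSide]; grind

theorem NodeState.Nb.mem {u : V} {x : NodeState V I} {b : V} (h : x.Nb u b) : x.Mem u b := by
  unfold NodeState.Nb sanitize at h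
  unfold NodeState.Mem NodeState.refs
  rcases hm : x.mode <;> simp only [hm, NodeState.refs, Finset.mem_union, OnSide]
    at * <;> grind

theorem mem_nbr_or_tmp_sanitize {u : V} {x : NodeState V I} {b : V} {d : Side} :
    b ∈ (sanitize u x).nbr d ∪ (sanitize u x).tmp d ↔ x.Mem u b ∧ OnSide d u b := by
  unfold NodeState.Mem sanitize NodeState.refs
  rcases hm : x.mode <;> cases d <;>
    simp only [Finset.mem_union, OnSide, Finset.notMem_empty] <;> grind

theorem mem_tmp_sanitize {u : V} {x : NodeState V I} {b : V} {d : Side}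
    (h : b ∈ (sanitize u x).tmp d) : x.mode = .leaving ∧ x.Mem u b ∧ OnSide d u b := by
  refine ⟨?_, mem_nbr_or_tmp_sanitize.1 (Finset.mem_union_right _ h)⟩
  rcases hm : x.mode with _ | _
  · simp [sanitize, hm] at h
  · rfl

theorem mem_refs_sanitize {u : V} {x : NodeState V I} {b : V} :
    b ∈ (sanitize u x).refs ↔ x.Mem u b := by
  rw [mem_refs]
  simp only [← Finset.mem_union, mem_nbr_or_tmp_sanitize]
  exact ⟨fun ⟨_, h⟩ => h.1, fun h => (exists_onSide h.2).imp fun _ h' => ⟨h, h'⟩⟩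

theorem Mem_sanitize {u : V} {x : NodeState V I} {b : V} :
    (sanitize u x).Mem u b ↔ x.Mem u b :=
  ⟨fun h => mem_refs_sanitize.1 h.1, fun h => ⟨mem_refs_sanitize.2 h, h.2⟩⟩

theorem Nb_sanitize {u : V} {x : NodeState V I} {b : V} :
    (sanitize u x).Nb u b ↔ x.Nb u b := by
  rcases hm : x.mode with _ | _
  · rw [Nb_of_staying hm, Nb_of_staying (x := sanitize u x) hm, Mem_sanitize]
  · rw [Nb_of_leaving (x := sanitize u x) hm]
    unfold NodeState.Nb
    exact ⟨fun h => h.1, fun h => ⟨h, (NodeState.Nb.mem h).2⟩⟩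

/-- The side drops out because a neighbour on the other side of `u` is neither `v` nor between `u`
and `v`. -/
theorem closer_sanitize {u v : V} {x : NodeState V I} {d : Side} (h : OnSide d u v) :
    (sanitize u x).Closer d v ↔ ∀ y, x.Nb u y → y ≠ v ∧ ¬ Btw u y v := by
  unfold NodeState.Closer
  simp only [mem_nbr_sanitize, and_imp]
  constructor
  · intro H y hy
    by_cases hs : OnSide d u y
    · have := H y hy hs
      cases d <;> simp only [OnSide, Side.other, Btw] at * <;> grind
    · refine ⟨fun e => hs (e ▸ h), fun e => hs (e.onSide.2 h)⟩
  · intro H y hy hs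
    have := H y hy
    cases d <;> simp only [OnSide, Side.other, Btw] at * <;> grind

theorem nearest_sanitize {u y : V} {x : NodeState V I} {d : Side} :
    nearest d ((sanitize u x).nbr d) = some y ↔
      x.Nb u y ∧ OnSide d u y ∧ ∀ w, x.Nb u w → ¬ Btw u w y := by
  rw [nearest_eq_some, mem_nbr_sanitize]
  constructor
  · rintro ⟨⟨h1, h2⟩, h3⟩
    refine ⟨h1, h2, fun w hw hb => ?_⟩
    have hs := hb.onSide.2 h2
    exact h3 w (mem_nbr_sanitize.2 ⟨hw, hs⟩) ((onSide_other_iff_btw hs h2).2 hb)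
  · rintro ⟨h1, h2, h3⟩
    refine ⟨⟨h1, h2⟩, fun w hw hb => ?_⟩
    rw [mem_nbr_sanitize] at hw
    exact h3 w hw.1 ((onSide_other_iff_btw hw.2 h2).1 hb)

theorem nextInward_sanitize {u v z : V} {x : NodeState V I} {d : Side} (hv : OnSide d u v) :
    nextInward d ((sanitize u x).nbr d) v = some z ↔
      x.Nb u z ∧ Btw u z v ∧ ∀ w, x.Nb u w → ¬ Btw z w v := by
  rw [nextInward_eq_some, mem_nbr_sanitize]
  constructor
  · rintro ⟨⟨⟨h1, h2⟩, h3⟩, h4⟩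
    have hb := (onSide_other_iff_btw h2 hv).1 h3
    refine ⟨h1, hb, fun w hw hb' => ?_⟩
    have := h4 w
    simp only [mem_nbr_sanitize] at this
    cases d <;> simp only [OnSide, Side.other, Btw] at * <;> grind
  · rintro ⟨h1, h2, h4⟩
    have hs := h2.onSide.2 hv
    refine ⟨⟨⟨h1, hs⟩, (onSide_other_iff_btw hs hv).2 h2⟩, fun w hw hb hc => ?_⟩
    rw [mem_nbr_sanitize] at hw
    have := h4 w hw.1
    cases d <;> simp only [OnSide, Side.other, Btw] at * <;> grind

theorem exists_nearest {u b : V} {x : NodeState V I} {d : Side} (hb : x.Nb u b)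
    (hs : OnSide d u b) :
    ∃ y, nearest d ((sanitize u x).nbr d) = some y ∧ (y = b ∨ Btw u y b) := by
  rcases h : nearest d ((sanitize u x).nbr d) with _ | y
  · rw [nearest_eq_none] at h
    exact absurd (mem_nbr_sanitize.2 ⟨hb, hs⟩) (by simp [h])
  · refine ⟨y, rfl, ?_⟩
    rw [nearest_sanitize] at h
    obtain ⟨h1, h2, h3⟩ := h
    have := h3 b hb
    cases d <;> simp only [OnSide, Btw] at * <;> grind

theorem exists_nextInward {u b z : V} {x : NodeState V I} {d : Side} (hs : OnSide d u b)
    (hz : x.Nb u z) (hb : Btw u z b) :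
    ∃ y, nextInward d ((sanitize u x).nbr d) b = some y := by
  rcases h : nextInward d ((sanitize u x).nbr d) b with _ | y
  · rw [nextInward, nearest_eq_none] at h
    have hz' := hb.onSide.2 hs
    exact absurd (Finset.mem_filter.2 ⟨mem_nbr_sanitize.2 ⟨hz, hz'⟩,
      (onSide_other_iff_btw hz' hs).2 hb⟩) (by simp [h])
  · exact ⟨y, rfl⟩

end LocalFacts

/-! ### Effects of Introduce, Linearize and TempDelegate. -/

section ActionFacts

variable {V I : Type*} [LinearOrder V]

theorem mem_refs_setNbr {x : NodeState V I} {d : Side} {S : Finset V} {b : V} :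
    b ∈ (x.setNbr d S).refs ↔ b ∈ S ∨ b ∈ x.nbr d.other ∨ b ∈ x.tmp .left ∨ b ∈ x.tmp .right := by
  cases d <;> simp [NodeState.refs, NodeState.setNbr, Side.other, Function.update] <;> tauto

theorem mem_refs_setTmp {x : NodeState V I} {d : Side} {S : Finset V} {b : V} :
    b ∈ (x.setTmp d S).refs ↔ b ∈ S ∨ b ∈ x.tmp d.other ∨ b ∈ x.nbr .left ∨ b ∈ x.nbr .right := by
  cases d <;> simp [NodeState.refs, NodeState.setTmp, Side.other, Function.update] <;> tauto

theorem mem_refs_iff {x : NodeState V I} {d : Side} {b : V} :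
    b ∈ x.refs ↔ b ∈ x.nbr d ∨ b ∈ x.nbr d.other ∨ b ∈ x.tmp d ∨ b ∈ x.tmp d.other := by
  cases d <;> simp [NodeState.refs, Side.other] <;> tauto

theorem mem_refs_addNbr {x : NodeState V I} {d : Side} {S : Finset V} {b : V} :
    b ∈ (x.setNbr d (x.nbr d ∪ S)).refs ↔ b ∈ x.refs ∨ b ∈ S := by
  rw [mem_refs_setNbr, mem_refs_iff (d := d)]
  cases d <;> simp [Side.other] <;> tauto

theorem mem_refs_addTmp {x : NodeState V I} {d : Side} {S : Finset V} {b : V} :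
    b ∈ (x.setTmp d (x.tmp d ∪ S)).refs ↔ b ∈ x.refs ∨ b ∈ S := by
  rw [mem_refs_setTmp, mem_refs_iff (d := d)]
  cases d <;> simp [Side.other] <;> tauto

theorem mem_refs_addTmp_sdiff {x : NodeState V I} {d : Side} {S : Finset V} {b : V} :
    b ∈ (x.setTmp d (x.tmp d ∪ (S \ x.nbr d))).refs ↔ b ∈ x.refs ∨ b ∈ S := by
  rw [mem_refs_setTmp, mem_refs_iff (d := d)]
  cases d <;> simp [Side.other] <;> tauto

theorem mem_refs_save {x : NodeState V I} {d : Side} {S : Finset V} {b : V} :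
    b ∈ (x.save d S).refs ↔ b ∈ x.refs ∨ b ∈ S := by
  unfold NodeState.save
  cases x.mode
  exacts [mem_refs_addNbr, mem_refs_addTmp]

@[simp] theorem setNbr_mode {x : NodeState V I} {d : Side} {S : Finset V} :
    (x.setNbr d S).mode = x.mode := rfl

@[simp] theorem setTmp_mode {x : NodeState V I} {d : Side} {S : Finset V} :
    (x.setTmp d S).mode = x.mode := rfl

@[simp] theorem sanitize_mode {u : V} {x : NodeState V I} : (sanitize u x).mode = x.mode := rfl

theorem sanitize_value {u b : V} {x : NodeState V I} (h : x.Mem u b) :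
    (sanitize u x).uniqueValues b = x.uniqueValues b := by
  simp [sanitize, h.1]

/-! ### Introduce, Linearize, TempDelegate -/

theorem mem_introduce {u v b : V} {w : Option V} {x : NodeState V I} :
    (introduce u v w (sanitize u x)).1.Mem u b ↔ x.Mem u b ∨ b ≠ u ∧ v ≠ u ∧
      ((x.mode = .staying ∧ w ≠ none ∧ b = v) ∨ (x.mode = .leaving ∧ (b = v ∨ w = some b))) := by
  unfold introduce
  rcases hs : sideOf u v with _ | d
  · rw [sideOf_eq_none] at hs
    simp [hs, Mem_sanitize]
  · rw [sideOf_eq_some] at hs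
    have := hs.ne
    simp only [sanitize_mode]
    rcases hm : x.mode <;> rcases w with _ | w <;>
      simp only [NodeState.Mem, mem_refs_addNbr, mem_refs_addTmp_sdiff,
        mem_refs_sanitize, Finset.mem_singleton, Option.toFinset_some, Option.toFinset_none,
        Finset.union_empty, Finset.mem_union, reduceCtorEq, Option.some.injEq] <;> grind

theorem send_introduce {u v a : V} {w : Option V} {x : NodeState V I} {m : Msg V I} :
    (a, m) ∈ (introduce u v w (sanitize u x)).2 ↔ v ≠ u ∧ x.mode = .staying ∧
      ((∃ w', w = some w' ∧ (a = w' ∧ m = .linearize v ∨ a = u ∧ m = .tempDelegate w')) ∨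
        w = none ∧ a = u ∧ m = .tempDelegate v) := by
  unfold introduce
  rcases hs : sideOf u v with _ | d
  · rw [sideOf_eq_none] at hs
    simp [hs]
  · rw [sideOf_eq_some] at hs
    have := hs.ne
    simp only [sanitize_mode]
    rcases hm : x.mode <;> rcases w with _ | w <;> simp [this]

/-- For a stored `v`, not being the closest neighbour on its side means that some stored `z` is
strictly between; for a `v` that is not stored the removal has no effect. -/
theorem mem_linearize {u v b : V} {x : NodeState V I} :
    (linearize u v (sanitize u x)).1.Mem u b ↔
      (x.mode = .staying ∧ x.Mem u b ∧ ¬ (b = v ∧ ∃ z, x.Mem u z ∧ Btw u z v)) ∨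
      (x.mode = .leaving ∧ (x.Mem u b ∨ b ≠ u ∧ b = v)) := by
  unfold linearize
  rcases hs : sideOf u v with _ | d
  · rw [sideOf_eq_none] at hs
    rcases hm : x.mode <;> simp [hs, Mem_sanitize]
    rintro h rfl
    exact absurd rfl h.2
  · rw [sideOf_eq_some] at hs
    have := hs.ne
    simp only [sanitize_mode]
    rcases hm : x.mode with _ | _
    · rcases hn : nearest d ((sanitize u x).nbr d) with _ | y
      · simp only [Mem_sanitize, true_and, reduceCtorEq, false_and, or_false]
        rw [nearest_eq_none] at hn
        constructor
        · refine fun h => ⟨h, ?_⟩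
          rintro ⟨rfl, z, hz, hb⟩
          have : z ∈ (sanitize u x).nbr d :=
            mem_nbr_sanitize.2 ⟨(Nb_of_staying hm).2 hz, hb.onSide.2 hs⟩
          simp [hn] at this
        · exact fun h => h.1
      · rw [nearest_sanitize] at hn
        obtain ⟨h1, h2, h3⟩ := hn
        by_cases hv : v = y
        · subst hv
          simp only [if_true, Mem_sanitize, true_and, reduceCtorEq, false_and, or_false]
          refine ⟨fun h => ⟨h, ?_⟩, fun h => h.1⟩
          rintro ⟨rfl, z, hz, hb⟩
          exact h3 z ((Nb_of_staying hm).2 hz) hb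
        · simp only [hv, if_false, true_and, reduceCtorEq, false_and, or_false]
          have key : x.Mem u v → Btw u y v := fun h => by
            have := h3 v ((Nb_of_staying hm).2 h)
            cases d <;> simp only [OnSide, Btw] at * <;> grind
          have hnb : ∀ d', ∀ b, b ∈ (sanitize u x).nbr d' ↔ x.Mem u b ∧ OnSide d' u b := by
            intro d' b; rw [mem_nbr_sanitize, Nb_of_staying hm]
          have ht : ∀ d', (sanitize u x).tmp d' = ∅ := by simp [sanitize, hm]
          simp only [NodeState.Mem, mem_refs_setNbr, ht, Finset.mem_sdiff, hnb,
            Finset.mem_singleton, Finset.notMem_empty, or_false]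
          constructor
          · rintro ⟨⟨⟨h, -⟩, hne⟩ | ⟨h, hd⟩, h'⟩
            · exact ⟨h, fun e => hne e.1⟩
            · refine ⟨h, fun e => ?_⟩
              rw [e.1] at hd
              cases d <;> simp only [OnSide, Side.other] at * <;> grind
          · rintro ⟨h, hn⟩
            refine ⟨?_, h.2⟩
            by_cases hb : b = v
            · subst hb
              exact absurd ⟨rfl, y, h1.mem, key h⟩ hn
            · obtain ⟨d', hd'⟩ := exists_onSide h.2
              cases d <;> cases d' <;> simp only [OnSide, Side.other] at * <;> tauto
    · simp only [NodeState.Mem, mem_refs_addTmp, mem_refs_sanitize, Finset.mem_singleton,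
        reduceCtorEq, false_and, false_or, true_and]
      grind

theorem send_linearize {u v a : V} {x : NodeState V I} {m : Msg V I}
    (h : (a, m) ∈ (linearize u v (sanitize u x)).2) :
    v ≠ u ∧ x.mode = .staying ∧ m = .tempDelegate v ∧ (a = u ∨ x.Mem u a ∧ Btw u a v) := by
  unfold linearize at h
  rcases hs : sideOf u v with _ | d
  · simp [hs] at h
  · simp only [hs, sanitize_mode] at h
    rw [sideOf_eq_some] at hs
    rcases hm : x.mode with _ | _
    · simp only [hm] at h
      rcases hn : nearest d ((sanitize u x).nbr d) with _ | y
      · simp [hn] at h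
        simp [h, hs.ne]
      · simp only [hn] at h
        split_ifs at h with hv
        · simp at h
          simp [h, hs.ne]
        · simp only [Multiset.mem_add, Multiset.mem_singleton, Prod.mk.injEq, mem_sendOpt] at h
          rcases h with h | ⟨h, h'⟩
          · simp [h, hs.ne]
          · rw [nextInward_sanitize hs] at h
            exact ⟨hs.ne, rfl, h', .inr ⟨h.1.mem, h.2.1⟩⟩
    · simp [hm] at h

theorem send_linearize_self {u v : V} {x : NodeState V I} (hv : v ≠ u) (hm : x.mode = .staying) :
    (u, Msg.tempDelegate v) ∈ (linearize u v (sanitize u x) : _ × Outbox V I).2 := by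
  unfold linearize
  obtain ⟨d, hs⟩ := exists_onSide hv
  simp only [sideOf_eq_some.2 hs, sanitize_mode, hm]
  split
  · simp
  · split_ifs <;> simp

/-- A removal by Linearize hands `v` to a stored node on the way, so that it amounts to a split of
the edge. -/
theorem send_linearize_inward {u v z : V} {x : NodeState V I} (hm : x.mode = .staying)
    (hz : x.Mem u z) (hb : Btw u z v) :
    ∃ y, x.Mem u y ∧ Btw u y v ∧
      (y, Msg.tempDelegate v) ∈ (linearize u v (sanitize u x) : _ × Outbox V I).2 := by
  unfold linearize
  obtain ⟨d, hs⟩ := exists_onSide hb.ne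
  simp only [sideOf_eq_some.2 hs, sanitize_mode, hm]
  rw [← Nb_of_staying hm] at hz
  obtain ⟨y, hy, hy'⟩ := exists_nearest hz (hb.onSide.2 hs)
  obtain ⟨y', hy'2⟩ := exists_nextInward hs hz hb
  simp only [hy]
  have hne : v ≠ y := by
    rintro rfl
    rcases hy' with rfl | hy'
    · exact hb.ne_right rfl
    · unfold Btw at *; grind
  simp only [hne, if_false, Multiset.mem_add, mem_sendOpt]
  have := (nextInward_sanitize hs).1 hy'2
  exact ⟨y', this.1.mem, this.2.1, .inr ⟨hy'2, trivial⟩⟩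

theorem mem_tempDelegate {u v b : V} {x : NodeState V I} :
    (tempDelegate u v (sanitize u x) : _ × Outbox V I).1.Mem u b ↔
      x.Mem u b ∨ b = v ∧ v ≠ u ∧ ∀ y, x.Nb u y → y ≠ v ∧ ¬ Btw u y v := by
  unfold tempDelegate
  rcases hs : sideOf u v with _ | d
  · rw [sideOf_eq_none] at hs
    simp [hs, Mem_sanitize]
  · rw [sideOf_eq_some] at hs
    have := hs.ne
    dsimp only
    split_ifs with h <;> rw [closer_sanitize hs] at h
    · simp only [NodeState.Mem, mem_refs_save, mem_refs_sanitize, Finset.mem_singleton]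
      constructor
      · rintro ⟨⟨h1, h2⟩ | rfl, h3⟩
        exacts [.inl ⟨h1, h2⟩, .inr ⟨rfl, this, h⟩]
      · rintro (h1 | ⟨rfl, h1, -⟩)
        exacts [⟨.inl h1, h1.2⟩, ⟨.inr rfl, h1⟩]
    · simp only [Mem_sanitize]
      exact ⟨.inl, fun h' => h'.elim id fun h' => absurd h'.2.2 h⟩

theorem send_tempDelegate {u v a : V} {x : NodeState V I} {m : Msg V I}
    (h : (a, m) ∈ (tempDelegate u v (sanitize u x)).2) :
    v ≠ u ∧ m = .tempDelegate v ∧ x.Nb u a ∧ (a = v ∨ Btw u a v) := by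
  unfold tempDelegate at h
  rcases hs : sideOf u v with _ | d
  · simp [hs] at h
  · simp only [hs] at h
    rw [sideOf_eq_some] at hs
    split_ifs at h with hc
    · simp at h
    · rw [closer_sanitize hs] at hc
      rw [mem_sendOpt, nearest_sanitize] at h
      obtain ⟨⟨h1, h2, h3⟩, h4⟩ := h
      refine ⟨hs.ne, h4, h1, ?_⟩
      push Not at hc
      obtain ⟨y, hy, hy'⟩ := hc
      have := h3 y hy
      by_cases e : y = v
      · subst e
        cases d <;> simp only [OnSide, Btw] at * <;> grind
      · have := hy' e
        cases d <;> simp only [OnSide, Btw] at * <;> grind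

/-- A delegated reference is never lost: if it is not stored afterwards, a stored node strictly
closer to its target has received it. -/
theorem tempDelegate_effect {u v : V} (x : NodeState V I) (hv : v ≠ u) :
    (tempDelegate u v (sanitize u x) : _ × Outbox V I).1.Mem u v ∨
      ∃ a, x.Mem u a ∧ Btw u a v ∧
        (a, Msg.tempDelegate v) ∈ (tempDelegate u v (sanitize u x) : _ × Outbox V I).2 := by
  by_cases hmem : x.Mem u v
  · exact .inl (mem_tempDelegate.2 (.inl hmem))
  by_cases hc : ∀ y, x.Nb u y → y ≠ v ∧ ¬ Btw u y v
  · exact .inl (mem_tempDelegate.2 (.inr ⟨rfl, hv, hc⟩))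
  · right
    obtain ⟨d, hs⟩ := exists_onSide hv
    have hc' := hc
    push Not at hc'
    obtain ⟨y, hy, hy'⟩ := hc'
    have hyv : y ≠ v := by rintro rfl; exact hmem hy.mem
    have hyb := hy' hyv
    obtain ⟨z, hz, hz'⟩ := exists_nearest hy (hyb.onSide.2 hs)
    have hz2 := nearest_sanitize.1 hz
    refine ⟨z, hz2.1.mem, ?_, ?_⟩
    · rcases hz' with rfl | hz'
      · exact hyb
      · unfold Btw at *; grind
    · unfold tempDelegate
      simp only [sideOf_eq_some.2 hs]
      rw [if_neg (by rwa [closer_sanitize hs])]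
      exact mem_sendOpt.2 ⟨hz, rfl⟩

end ActionFacts

/-! ### Freshness and uniqueness of the satellite values. -/

section ValueFacts

variable {V I : Type*} [LinearOrder V]

/-- No value is stored at two nodes. -/
def NodeState.ValuesInjective (x : NodeState V I) : Prop :=
  ∀ v w k, x.uniqueValues v = some k → x.uniqueValues w = some k → v = w

/-- No value is stored at two neighbours. -/
def NodeState.ValuesUnique (x : NodeState V I) : Prop :=
  ∀ v ∈ x.refs, ∀ w ∈ x.refs, ∀ k, x.uniqueValues v = some k → x.uniqueValues w = some k → v = w

theorem sanitize_value_eq {u v : V} {x : NodeState V I} {k : ℕ}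
    (h : (sanitize u x).uniqueValues v = some k) : x.uniqueValues v = some k := by
  simp only [sanitize] at h
  grind

section Assign

variable [Fintype V] {S : Finset V} {x : NodeState V I}

theorem assignValues_of_some {v : V} {k : ℕ} (h : x.uniqueValues v = some k) :
    (assignValues S x).uniqueValues v = some k := by
  simp [assignValues, h]

theorem le_sup_values {v : V} {k : ℕ} (h : x.uniqueValues v = some k) :
    k ≤ max x.counter (Finset.univ.sup fun v => (x.uniqueValues v).getD 0) := by
  have := Finset.le_sup (f := fun v => (x.uniqueValues v).getD 0) (Finset.mem_univ v)
  simp only [h, Option.getD_some] at this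
  exact le_max_of_le_right this

theorem counter_le_assignValues : x.counter ≤ (assignValues S x).counter := by
  simp only [assignValues]
  exact le_add_right (le_max_left _ _)

/-- Together with the monotonicity of the counter this shows that a value not exceeding the counter
never acquires a new owner. -/
theorem assignValues_eq_some {v : V} {k : ℕ} (h : (assignValues S x).uniqueValues v = some k) :
    x.uniqueValues v = some k ∨ x.counter < k := by
  simp only [assignValues] at h
  split_ifs at h with hc
  · right
    simp only [Option.some.injEq] at h
    have := le_max_left x.counter (Finset.univ.sup fun v => (x.uniqueValues v).getD 0)
    omega
  · exact .inl h

theorem exists_assignValues {v : V} (hv : v ∈ S) :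
    ∃ k, (assignValues S x).uniqueValues v = some k := by
  rcases h : x.uniqueValues v with _ | k
  · simp [assignValues, h, hv]
  · exact ⟨k, assignValues_of_some h⟩

theorem assignValues_le_counter {v : V} {k : ℕ}
    (h : (assignValues S x).uniqueValues v = some k) : k ≤ (assignValues S x).counter := by
  simp only [assignValues] at h ⊢
  split_ifs at h with hc
  · simp only [Option.some.injEq] at h
    have : (S.filter (· < v)).card < S.card :=
      Finset.card_lt_card (Finset.filter_ssubset.2 ⟨v, hc.1, lt_irrefl v⟩)
    omega
  · exact le_add_right (le_sup_values h)

/-- New values exceed all stored ones, and are told apart by the number of smaller elements of `S`.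
-/
theorem ValuesInjective_assignValues (hx : x.ValuesInjective) :
    (assignValues S x).ValuesInjective := by
  intro v w k hv hw
  simp only [assignValues] at hv hw
  split_ifs at hv with h1 <;> split_ifs at hw with h2
  · simp only [Option.some.injEq] at hv hw
    by_contra hne
    have key : ∀ a b : V, a ∈ S → a < b → (S.filter (· < a)).card < (S.filter (· < b)).card := by
      intro a b ha hab
      apply Finset.card_lt_card
      rw [Finset.ssubset_iff_of_subset]
      · exact ⟨a, by simp [ha, hab], by simp⟩
      · intro c
        simp only [Finset.mem_filter, and_imp]
        exact fun hc hca => ⟨hc, hca.trans hab⟩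
    rcases lt_or_gt_of_ne hne with h | h
    · have := key v w h1.1 h
      omega
    · have := key w v h2.1 h
      omega
  · have := le_sup_values hw
    simp only [Option.some.injEq] at hv
    omega
  · have := le_sup_values hv
    simp only [Option.some.injEq] at hw
    omega
  · exact hx v w k hv hw

end Assign

/-- Uniqueness among stored neighbours becomes global injectivity because the sanity check erases
all other values. -/
theorem ValuesInjective_sanitize {u : V} {x : NodeState V I} (hx : x.ValuesUnique) :
    (sanitize u x).ValuesInjective := by
  intro v w k hv hw
  have aux : ∀ v, (sanitize u x).uniqueValues v = some k → v ∈ x.refs := by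
    intro v hv
    simp only [sanitize] at hv
    by_contra hn
    simp [hn] at hv
  exact hx v (aux v hv) w (aux w hw) k (sanitize_value_eq hv) (sanitize_value_eq hw)

theorem NodeState.ValuesInjective.unique {x : NodeState V I} (hx : x.ValuesInjective) :
    x.ValuesUnique :=
  fun v _ w _ k => hx v w k

end ValueFacts

/-! ### RevAndLinREQ, RevAndLinACK and the outcomes of RevAndLin. -/

section MoreActionFacts

variable {V I : Type*} [LinearOrder V]

theorem owner_eq_some {x : NodeState V I} {k : ℕ} {v : V} (h : owner k x = some v) :
    v ∈ x.refs ∧ x.uniqueValues v = some k := by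
  unfold owner at h
  rw [nearest_eq_some] at h
  simpa using h.1

theorem owner_eq {x : NodeState V I} {k : ℕ} {v : V} (hx : x.ValuesInjective) (hv : v ∈ x.refs)
    (hk : x.uniqueValues v = some k) : owner k x = some v := by
  rcases h : owner k x with _ | w
  · unfold owner at h
    rw [nearest_eq_none] at h
    have : v ∈ x.refs.filter fun v => x.uniqueValues v = some k := by simp [hv, hk]
    simp [h] at this
  · rw [hx w v k (owner_eq_some h).2 hk]

/-! ### RevAndLinREQ and RevAndLinACK -/

section Req

variable [Fintype V]

theorem refs_revAndLinReq {u : V} {d : Side} {x : NodeState V I} :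
    (revAndLinReq u d x).1.nbr = x.nbr ∧ (revAndLinReq u d x).1.tmp = x.tmp ∧
    (revAndLinReq u d x).1.mode = x.mode := by
  unfold revAndLinReq
  split <;> simp [assignValues]

theorem revAndLinReq_value {u v : V} {d : Side} {x : NodeState V I} {k : ℕ}
    (h : x.uniqueValues v = some k) : (revAndLinReq u d x).1.uniqueValues v = some k := by
  unfold revAndLinReq
  split
  exacts [h, assignValues_of_some h]

theorem revAndLinReq_value_eq {u v : V} {d : Side} {x : NodeState V I} {k : ℕ}
    (h : (revAndLinReq u d x).1.uniqueValues v = some k) :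
    x.uniqueValues v = some k ∨ x.counter < k := by
  unfold revAndLinReq at h
  split at h
  exacts [.inl h, assignValues_eq_some h]

theorem counter_le_revAndLinReq {u : V} {d : Side} {x : NodeState V I} :
    x.counter ≤ (revAndLinReq u d x).1.counter := by
  unfold revAndLinReq
  split
  exacts [le_rfl, counter_le_assignValues]

theorem ValuesInjective_revAndLinReq {u : V} {d : Side} {x : NodeState V I}
    (hx : x.ValuesInjective) : (revAndLinReq u d x).1.ValuesInjective := by
  unfold revAndLinReq
  split
  exacts [hx, ValuesInjective_assignValues hx]

theorem send_revAndLinReq {u a : V} {d : Side} {x : NodeState V I} {m : Msg V I} :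
    (a, m) ∈ (revAndLinReq u d (sanitize u x)).2 ↔
      (x.mode = .staying ∨ d = .right) ∧ x.Mem u a ∧ OnSide d u a ∧
      ∃ k, (revAndLinReq u d (sanitize u x)).1.uniqueValues a = some k ∧
        k ≤ (revAndLinReq u d (sanitize u x)).1.counter ∧ m = .revAndLinAck u k := by
  -- The default `0` of `getD` is never used: after `assignValues` every element of the set has a
  -- value.
  have key : ∀ y : NodeState V I, (a, m) ∈ ((y.nbr d ∪ y.tmp d).val.map fun v =>
      (v, Msg.revAndLinAck (I := I) u
        (((assignValues (y.nbr d ∪ y.tmp d) y).uniqueValues v).getD 0))) ↔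
      a ∈ y.nbr d ∪ y.tmp d ∧ ∃ k, (assignValues (y.nbr d ∪ y.tmp d) y).uniqueValues a = some k ∧
        k ≤ (assignValues (y.nbr d ∪ y.tmp d) y).counter ∧ m = .revAndLinAck u k := by
    intro y
    simp only [Multiset.mem_map, Finset.mem_val, Prod.mk.injEq]
    constructor
    · rintro ⟨v, hv, rfl, rfl⟩
      obtain ⟨k, hk⟩ := exists_assignValues (x := y) hv
      exact ⟨hv, k, hk, assignValues_le_counter hk, by simp [hk]⟩
    · rintro ⟨ha, k, hk, -, rfl⟩
      exact ⟨a, ha, rfl, by simp [hk]⟩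
  rcases hm : x.mode <;> cases d <;>
    simp only [revAndLinReq, sanitize_mode, hm, reduceCtorEq, or_false, or_true, false_and,
      true_and, Multiset.notMem_zero] <;>
    rw [key, mem_nbr_or_tmp_sanitize, and_assoc]

end Req

theorem mem_revAndLinAck {u v b : V} {k : ℕ} {x : NodeState V I} :
    (revAndLinAck u v k (sanitize u x) : _ × Outbox V I).1.Mem u b ↔
      x.Mem u b ∨ x.mode = .leaving ∧ b ≠ u ∧ b = v := by
  unfold revAndLinAck
  rcases hs : sideOf u v with _ | d
  · rw [sideOf_eq_none] at hs
    simp [hs, Mem_sanitize]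
  · rw [sideOf_eq_some] at hs
    have := hs.ne
    simp only [sanitize_mode]
    rcases hm : x.mode <;>
      simp only [NodeState.Mem, mem_refs_addTmp, mem_refs_sanitize,
        Finset.mem_singleton, reduceCtorEq] <;> grind

/-- The list that a leaving `u` returns to `v` contains only nodes beyond `u` as seen from `v`.
Temporary references are not included, which is why `Nb` appears here. -/
theorem send_revAndLinAck {u v a : V} {k : ℕ} {x : NodeState V I} {m : Msg V I} :
    (a, m) ∈ (revAndLinAck u v k (sanitize u x)).2 ↔ v ≠ u ∧
      (x.mode = .staying ∧ a = u ∧ m = .tempDelegate v ∨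
       x.mode = .leaving ∧ a = v ∧ ∃ N, m = .revAndLin N k ∧
        ∀ n, n ∈ N ↔ x.Nb u n ∧ Btw v u n) := by
  unfold revAndLinAck
  rcases hs : sideOf u v with _ | d
  · rw [sideOf_eq_none] at hs
    simp [hs]
  · rw [sideOf_eq_some] at hs
    have hne := hs.ne
    have hb : ∀ n, OnSide d.other u n ↔ Btw v u n := by
      intro n
      cases d <;> simp only [OnSide, Side.other, Btw] at * <;> grind
    simp only [sanitize_mode]
    rcases hm : x.mode
    · simp [hne]
    · simp only [hne, ne_eq, not_false_eq_true, true_and, Multiset.mem_singleton, Prod.mk.injEq,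
        reduceCtorEq, false_and, false_or, ← hb]
      constructor
      · rintro ⟨rfl, rfl⟩
        exact ⟨rfl, _, rfl, fun n => mem_nbr_sanitize⟩
      · rintro ⟨rfl, N, rfl, hN⟩
        refine ⟨rfl, ?_⟩
        congr 1
        ext n
        rw [hN, mem_nbr_sanitize]

/-! ### RevAndLin -/

theorem revAndLin_cases (u : V) (N : Finset V) (k : ℕ) (x : NodeState V I) :
    revAndLin u N k x = (x, sendAllTo u N .tempDelegate) ∨
    ∃ v d, v ∈ x.refs ∧ x.uniqueValues v = some k ∧ OnSide d u v ∧
      (x.mode = .staying ∧ revAndLin u N k x =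
          (x.setNbr d ((x.nbr d ∪ N) \ {v}), {(v, .introduce u none)}) ∨
       x.mode = .leaving ∧ d = .left ∧ revAndLin u N k x =
          (x.setTmp .left (x.tmp .left ∪ N), 0) ∨
       x.mode = .leaving ∧ d = .right ∧ revAndLin u N k x =
          (if v ∈ x.nbr .right then x.setNbr .right ((x.nbr .right ∪ N) \ {v})
            else x.setTmp .right ((x.tmp .right ∪ N) \ {v}), {(v, .introduce u none)})) := by
  unfold revAndLin
  split_ifs with h1
  · rcases ho : owner k x with _ | v
    · exact .inl rfl
    · rcases hs : sideOf u v with _ | d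
      · simp only
        split <;> simp_all
      · right
        refine ⟨v, d, (owner_eq_some ho).1, (owner_eq_some ho).2, sideOf_eq_some.1 hs, ?_⟩
        rcases hm : x.mode <;> cases d <;> simp [hs]
  · exact .inl rfl

theorem revAndLin_of_owner {u v : V} {N : Finset V} {k : ℕ} {x : NodeState V I} {d : Side}
    (hx : x.ValuesInjective) (hv : v ∈ x.refs) (hk : x.uniqueValues v = some k)
    (hd : OnSide d u v) (hN : OneSided u N) :
    (x.mode = .staying → revAndLin u N k x =
          (x.setNbr d ((x.nbr d ∪ N) \ {v}), {(v, .introduce u none)})) ∧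
    (x.mode = .leaving → d = .right → revAndLin u N k x =
          (if v ∈ x.nbr .right then x.setNbr .right ((x.nbr .right ∪ N) \ {v})
            else x.setTmp .right ((x.tmp .right ∪ N) \ {v}), {(v, .introduce u none)})) := by
  have ho := owner_eq hx hv hk
  have hs := sideOf_eq_some.2 hd
  unfold revAndLin
  rw [if_pos hN]
  simp only [ho, hs]
  constructor
  · intro hm
    simp [hm]
  · rintro hm rfl
    simp [hm]

end MoreActionFacts

/-! ### Conservation and removal of references in RevAndLin. -/

section RevAndLinFacts

variable {V I : Type*} [LinearOrder V]

theorem send_revAndLin {u a : V} {N : Finset V} {k : ℕ} {x : NodeState V I} {m : Msg V I}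
    (h : (a, m) ∈ (revAndLin u N k (sanitize u x)).2) :
    (a = u ∧ ∃ n ∈ N, m = .tempDelegate n) ∨
      (m = .introduce u none ∧ x.Mem u a ∧ x.uniqueValues a = some k ∧
        (x.mode = .staying ∨ u < a)) := by
  rcases revAndLin_cases u N k (sanitize u x) with h' | ⟨v, d, hv, hk, hd, h'⟩
  · rw [h', mem_sendAllTo] at h
    exact .inl h
  · right
    have hv' := mem_refs_sanitize.1 hv
    rw [sanitize_value hv'] at hk
    rcases h' with ⟨hm, h'⟩ | ⟨hm, rfl, h'⟩ | ⟨hm, rfl, h'⟩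
    · rw [h'] at h
      simp only [Multiset.mem_singleton, Prod.mk.injEq] at h
      rw [h.1]
      exact ⟨h.2, hv', hk, .inl hm⟩
    · rw [h'] at h
      simp at h
    · rw [h'] at h
      simp only [Multiset.mem_singleton, Prod.mk.injEq] at h
      rw [h.1]
      exact ⟨h.2, hv', hk, .inr hd⟩

theorem mem_of_revAndLin {u b : V} {N : Finset V} {k : ℕ} {x : NodeState V I}
    (h : (revAndLin u N k (sanitize u x)).1.Mem u b) : x.Mem u b ∨ b ∈ N := by
  by_contra hc
  push Not at hc
  have hr : b ∉ (sanitize u x).refs := fun h => hc.1 (mem_refs_sanitize.1 h)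
  have hr' := hr
  simp only [NodeState.refs, Finset.mem_union, not_or] at hr'
  obtain ⟨⟨r1, r2⟩, r3, r4⟩ := hr'
  rcases revAndLin_cases u N k (sanitize u x) with h' | ⟨v, d, -, -, -, h'⟩
  · rw [h'] at h
    exact hr h.1
  · rcases h' with ⟨-, h'⟩ | ⟨-, rfl, h'⟩ | ⟨-, rfl, h'⟩ <;> rw [h'] at h <;> obtain ⟨h, -⟩ := h
    · rw [mem_refs_setNbr] at h
      cases d <;> simp [Side.other, r1, r2, r3, r4, hc.2] at h
    · rw [mem_refs_setTmp] at h
      simp [Side.other, r1, r2, r3, r4, hc.2] at h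
    · dsimp only at h
      split_ifs at h
      · rw [mem_refs_setNbr] at h
        simp [Side.other, r1, r2, r3, r4, hc.2] at h
      · rw [mem_refs_setTmp] at h
        simp [Side.other, r1, r2, r3, r4, hc.2] at h

/-- No reference is lost: only the owner of the value is dropped, and it receives the reversed edge
in an Introduce message. -/
theorem mem_revAndLin_or {u b : V} {N : Finset V} {k : ℕ} {x : NodeState V I}
    (h : x.Mem u b ∨ b ∈ N) (hb : b ≠ u) :
    (revAndLin u N k (sanitize u x)).1.Mem u b ∨
    (¬ x.Mem u b ∧ (u, Msg.tempDelegate b) ∈ (revAndLin u N k (sanitize u x)).2) ∨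
    (x.Mem u b ∧ x.uniqueValues b = some k ∧ (x.mode = .staying ∨ u < b) ∧
      (b, Msg.introduce u none) ∈ (revAndLin u N k (sanitize u x)).2) := by
  rcases revAndLin_cases u N k (sanitize u x) with h' | ⟨v, d, hv, hk, hd, h'⟩
  · rw [h']
    by_cases hc : x.Mem u b
    · exact .inl (Mem_sanitize.2 hc)
    · exact .inr (.inl ⟨hc, mem_sendAllTo.2 ⟨rfl, b, h.resolve_left hc, rfl⟩⟩)
  · have hv' := mem_refs_sanitize.1 hv
    rw [sanitize_value hv'] at hk
    have key : b ≠ v → b ∈ (sanitize u x).refs ∨ b ∈ N := fun _ => h.imp_left mem_refs_sanitize.2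
    rcases h' with ⟨hm, h'⟩ | ⟨hm, rfl, h'⟩ | ⟨hm, rfl, h'⟩ <;> rw [h'] <;> clear h'
    · by_cases hbv : b = v
      · subst hbv
        exact .inr (.inr ⟨hv', hk, .inl hm, by simp⟩)
      · left
        refine ⟨?_, hb⟩
        rw [mem_refs_setNbr]
        rcases key hbv with h | h
        · rw [mem_refs_iff (d := d)] at h
          cases d <;> simp only [Side.other, Finset.mem_sdiff, Finset.mem_union,
            Finset.mem_singleton] at * <;> tauto
        · simp [h, hbv]
    · left
      refine ⟨?_, hb⟩
      rw [mem_refs_addTmp]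
      exact h.imp_left mem_refs_sanitize.2
    · by_cases hbv : b = v
      · subst hbv
        exact .inr (.inr ⟨hv', hk, .inr hd, by simp⟩)
      · left
        refine ⟨?_, hb⟩
        dsimp only
        split_ifs
        · rw [mem_refs_setNbr]
          rcases key hbv with h | h
          · rw [mem_refs_iff (d := .right)] at h
            simp only [Side.other, Finset.mem_sdiff, Finset.mem_union,
              Finset.mem_singleton] at * <;> tauto
          · simp [h, hbv]
        · rw [mem_refs_setTmp]
          rcases key hbv with h | h
          · rw [mem_refs_iff (d := .right)] at h
            simp only [Side.other, Finset.mem_sdiff, Finset.mem_union,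
              Finset.mem_singleton] at * <;> tauto
          · simp [h, hbv]

theorem Nb_of_revAndLin {u b : V} {N : Finset V} {k : ℕ} {x : NodeState V I}
    (hm : x.mode = .leaving) (h : (revAndLin u N k (sanitize u x)).1.Nb u b) :
    x.Nb u b ∨ b ∈ N := by
  have hL : b ∈ (sanitize u x).nbr .left → x.Nb u b := fun h => (mem_nbr_sanitize.1 h).1
  have hR : b ∈ (sanitize u x).nbr .right → x.Nb u b := fun h => (mem_nbr_sanitize.1 h).1
  rcases revAndLin_cases u N k (sanitize u x) with h' | ⟨v, d, -, -, -, h'⟩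
  · rw [h', Nb_sanitize] at h
    exact .inl h
  · rcases h' with ⟨h2, h'⟩ | ⟨-, rfl, h'⟩ | ⟨-, rfl, h'⟩
    · simp [hm] at h2
    · rw [h', Nb_of_leaving (by simpa using hm)] at h
      exact .inl (h.1.elim hL hR)
    · rw [h', Nb_of_leaving (by dsimp only; split_ifs <;> simpa using hm)] at h
      dsimp only at h
      split_ifs at h
      · simp [NodeState.setNbr] at h
        tauto
      · exact .inl (h.1.elim hL hR)

/-- As all of `N` lies beyond `g`, the list is one-sided and not rejected, and uniqueness of values
makes `g` the owner. A leaving node clears `Right` if `g` is there and `TempRight` only otherwise;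
hence the separate conclusions about `Nb` and `Mem`. -/
theorem revAndLin_drop {u g : V} {N : Finset V} {k : ℕ} {x : NodeState V I}
    (hx : x.ValuesUnique) (hg : x.Mem u g) (hk : x.uniqueValues g = some k)
    (hN : ∀ n ∈ N, Btw u g n) :
    (x.mode = .staying → ¬ (revAndLin u N k (sanitize u x)).1.Mem u g) ∧
    (x.mode = .leaving → u < g → x.Nb u g → ¬ (revAndLin u N k (sanitize u x)).1.Nb u g) ∧
    (x.mode = .leaving → u < g → ¬ x.Nb u g → ¬ (revAndLin u N k (sanitize u x)).1.Mem u g) := by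
  obtain ⟨d, hd⟩ := exists_onSide hg.2
  have hO : OneSided u N := by
    unfold OneSided
    rcases d with _ | _
    · exact .inl fun n hn => by have := hN n hn; simp only [OnSide, Btw] at *; grind
    · exact .inr fun n hn => by have := hN n hn; simp only [OnSide, Btw] at *; grind
  obtain ⟨h1, h2⟩ := revAndLin_of_owner (ValuesInjective_sanitize hx) (mem_refs_sanitize.2 hg)
    ((sanitize_value hg).trans hk) hd hO
  have hno : ∀ d', g ∈ (sanitize u x).nbr d' → d' = d := fun d' h =>
    (mem_nbr_sanitize.1 h).2.unique hd
  have hno' : ∀ d', g ∈ (sanitize u x).tmp d' → x.mode = .leaving ∧ d' = d := fun d' h =>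
    ⟨(mem_tmp_sanitize h).1, (mem_tmp_sanitize h).2.2.unique hd⟩
  suffices H : x.mode = .leaving → u < g →
      ((x.Nb u g → ¬ (revAndLin u N k (sanitize u x)).1.Nb u g) ∧
      (¬ x.Nb u g → ¬ (revAndLin u N k (sanitize u x)).1.Mem u g)) by
    refine ⟨fun hm => ?_, fun a b => (H a b).1, fun a b => (H a b).2⟩
    rw [h1 hm]
    rintro ⟨h, -⟩
    rw [mem_refs_setNbr] at h
    rcases h with h | h | h | h
    · simp at h
    · have := hno _ h
      cases d <;> simp [Side.other] at this
    · simpa [hm] using (hno' _ h).1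
    · simpa [hm] using (hno' _ h).1
  · intro hm hug
    have hd' : d = .right := by
      cases d
      · simp only [OnSide] at hd; exact absurd hd hug.not_gt
      · rfl
    subst hd'
    rw [h2 hm rfl]
    refine ⟨fun hnb => ?_, fun hnb => ?_⟩
    · have : g ∈ (sanitize u x).nbr .right := mem_nbr_sanitize.2 ⟨hnb, hd⟩
      simp only [this, if_true]
      rw [Nb_of_leaving (by simpa using hm)]
      rintro ⟨h | h, -⟩
      · exact absurd (hno .left h) (by simp)
      · simp [NodeState.setNbr] at h
    · have : g ∉ (sanitize u x).nbr .right := fun h => hnb (mem_nbr_sanitize.1 h).1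
      simp only [this, if_false]
      rintro ⟨h, -⟩
      rw [mem_refs_setTmp] at h
      rcases h with h | h | h | h
      · simp at h
      · exact absurd (hno' _ h).2 (by simp [Side.other])
      · exact absurd (hno _ h) (by simp)
      · exact this h

end RevAndLinFacts

/-! ### Forwarding of probes. -/

section ProbeFacts

variable {V I : Type*} [LinearOrder V] [LinearOrder I]

/-- The nodes that a probe is still to visit when `u` passes it on. -/
def nextSet (ident : V ↪o I) (u : V) (D : I) (next : Finset V) (x : NodeState V I) : Finset V :=
  (next \ {u}) ∪ ((sanitize u x).nbr (probeSide (ident u) D)).filter fun w =>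
    NotBeyond (probeSide (ident u) D) D (ident w)

variable {ident : V ↪o I} {u s : V} {D : I} {next : Finset V} {q : ℕ} {x : NodeState V I}

theorem mem_nextSet {b : V} : b ∈ nextSet ident u D next x ↔ (b ∈ next ∧ b ≠ u) ∨
    (x.Nb u b ∧ OnSide (probeSide (ident u) D) u b ∧
      NotBeyond (probeSide (ident u) D) D (ident b)) := by
  simp only [nextSet, Finset.mem_union, Finset.mem_sdiff, Finset.mem_singleton, Finset.mem_filter,
    mem_nbr_sanitize, and_assoc]

theorem ne_of_mem_nextSet {b : V} (h : b ∈ nextSet ident u D next x) : b ≠ u :=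
  (mem_nextSet.1 h).elim (fun h => h.2) fun h => h.1.mem.2

theorem forwardProbe_cases (ident : V ↪o I) (u s : V) (D : I) (next : Finset V) (q : ℕ)
    (x : NodeState V I) :
    (D = ident u ∧ forwardProbe ident u s D next q (sanitize u x) =
      (sanitize u x, sendAllTo u next .tempDelegate + {(s, match x.mode with
      | .staying => .probeSuccess D q u
      | .leaving => .probeFail D q), (u, .tempDelegate s)})) ∨
    (D ≠ ident u ∧ nextSet ident u D next x = ∅ ∧
      forwardProbe ident u s D next q (sanitize u x) =
        (sanitize u x, {(s, .probeFail D q), (u, .tempDelegate s)})) ∨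
    (D ≠ ident u ∧ ∃ y, nearest (probeSide (ident u) D) (nextSet ident u D next x) = some y ∧
      ((¬ OnSide (probeSide (ident u) D) u y ∧
          forwardProbe ident u s D next q (sanitize u x) = (sanitize u x,
            {(u, .tempDelegate y), (y, .forwardProbe s D (nextSet ident u D next x) q)})) ∨
       (OnSide (probeSide (ident u) D) u y ∧
          (sanitize u x).Closer (probeSide (ident u) D) y ∧
          forwardProbe ident u s D next q (sanitize u x) =
            ((sanitize u x).save (probeSide (ident u) D) {y},
              {(y, .forwardProbe s D (nextSet ident u D next x) q)})) ∨
       (OnSide (probeSide (ident u) D) u y ∧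
          ¬ (sanitize u x).Closer (probeSide (ident u) D) y ∧
          forwardProbe ident u s D next q (sanitize u x) =
            (sanitize u x, {(y, .forwardProbe s D (nextSet ident u D next x) q)})))) := by
  unfold forwardProbe
  split_ifs with h1
  · exact .inl ⟨h1, rfl⟩
  · right
    rcases hn : nearest (probeSide (ident u) D) (nextSet ident u D next x) with _ | y
    · refine .inl ⟨h1, nearest_eq_none.1 hn, ?_⟩
      unfold nextSet at hn
      simp only [hn]
    · right
      refine ⟨h1, y, rfl, ?_⟩
      have hne := ne_of_mem_nextSet (nearest_eq_some.1 hn).1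
      have hiff : OnSide (probeSide (ident u) D).other u y ↔
          ¬ OnSide (probeSide (ident u) D) u y := by
        cases probeSide (ident u) D <;> simp only [OnSide, Side.other] <;> grind
      unfold nextSet at hn ⊢
      simp only [hn]
      by_cases h2 : OnSide (probeSide (ident u) D) u y
      · right
        rw [if_neg (by rw [hiff]; exact not_not.2 h2)]
        by_cases h3 : (sanitize u x).Closer (probeSide (ident u) D) y
        · rw [if_pos h3]; exact .inl ⟨h2, h3, rfl⟩
        · rw [if_neg h3]; exact .inr ⟨h2, h3, rfl⟩
      · left
        rw [if_pos (hiff.2 h2)]; exact ⟨h2, rfl⟩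

theorem mem_forwardProbe {b : V}
    (h : (forwardProbe ident u s D next q (sanitize u x)).1.Mem u b) :
    x.Mem u b ∨ b ∈ next ∧ ∀ y, x.Nb u y → y ≠ b ∧ ¬ Btw u y b := by
  rcases forwardProbe_cases ident u s D next q x with ⟨-, h'⟩ | ⟨-, -, h'⟩ |
    ⟨-, y, hy, ⟨-, h'⟩ | ⟨hs, hc, h'⟩ | ⟨-, -, h'⟩⟩ <;> rw [h'] at h
  · exact .inl (Mem_sanitize.1 h)
  · exact .inl (Mem_sanitize.1 h)
  · exact .inl (Mem_sanitize.1 h)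
  · obtain ⟨h, hb⟩ := h
    rw [mem_refs_save, mem_refs_sanitize, Finset.mem_singleton] at h
    rcases h with h | rfl
    · exact .inl h
    · rw [closer_sanitize hs] at hc
      rcases mem_nextSet.1 (nearest_eq_some.1 hy).1 with h | h
      · exact .inr ⟨h.1, hc⟩
      · exact .inl h.1.mem
  · exact .inl (Mem_sanitize.1 h)

theorem forwardProbe_mem {b : V} (h : x.Mem u b) :
    (forwardProbe ident u s D next q (sanitize u x)).1.Mem u b := by
  rcases forwardProbe_cases ident u s D next q x with ⟨-, h'⟩ | ⟨-, -, h'⟩ |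
    ⟨-, y, hy, ⟨-, h'⟩ | ⟨hs, hc, h'⟩ | ⟨-, -, h'⟩⟩ <;> rw [h']
  · exact Mem_sanitize.2 h
  · exact Mem_sanitize.2 h
  · exact Mem_sanitize.2 h
  · exact ⟨mem_refs_save.2 (.inl (mem_refs_sanitize.2 h)), h.2⟩
  · exact Mem_sanitize.2 h

theorem send_forwardProbe {a : V} {m : Msg V I}
    (h : (a, m) ∈ (forwardProbe ident u s D next q (sanitize u x)).2) :
    (a = u ∧ ∃ n, (n ∈ next ∨ n = s ∨ n ∈ nextSet ident u D next x ∧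
        ¬ OnSide (probeSide (ident u) D) u n) ∧ m = .tempDelegate n) ∨
    (a = s ∧ (x.mode = .staying ∧ m = .probeSuccess D q u ∨ m = .probeFail D q)) ∨
    (D ≠ ident u ∧ nearest (probeSide (ident u) D) (nextSet ident u D next x) = some a ∧
      m = .forwardProbe s D (nextSet ident u D next x) q) := by
  rcases forwardProbe_cases ident u s D next q x with ⟨-, h'⟩ | ⟨-, -, h'⟩ |
    ⟨h0, y, hy, ⟨hs, h'⟩ | ⟨-, -, h'⟩ | ⟨-, -, h'⟩⟩ <;> rw [h'] at h
  · simp only [Multiset.mem_add, mem_sendAllTo, Multiset.insert_eq_cons, Multiset.mem_cons,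
      Multiset.mem_singleton, Prod.mk.injEq] at h
    rcases h with ⟨h1, n, hn, h2⟩ | ⟨h1, h2⟩ | ⟨h1, h2⟩
    · exact .inl ⟨h1, n, .inl hn, h2⟩
    · refine .inr (.inl ⟨h1, ?_⟩)
      rcases hm : x.mode <;> simp only [hm] at h2
      exacts [.inl ⟨rfl, h2⟩, .inr h2]
    · exact .inl ⟨h1, s, .inr (.inl rfl), h2⟩
  · simp only [Multiset.insert_eq_cons, Multiset.mem_cons, Multiset.mem_singleton,
      Prod.mk.injEq] at h
    rcases h with ⟨h1, h2⟩ | ⟨h1, h2⟩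
    · exact .inr (.inl ⟨h1, .inr h2⟩)
    · exact .inl ⟨h1, s, .inr (.inl rfl), h2⟩
  · simp only [Multiset.insert_eq_cons, Multiset.mem_cons, Multiset.mem_singleton,
      Prod.mk.injEq] at h
    rcases h with ⟨h1, h2⟩ | ⟨h1, h2⟩
    · exact .inl ⟨h1, y, .inr (.inr ⟨(nearest_eq_some.1 hy).1, hs⟩), h2⟩
    · exact .inr (.inr ⟨h0, h1 ▸ hy, h2⟩)
  all_goals
    simp only [Multiset.mem_singleton, Prod.mk.injEq] at h
    exact .inr (.inr ⟨h0, h.1 ▸ hy, h.2⟩)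

end ProbeFacts

/-! ### What a single action changes: references gained and lost, values, mode. -/

section ActFacts

variable {V I : Type*} [LinearOrder V] [LinearOrder I]

theorem probeSuccess_static {u n : V} {D : I} {q : ℕ} {x : NodeState V I} :
    (probeSuccess u D q n x).1.nbr = x.nbr ∧ (probeSuccess u D q n x).1.tmp = x.tmp ∧
    (probeSuccess u D q n x).1.mode = x.mode ∧ (probeSuccess u D q n x).1.gone = x.gone ∧
    (probeSuccess u D q n x).1.uniqueValues = x.uniqueValues ∧
    (probeSuccess u D q n x).1.counter = x.counter := by
  unfold probeSuccess
  rcases hm : x.mode <;> dsimp only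
  · split_ifs <;> simp [hm]
  · simp [hm]

theorem send_probeSuccess {u n a : V} {D : I} {q : ℕ} {x : NodeState V I} {m : Msg V I}
    (h : (a, m) ∈ (probeSuccess u D q n x).2) :
    (a = n ∧ x.mode = .staying ∧ m = .search u D) ∨ (a = u ∧ m = .tempDelegate n) := by
  unfold probeSuccess at h
  rcases hm : x.mode <;> simp only [hm] at h
  · split_ifs at h
    · simp only [Multiset.mem_add, Multiset.mem_singleton, Prod.mk.injEq] at h
      refine h.imp (fun h => ?_) id
      have := Multiset.eq_of_mem_replicate h
      simpa using this
    · exact .inr (by simpa using h)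
  · exact .inr (by simpa using h)

theorem probeSuccess_send {u n : V} {D : I} {q : ℕ} {x : NodeState V I} :
    (u, Msg.tempDelegate n) ∈ (probeSuccess u D q n x).2 := by
  unfold probeSuccess
  rcases hm : x.mode <;> dsimp only
  · split_ifs <;> simp
  · simp

theorem probeFail_static {D : I} {q : ℕ} {x : NodeState V I} :
    (probeFail D q x).nbr = x.nbr ∧ (probeFail D q x).tmp = x.tmp ∧
    (probeFail D q x).mode = x.mode ∧ (probeFail D q x).gone = x.gone ∧
    (probeFail D q x).uniqueValues = x.uniqueValues ∧
    (probeFail D q x).counter = x.counter := by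
  unfold probeFail
  rcases hm : x.mode <;> dsimp only
  · split_ifs <;> simp [hm]
  · simp [hm]

theorem initSearch_static {D : I} {x : NodeState V I} :
    (initSearch D x).nbr = x.nbr ∧ (initSearch D x).tmp = x.tmp ∧
    (initSearch D x).mode = x.mode ∧ (initSearch D x).gone = x.gone ∧
    (initSearch D x).uniqueValues = x.uniqueValues ∧
    (initSearch D x).counter = x.counter := by
  unfold initSearch
  rcases hm : x.mode <;> dsimp only
  · split_ifs <;> simp
  · simp [hm]

theorem refs_congr {x y : NodeState V I} (h1 : x.nbr = y.nbr) (h2 : x.tmp = y.tmp) :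
    x.refs = y.refs := by
  simp [NodeState.refs, h1, h2]

theorem Mem_congr {x y : NodeState V I} {u b : V} (h1 : x.nbr = y.nbr) (h2 : x.tmp = y.tmp) :
    x.Mem u b ↔ y.Mem u b := by
  simp [NodeState.Mem, refs_congr h1 h2]

theorem save_static {d : Side} {S : Finset V} {x : NodeState V I} :
    (x.save d S).mode = x.mode ∧ (x.save d S).gone = x.gone ∧
    (x.save d S).uniqueValues = x.uniqueValues ∧ (x.save d S).counter = x.counter := by
  unfold NodeState.save
  rcases hm : x.mode <;> simp [NodeState.setNbr, NodeState.setTmp, hm]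

theorem introduce_static {u v : V} {w : Option V} {x : NodeState V I} :
    (introduce u v w x).1.mode = x.mode ∧ (introduce u v w x).1.gone = x.gone ∧
    (introduce u v w x).1.uniqueValues = x.uniqueValues ∧
    (introduce u v w x).1.counter = x.counter ∧
    (x.mode = .leaving → (introduce u v w x).1.nbr = x.nbr) := by
  unfold introduce
  rcases sideOf u v with _ | d
  · simp
  · rcases hm : x.mode <;> rcases w with _ | w <;> simp [NodeState.setNbr, NodeState.setTmp, hm]

theorem linearize_static {u v : V} {x : NodeState V I} :
    (linearize u v x).1.mode = x.mode ∧ (linearize u v x).1.gone = x.gone ∧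
    (linearize u v x).1.uniqueValues = x.uniqueValues ∧
    (linearize u v x).1.counter = x.counter ∧
    (x.mode = .leaving → (linearize u v x).1.nbr = x.nbr) := by
  unfold linearize
  rcases sideOf u v with _ | d
  · simp
  · rcases hm : x.mode <;> dsimp only
    · rcases nearest d (x.nbr d) with _ | y
      · simp [hm]
      · dsimp only
        split_ifs <;> simp [NodeState.setNbr, hm]
    · simp [NodeState.setTmp, hm]

theorem tempDelegate_static {u v : V} {x : NodeState V I} :
    (tempDelegate u v x).1.mode = x.mode ∧ (tempDelegate u v x).1.gone = x.gone ∧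
    (tempDelegate u v x).1.uniqueValues = x.uniqueValues ∧
    (tempDelegate u v x).1.counter = x.counter ∧
    (x.mode = .leaving → (tempDelegate u v x).1.nbr = x.nbr) := by
  unfold tempDelegate
  rcases sideOf u v with _ | d
  · simp
  · dsimp only
    split_ifs
    · exact ⟨save_static.1, save_static.2.1, save_static.2.2.1, save_static.2.2.2, fun hm => by
        simp [NodeState.save, hm, NodeState.setTmp]⟩
    · simp

theorem revAndLinAck_static {u v : V} {k : ℕ} {x : NodeState V I} :
    (revAndLinAck u v k x).1.mode = x.mode ∧ (revAndLinAck u v k x).1.gone = x.gone ∧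
    (revAndLinAck u v k x).1.uniqueValues = x.uniqueValues ∧
    (revAndLinAck u v k x).1.counter = x.counter ∧
    (x.mode = .leaving → (revAndLinAck u v k x).1.nbr = x.nbr) := by
  unfold revAndLinAck
  rcases sideOf u v with _ | d
  · simp
  · rcases hm : x.mode <;> simp [NodeState.setTmp, hm]

theorem revAndLin_static {u : V} {N : Finset V} {k : ℕ} {x : NodeState V I} :
    (revAndLin u N k x).1.mode = x.mode ∧ (revAndLin u N k x).1.gone = x.gone ∧
    (revAndLin u N k x).1.uniqueValues = x.uniqueValues ∧
    (revAndLin u N k x).1.counter = x.counter := by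
  rcases revAndLin_cases u N k x with h | ⟨v, d, -, -, -, ⟨-, h⟩ | ⟨-, -, h⟩ | ⟨-, -, h⟩⟩ <;>
    rw [h]
  · simp
  · simp [NodeState.setNbr]
  · simp [NodeState.setTmp]
  · dsimp only
    split_ifs <;> simp [NodeState.setNbr, NodeState.setTmp]

theorem forwardProbe_static {ident : V ↪o I} {u s : V} {D : I} {next : Finset V} {q : ℕ}
    {x : NodeState V I} :
    (forwardProbe ident u s D next q (sanitize u x)).1.mode = x.mode ∧
    (forwardProbe ident u s D next q (sanitize u x)).1.gone = x.gone ∧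
    (forwardProbe ident u s D next q (sanitize u x)).1.uniqueValues =
      (sanitize u x).uniqueValues ∧
    (forwardProbe ident u s D next q (sanitize u x)).1.counter = x.counter ∧
    (x.mode = .leaving →
      (forwardProbe ident u s D next q (sanitize u x)).1.nbr = (sanitize u x).nbr) := by
  rcases forwardProbe_cases ident u s D next q x with ⟨-, h'⟩ | ⟨-, -, h'⟩ |
    ⟨-, y, hy, ⟨-, h'⟩ | ⟨hs, hc, h'⟩ | ⟨-, -, h'⟩⟩ <;> rw [h']
  · simp [sanitize]
  · simp [sanitize]
  · simp [sanitize]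
  · refine ⟨save_static.1, save_static.2.1, save_static.2.2.1, save_static.2.2.2, fun hm => ?_⟩
    simp [NodeState.save, sanitize, hm, NodeState.setTmp]
  · simp [sanitize]

variable [Fintype V]

theorem act_static {ident : V ↪o I} {u : V} {m : Msg V I} {x : NodeState V I} :
    (act ident u m (sanitize u x)).1.mode = x.mode ∧
    (act ident u m (sanitize u x)).1.gone = x.gone := by
  cases m <;> simp only [act]
  case introduce => exact ⟨introduce_static.1, introduce_static.2.1⟩
  case linearize => exact ⟨linearize_static.1, linearize_static.2.1⟩
  case tempDelegate => exact ⟨tempDelegate_static.1, tempDelegate_static.2.1⟩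
  case revAndLinReq dir =>
    refine ⟨refs_revAndLinReq.2.2, ?_⟩
    unfold revAndLinReq
    split <;> simp [assignValues, sanitize]
  case revAndLinAck => exact ⟨revAndLinAck_static.1, revAndLinAck_static.2.1⟩
  case revAndLin => exact ⟨revAndLin_static.1, revAndLin_static.2.1⟩
  case forwardProbe => exact ⟨forwardProbe_static.1, forwardProbe_static.2.1⟩
  case probeSuccess => exact ⟨probeSuccess_static.2.2.1, probeSuccess_static.2.2.2.1⟩
  case probeFail => exact ⟨probeFail_static.2.2.1, probeFail_static.2.2.2.1⟩
  case initSearch => exact ⟨initSearch_static.2.2.1, initSearch_static.2.2.2.1⟩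
  case search => exact ⟨rfl, rfl⟩

theorem act_values {ident : V ↪o I} {u : V} {m : Msg V I} {x : NodeState V I} :
    ((act ident u m (sanitize u x)).1.uniqueValues = (sanitize u x).uniqueValues ∧
      (act ident u m (sanitize u x)).1.counter = x.counter) ∨
    ∃ d, m = .revAndLinReq d := by
  cases m <;> simp only [act, reduceCtorEq, exists_false, or_false]
  case introduce => exact ⟨introduce_static.2.2.1, introduce_static.2.2.2.1⟩
  case linearize => exact ⟨linearize_static.2.2.1, linearize_static.2.2.2.1⟩
  case tempDelegate => exact ⟨tempDelegate_static.2.2.1, tempDelegate_static.2.2.2.1⟩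
  case revAndLinReq dir => exact .inr ⟨_, rfl⟩
  case revAndLinAck => exact ⟨revAndLinAck_static.2.2.1, revAndLinAck_static.2.2.2.1⟩
  case revAndLin => exact ⟨revAndLin_static.2.2.1, revAndLin_static.2.2.2⟩
  case forwardProbe => exact ⟨forwardProbe_static.2.2.1, forwardProbe_static.2.2.2.1⟩
  case probeSuccess => exact ⟨probeSuccess_static.2.2.2.2.1, probeSuccess_static.2.2.2.2.2⟩
  case probeFail => exact ⟨probeFail_static.2.2.2.2.1, probeFail_static.2.2.2.2.2⟩
  case initSearch => exact ⟨initSearch_static.2.2.2.2.1, initSearch_static.2.2.2.2.2⟩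
  case search => exact ⟨trivial, rfl⟩

theorem act_ValuesInjective {ident : V ↪o I} {u : V} {m : Msg V I} {x : NodeState V I}
    (hx : x.ValuesUnique) : (act ident u m (sanitize u x)).1.ValuesInjective := by
  have := ValuesInjective_sanitize (u := u) hx
  rcases act_values (ident := ident) (u := u) (m := m) (x := x) with h | ⟨d, rfl⟩
  · unfold NodeState.ValuesInjective at *
    rwa [h.1]
  · exact ValuesInjective_revAndLinReq this

theorem counter_le_act {ident : V ↪o I} {u : V} {m : Msg V I} {x : NodeState V I} :
    x.counter ≤ (act ident u m (sanitize u x)).1.counter := by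
  rcases act_values (ident := ident) (u := u) (m := m) (x := x) with h | ⟨d, rfl⟩
  · exact h.2.ge
  · exact counter_le_revAndLinReq (x := sanitize u x)

theorem act_value_eq {ident : V ↪o I} {u v : V} {m : Msg V I} {x : NodeState V I} {k : ℕ}
    (h : (act ident u m (sanitize u x)).1.uniqueValues v = some k) :
    x.uniqueValues v = some k ∧ v ∈ x.refs ∨ x.counter < k := by
  have key : (sanitize u x).uniqueValues v = some k → x.uniqueValues v = some k ∧ v ∈ x.refs := by
    intro h
    refine ⟨sanitize_value_eq h, ?_⟩
    simp only [sanitize] at h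
    by_contra hn
    simp [hn] at h
  rcases act_values (ident := ident) (u := u) (m := m) (x := x) with h' | ⟨d, rfl⟩
  · rw [h'.1] at h
    exact .inl (key h)
  · exact (revAndLinReq_value_eq h).imp key id

theorem act_value {ident : V ↪o I} {u v : V} {m : Msg V I} {x : NodeState V I} {k : ℕ}
    (h : x.uniqueValues v = some k) (hv : x.Mem u v) :
    (act ident u m (sanitize u x)).1.uniqueValues v = some k := by
  rw [← sanitize_value hv] at h
  rcases act_values (ident := ident) (u := u) (m := m) (x := x) with h' | ⟨d, rfl⟩
  · rw [h'.1, h]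
  · exact revAndLinReq_value h

/-- A staying node saves without comparison only in response to the first two kinds of messages.
Once these are ruled out, any stored node on the way to `b` keeps `b` out. -/
theorem act_gain {ident : V ↪o I} {u b : V} {m : Msg V I} {x : NodeState V I}
    (h : (act ident u m (sanitize u x)).1.Mem u b) (hb : ¬ x.Mem u b) :
    b ∈ m.refs ∧ (x.mode = .staying → (∃ w, m = .introduce b (some w)) ∨
      (∃ N k, m = .revAndLin N k ∧ b ∈ N) ∨ ∀ y, x.Nb u y → y ≠ b ∧ ¬ Btw u y b) := by
  cases m <;> simp only [act] at h
  case introduce v w =>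
    rcases (mem_introduce.1 h).resolve_left hb with ⟨-, -, ⟨hm, hw, rfl⟩ | ⟨hm, h⟩⟩
    · obtain ⟨w, rfl⟩ := Option.ne_none_iff_exists'.1 hw
      simp [Msg.refs]
    · simp only [hm, reduceCtorEq, false_implies, and_true, Msg.refs, Finset.mem_union,
        Finset.mem_singleton, Option.mem_toFinset, Option.mem_def, h]
  case linearize v =>
    rcases mem_linearize.1 h with ⟨-, h, -⟩ | ⟨hm, h⟩
    · exact absurd h hb
    · simp [hm, Msg.refs, (h.resolve_left hb).2]
  case tempDelegate v =>
    have := (mem_tempDelegate.1 h).resolve_left hb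
    exact ⟨by simp [Msg.refs, this.1], fun _ => .inr (.inr (this.1 ▸ this.2.2))⟩
  case revAndLinReq dir =>
    exact absurd (Mem_sanitize.1 ((Mem_congr refs_revAndLinReq.1 refs_revAndLinReq.2.1).1 h)) hb
  case revAndLinAck v k =>
    have := (mem_revAndLinAck.1 h).resolve_left hb
    simp [this.1, this.2.2, Msg.refs]
  case revAndLin N k =>
    have := (mem_of_revAndLin h).resolve_left hb
    exact ⟨this, fun _ => .inr (.inl ⟨_, _, rfl, this⟩)⟩
  case initSearch =>
    exact absurd (Mem_sanitize.1 ((Mem_congr initSearch_static.1 initSearch_static.2.1).1 h)) hb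
  case forwardProbe =>
    have := (mem_forwardProbe h).resolve_left hb
    exact ⟨by simp [Msg.refs, this.1], fun _ => .inr (.inr this.2)⟩
  case probeSuccess =>
    exact absurd (Mem_sanitize.1 ((Mem_congr probeSuccess_static.1
      probeSuccess_static.2.1).1 h)) hb
  case probeFail =>
    exact absurd (Mem_sanitize.1 ((Mem_congr probeFail_static.1 probeFail_static.2.1).1 h)) hb
  case search => exact absurd (Mem_sanitize.1 h) hb

/-- There are only two ways to forget a reference. A leaving node has just the second one, and only
for nodes on its right; this asymmetry drives the elimination of leaving nodes. -/
theorem act_loss {ident : V ↪o I} {u b : V} {m : Msg V I} {x : NodeState V I}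
    (h : ¬ (act ident u m (sanitize u x)).1.Mem u b) (hb : x.Mem u b) :
    (m = .linearize b ∧ x.mode = .staying ∧ ∃ z, x.Mem u z ∧ Btw u z b) ∨
    (∃ N k, m = .revAndLin N k ∧ x.uniqueValues b = some k ∧ (x.mode = .staying ∨ u < b) ∧
      (b, Msg.introduce u none) ∈ (act ident u m (sanitize u x)).2) := by
  cases m <;> simp only [act] at h ⊢
  case introduce => exact absurd (mem_introduce.2 (.inl hb)) h
  case linearize v =>
    rw [mem_linearize] at h
    rcases hm : x.mode
    · simp only [hm, hb, true_and, reduceCtorEq, false_and, or_false, not_not] at h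
      exact .inl ⟨by rw [h.1], rfl, by rw [h.1]; exact h.2⟩
    · simp [hm, hb] at h
  case tempDelegate => exact absurd (mem_tempDelegate.2 (.inl hb)) h
  case revAndLinReq dir =>
    exact absurd ((Mem_congr refs_revAndLinReq.1 refs_revAndLinReq.2.1).2 (Mem_sanitize.2 hb)) h
  case revAndLinAck v k => exact absurd (mem_revAndLinAck.2 (.inl hb)) h
  case revAndLin N k =>
    rcases mem_revAndLin_or (k := k) (.inl hb : x.Mem u b ∨ b ∈ N) hb.2 with h' | h' | h'
    · exact absurd h' h
    · exact absurd hb h'.1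
    · exact .inr ⟨N, k, rfl, h'.2⟩
  case initSearch =>
    exact absurd ((Mem_congr initSearch_static.1 initSearch_static.2.1).2 (Mem_sanitize.2 hb)) h
  case forwardProbe => exact absurd (forwardProbe_mem hb) h
  case probeSuccess =>
    exact absurd ((Mem_congr probeSuccess_static.1 probeSuccess_static.2.1).2
      (Mem_sanitize.2 hb)) h
  case probeFail =>
    exact absurd ((Mem_congr probeFail_static.1 probeFail_static.2.1).2 (Mem_sanitize.2 hb)) h
  case search => exact absurd (Mem_sanitize.2 hb) h

/-- Every other action of a leaving node saves into the temporary sets and leaves `Left` and `Right`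
alone. -/
theorem act_Nb_gain {ident : V ↪o I} {u b : V} {m : Msg V I} {x : NodeState V I}
    (hm : x.mode = .leaving) (h : (act ident u m (sanitize u x)).1.Nb u b) (hb : ¬ x.Nb u b) :
    ∃ N k, m = .revAndLin N k ∧ b ∈ N := by
  have key : (act ident u m (sanitize u x)).1.nbr = (sanitize u x).nbr ∨
      ∃ N k, m = .revAndLin N k := by
    cases m <;> simp only [act, reduceCtorEq, exists_false, or_false]
    case introduce => exact introduce_static.2.2.2.2 hm
    case linearize => exact linearize_static.2.2.2.2 hm
    case tempDelegate => exact tempDelegate_static.2.2.2.2 hm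
    case revAndLinReq dir => exact refs_revAndLinReq.1
    case revAndLinAck => exact revAndLinAck_static.2.2.2.2 hm
    case revAndLin => exact .inr ⟨_, _, rfl⟩
    case forwardProbe => exact forwardProbe_static.2.2.2.2 hm
    case probeSuccess => exact probeSuccess_static.1
    case probeFail => exact probeFail_static.1
    case initSearch => exact initSearch_static.1
  rcases key with key | ⟨N, k, rfl⟩
  · rw [Nb_of_leaving (act_static.1.trans hm), key] at h
    exact absurd h.1 hb
  · exact ⟨N, k, rfl, (Nb_of_revAndLin hm h).resolve_left hb⟩

end ActFacts

/-! ### Messages sent by an action and their causes. -/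

section SendFacts

variable {V I : Type*} [LinearOrder V]

theorem mem_introductions {u a : V} {d : Side} {x : NodeState V I} {m : Msg V I} :
    (a, m) ∈ introductions u d ((sanitize u x).nbr d) ↔
      (∃ v, x.Nb u v ∧ OnSide d u v ∧ x.Nb u a ∧ Btw u a v ∧ (∀ w, x.Nb u w → ¬ Btw a w v) ∧
        m = .introduce v (some u)) ∨
      (x.Nb u a ∧ OnSide d u a ∧ (∀ w, x.Nb u w → ¬ Btw u w a) ∧ m = .introduce u none) := by
  unfold introductions
  simp only [Multiset.mem_add, Multiset.mem_bind, Finset.mem_val, mem_sendOpt, mem_nbr_sanitize,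
    nearest_sanitize, and_assoc]
  refine or_congr (exists_congr fun v => ?_) Iff.rfl
  constructor
  · rintro ⟨h1, h2, h3, h4⟩
    rw [nextInward_sanitize h2] at h3
    exact ⟨h1, h2, h3.1, h3.2.1, h3.2.2, h4⟩
  · rintro ⟨h1, h2, h3, h4, h5, h6⟩
    exact ⟨h1, h2, (nextInward_sanitize h2).2 ⟨h3, h4, h5⟩, h6⟩

theorem send_timeoutStaying {u a : V} {x : NodeState V I} {m : Msg V I} (hm : x.mode = .staying) :
    (a, m) ∈ (timeoutStaying u (sanitize u x)).2 ↔
      (∃ D ∈ x.waitingFor.support, a = u ∧ m = .forwardProbe u D {u} x.seq) ∨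
      (∃ v, x.Mem u v ∧ x.Mem u a ∧ Btw u a v ∧ (∀ w, x.Mem u w → ¬ Btw a w v) ∧
        m = .introduce v (some u)) ∨
      (x.Mem u a ∧ (∀ w, x.Mem u w → ¬ Btw u w a) ∧ m = .introduce u none) := by
  unfold timeoutStaying
  simp only [Multiset.mem_add, mem_introductions, Nb_of_staying hm, Multiset.mem_map,
    Finset.mem_val, Prod.mk.injEq]
  have hw : (sanitize u x).waitingFor = x.waitingFor := rfl
  have hs : (sanitize u x).seq = x.seq := rfl
  rw [hw, hs]
  constructor
  · rintro ((⟨D, h, rfl, rfl⟩ | ⟨v, h⟩ | h) | ⟨v, h⟩ | h)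
    · exact .inl ⟨D, h, rfl, rfl⟩
    · exact .inr (.inl ⟨v, h.1, h.2.2⟩)
    · exact .inr (.inr ⟨h.1, h.2.2⟩)
    · exact .inr (.inl ⟨v, h.1, h.2.2⟩)
    · exact .inr (.inr ⟨h.1, h.2.2⟩)
  · rintro (⟨D, h, rfl, rfl⟩ | ⟨v, h⟩ | h)
    · exact .inl (.inl ⟨D, h, rfl, rfl⟩)
    · obtain ⟨d, hd⟩ := exists_onSide h.1.2
      cases d
      exacts [.inl (.inr (.inl ⟨v, h.1, hd, h.2⟩)), .inr (.inl ⟨v, h.1, hd, h.2⟩)]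
    · obtain ⟨d, hd⟩ := exists_onSide h.1.2
      cases d
      exacts [.inl (.inr (.inr ⟨h.1, hd, h.2⟩)), .inr (.inr ⟨h.1, hd, h.2⟩)]

theorem send_timeoutLeaving {u a : V} {x : NodeState V I} {m : Msg V I} :
    (a, m) ∈ (timeoutLeaving (sanitize u x)).2 ↔
      ∃ d, x.Mem u a ∧ OnSide d u a ∧ m = .revAndLinReq d.other := by
  unfold timeoutLeaving
  simp only [Multiset.mem_add, Multiset.mem_map, Finset.mem_val, Prod.mk.injEq,
    mem_nbr_or_tmp_sanitize]
  constructor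
  · rintro (⟨v, h, rfl, rfl⟩ | ⟨v, h, rfl, rfl⟩)
    exacts [⟨.left, h.1, h.2, rfl⟩, ⟨.right, h.1, h.2, rfl⟩]
  · rintro ⟨_ | _, h1, h2, rfl⟩
    exacts [.inl ⟨a, ⟨h1, h2⟩, rfl, rfl⟩, .inr ⟨a, ⟨h1, h2⟩, rfl, rfl⟩]

theorem send_exit {u a : V} {x : NodeState V I} {m : Msg V I} :
    (a, m) ∈ (exit (sanitize u x)).2 ↔ ∃ b, x.Mem u a ∧ x.Mem u b ∧ m = .introduce b none := by
  unfold exit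
  simp only [Multiset.mem_bind, Finset.mem_val, Finset.mem_product, mem_refs_sanitize,
    Multiset.insert_eq_cons, Multiset.mem_cons, Multiset.mem_singleton, Prod.mk.injEq]
  constructor
  · rintro ⟨⟨p, p'⟩, ⟨h1, h2⟩, ⟨rfl, rfl⟩ | ⟨rfl, rfl⟩⟩
    exacts [⟨_, h1, h2, rfl⟩, ⟨_, h2, h1, rfl⟩]
  · rintro ⟨b, h1, h2, rfl⟩
    exact ⟨(a, b), ⟨h1, h2⟩, .inl ⟨rfl, rfl⟩⟩

variable [LinearOrder I] [Fintype V]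

/-- `Reply ident u x m₀ a m`: when `u` with variables `x` processes `m₀`, it sends `m` to `a`. -/
inductive Reply (ident : V ↪o I) (u : V) (x : NodeState V I) : Msg V I → V → Msg V I → Prop
  | self {m₀ n} (hn : n ∈ m₀.refs) (hm : ∀ v, m₀ ≠ .tempDelegate v)
      (hs : ∀ v D, m₀ ≠ .search v D) : Reply ident u x m₀ u (.tempDelegate n)
  | delegate {v a} (ha : x.Nb u a) (hv : a = v ∨ Btw u a v) (hu : v ≠ u) :
      Reply ident u x (.tempDelegate v) a (.tempDelegate v)
  | inward {v a} (hm : x.mode = .staying) (ha : x.Mem u a) (hb : Btw u a v) :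
      Reply ident u x (.linearize v) a (.tempDelegate v)
  | linearize {v a} (hm : x.mode = .staying) (hv : v ≠ u) :
      Reply ident u x (.introduce v (some a)) a (.linearize v)
  | ack {dir a k} (hd : x.mode = .staying ∨ dir = .right) (ha : x.Mem u a) (hs : OnSide dir u a)
      (hk : (act ident u (.revAndLinReq dir) (sanitize u x)).1.uniqueValues a = some k)
      (hc : k ≤ (act ident u (.revAndLinReq dir) (sanitize u x)).1.counter) :
      Reply ident u x (.revAndLinReq dir) a (.revAndLinAck u k)
  | revAndLin {a k N} (hm : x.mode = .leaving) (ha : a ≠ u)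
      (hN : ∀ n, n ∈ N ↔ x.Nb u n ∧ Btw a u n) :
      Reply ident u x (.revAndLinAck a k) a (.revAndLin N k)
  | introduce {a k N} (ha : x.Mem u a) (hk : x.uniqueValues a = some k)
      (hm : x.mode = .staying ∨ u < a) :
      Reply ident u x (.revAndLin N k) a (.introduce u none)
  | success {s D next q} (hm : x.mode = .staying) :
      Reply ident u x (.forwardProbe s D next q) s (.probeSuccess D q u)
  | fail {s D next q} : Reply ident u x (.forwardProbe s D next q) s (.probeFail D q)
  | hop {s D next q a} (hD : D ≠ ident u)
      (ha : nearest (probeSide (ident u) D) (nextSet ident u D next x) = some a) :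
      Reply ident u x (.forwardProbe s D next q) a
        (.forwardProbe s D (nextSet ident u D next x) q)
  | search {D q n} (hm : x.mode = .staying) :
      Reply ident u x (.probeSuccess D q n) n (.search u D)

theorem reply_of_act {ident : V ↪o I} {u a : V} {m₀ m : Msg V I} {x : NodeState V I}
    (h : (a, m) ∈ (act ident u m₀ (sanitize u x)).2) : Reply ident u x m₀ a m := by
  cases m₀ <;> simp only [act] at h
  case introduce v w =>
    obtain ⟨h1, h2, ⟨w', rfl, ⟨rfl, rfl⟩ | ⟨rfl, rfl⟩⟩ | ⟨rfl, rfl, rfl⟩⟩ := send_introduce.1 h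
    · exact .linearize h2 h1
    · exact .self (by simp [Msg.refs]) (by simp) (by simp)
    · exact .self (by simp [Msg.refs]) (by simp) (by simp)
  case linearize v =>
    obtain ⟨h1, h2, rfl, rfl | ⟨h3, h4⟩⟩ := send_linearize h
    · exact .self (by simp [Msg.refs]) (by simp) (by simp)
    · exact .inward h2 h3 h4
  case tempDelegate v =>
    obtain ⟨h1, rfl, h2, h3⟩ := send_tempDelegate h
    exact .delegate h2 h3 h1
  case revAndLinReq dir =>
    obtain ⟨h1, h2, h3, k, h4, h5, rfl⟩ := send_revAndLinReq.1 h
    exact .ack h1 h2 h3 h4 h5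
  case revAndLinAck v k =>
    obtain ⟨h1, ⟨h2, rfl, rfl⟩ | ⟨h2, rfl, N, rfl, h3⟩⟩ := send_revAndLinAck.1 h
    · exact .self (by simp [Msg.refs]) (by simp) (by simp)
    · exact .revAndLin h2 h1 h3
  case revAndLin N k =>
    rcases send_revAndLin h with ⟨rfl, n, hn, rfl⟩ | ⟨rfl, h1, h2, h3⟩
    · exact .self hn (by simp) (by simp)
    · exact .introduce h1 h2 h3
  case initSearch => simp at h
  case forwardProbe s D next q =>
    rcases send_forwardProbe h with ⟨rfl, n, hn, rfl⟩ | ⟨rfl, ⟨h1, rfl⟩ | rfl⟩ | ⟨h1, h2, rfl⟩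
    · refine .self ?_ (by simp) (by simp)
      simp only [Msg.refs, Finset.mem_union, Finset.mem_singleton]
      rcases hn with hn | hn | ⟨hn, hs⟩
      · exact .inr hn
      · exact .inl hn
      · rw [mem_nextSet] at hn
        exact .inr (hn.resolve_right fun h => hs h.2.1).1
    · exact .success h1
    · exact .fail
    · exact .hop h1 h2
  case probeSuccess D q n =>
    rcases send_probeSuccess h with ⟨rfl, h1, rfl⟩ | ⟨rfl, rfl⟩
    · exact .search h1
    · exact .self (by simp [Msg.refs]) (by simp) (by simp)
  case probeFail => simp at h
  case search => simp at h

end SendFacts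

/-! ### Global steps and the origin of messages. -/

section System

variable {V I : Type*} [LinearOrder V] [LinearOrder I] [Fintype V]

/-- `u` stores a reference to `b ≠ u`. -/
abbrev State.Mem (s : State V I) (u b : V) : Prop := (s.loc u).Mem u b

/-- `u` stores a reference to `b ≠ u` in `Left` or `Right`, after the sanity check. -/
abbrev State.Nb (s : State V I) (u b : V) : Prop := (s.loc u).Nb u b

open Classical in
/-- The new variables of the acting node, and the messages it sends. -/
noncomputable def result (ident : V ↪o I) (s : State V I) :
    Event V I → Option (V × NodeState V I × Outbox V I)
  | .timeout u => some (u, match (s.loc u).mode with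
      | .staying => timeoutStaying u (sanitize u (s.loc u))
      | .leaving => if s.Nidec u then exit (sanitize u (s.loc u))
          else timeoutLeaving (sanitize u (s.loc u)))
  | .receive u m => some (u, act ident u m (sanitize u (s.loc u)))
  | .initSearch u dest => some (u, initSearch dest (sanitize u (s.loc u)), 0)
  | .leave u => some (u, { s.loc u with mode := .leaving }, 0)
  | .idle => none

/-- In the step `e` from `s`, the message `m` is sent to `a`. -/
def Sends (ident : V ↪o I) (s : State V I) (e : Event V I) (a : V) (m : Msg V I) : Prop :=
  ∃ r ∈ result ident s e, (a, m) ∈ r.2.2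

variable {ident : V ↪o I} {s s' : State V I} {e : Event V I}

/-- A common normal form of all kinds of steps, so that the channels can be analysed without
distinguishing the actions. -/
theorem Step.spec (h : Step ident s e s') : (s' = s ∧ result ident s e = none ∧ e = .idle) ∨
    ∃ u r rest, s.Present u ∧ result ident s e = some (u, r) ∧ s' = s.update u rest r ∧
      ((∃ m, e = .receive u m ∧ s.ch u = m ::ₘ rest) ∨
        ((∀ a m, e ≠ .receive a m) ∧ rest = s.ch u)) := by
  cases h with
  | timeoutStaying u hp hm =>
    exact .inr ⟨u, _, _, hp, by simp only [result, hm], rfl, .inr ⟨by simp, rfl⟩⟩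
  | timeoutLeaving u hp hm ho =>
    exact .inr ⟨u, _, _, hp, by simp only [result, hm, ho, if_false], rfl, .inr ⟨by simp, rfl⟩⟩
  | exit u hp hm ho =>
    exact .inr ⟨u, _, _, hp, by simp only [result, hm, ho, if_true], rfl, .inr ⟨by simp, rfl⟩⟩
  | receive u m rest hp hc => exact .inr ⟨u, _, _, hp, rfl, rfl, .inl ⟨m, rfl, hc⟩⟩
  | initSearch u dest hp hm => exact .inr ⟨u, _, _, hp, rfl, rfl, .inr ⟨by simp, rfl⟩⟩
  | leave u hp hm => exact .inr ⟨u, _, _, hp, rfl, rfl, .inr ⟨by simp, rfl⟩⟩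
  | idle hg => exact .inl ⟨rfl, rfl, rfl⟩

/-- The channels after a step consist of the messages that remain and the messages that are sent. -/
theorem Step.ch_spec (h : Step ident s e s') : ∃ res new : V → Multiset (Msg V I),
    (∀ a, s'.ch a = res a + new a) ∧ (∀ a m, m ∈ new a ↔ Sends ident s e a m) ∧
    ∀ a, (∃ m, e = .receive a m ∧ s.ch a = m ::ₘ res a) ∨
      ((∀ m, e ≠ .receive a m) ∧ res a = s.ch a) := by
  rcases h.spec with ⟨rfl, hr, rfl⟩ | ⟨u, r, rest, hp, hr, rfl, hc⟩
  · exact ⟨s'.ch, fun _ => 0, by simp, by simp [Sends, hr], by simp⟩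
  · refine ⟨Function.update s.ch u rest, fun w => (r.2.filter fun p => p.1 = w).map Prod.snd,
      fun a => rfl, fun a m => ?_, fun a => ?_⟩
    · simp only [Multiset.mem_map, Multiset.mem_filter, Prod.exists, Sends, hr, Option.mem_def,
        Option.some.injEq]
      constructor
      · rintro ⟨a', m', ⟨h1, rfl⟩, rfl⟩
        exact ⟨_, _, _, rfl, h1⟩
      · rintro ⟨_, _, _, h0, h1⟩
        cases h0
        exact ⟨a, m, ⟨h1, rfl⟩, rfl⟩
    · by_cases ha : a = u
      · subst ha
        rw [Function.update_self]
        exact hc.imp id fun h => ⟨h.1 a, h.2⟩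
      · rw [Function.update_of_ne ha]
        refine .inr ⟨?_, rfl⟩
        rintro m rfl
        rcases hc with ⟨m', h, -⟩ | ⟨h, -⟩
        · simp only [Event.receive.injEq] at h
          exact ha h.1
        · exact h _ _ rfl

theorem Step.mem_ch (h : Step ident s e s') {a : V} {m : Msg V I} (hm : m ∈ s'.ch a) :
    m ∈ s.ch a ∨ Sends ident s e a m := by
  obtain ⟨res, new, h1, h2, h3⟩ := h.ch_spec
  rw [h1, Multiset.mem_add, h2] at hm
  refine hm.imp_left fun hm => ?_
  rcases h3 a with ⟨m', -, h4⟩ | ⟨-, h4⟩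
  · rw [h4]; exact Multiset.mem_cons_of_mem hm
  · rwa [← h4]

theorem Step.mem_ch_of_sends (h : Step ident s e s') {a : V} {m : Msg V I}
    (hm : Sends ident s e a m) : m ∈ s'.ch a := by
  obtain ⟨res, new, h1, h2, -⟩ := h.ch_spec
  rw [h1, Multiset.mem_add, h2]
  exact .inr hm

theorem Step.mem_ch_of_ne (h : Step ident s e s') {a : V} {m : Msg V I} (hm : m ∈ s.ch a)
    (he : e ≠ .receive a m) : m ∈ s'.ch a := by
  obtain ⟨res, new, h1, h2, h3⟩ := h.ch_spec
  rw [h1, Multiset.mem_add]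
  left
  rcases h3 a with ⟨m', h4, h5⟩ | ⟨-, h4⟩
  · rw [h5, Multiset.mem_cons] at hm
    refine hm.resolve_left ?_
    rintro rfl
    exact he h4
  · rwa [h4]

theorem Step.mem_of_receive {u : V} {m : Msg V I} (h : Step ident s (.receive u m) s') :
    m ∈ s.ch u := by
  cases h with
  | receive _ _ rest hp hc => rw [hc]; exact Multiset.mem_cons_self _ _

theorem Step.loc_receive {u : V} {m : Msg V I} (h : Step ident s (.receive u m) s') :
    s'.loc u = (act ident u m (sanitize u (s.loc u))).1 := by
  cases h with
  | receive _ _ rest hp hc => simp [State.update]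

theorem sends_receive {u a : V} {m m' : Msg V I} :
    Sends ident s (.receive u m) a m' ↔ (a, m') ∈ (act ident u m (sanitize u (s.loc u))).2 := by
  simp [Sends, result]

/-- The memory of a node that neither processes a message nor exits. -/
theorem Step.loc_of_not_receive (h : Step ident s e s') {u : V}
    (hg : (s'.loc u).gone = (s.loc u).gone) (he : ∀ m, e ≠ .receive u m) :
    (∀ b, s'.Mem u b ↔ s.Mem u b) ∧
    ((s'.loc u).mode = (s.loc u).mode → ∀ b, s'.Nb u b ↔ s.Nb u b) ∧
    (s'.loc u).counter = (s.loc u).counter ∧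
    (s'.loc u = s.loc u ∨ (s'.loc u).uniqueValues = (sanitize u (s.loc u)).uniqueValues ∨
      (s'.loc u).uniqueValues = (s.loc u).uniqueValues ∧ (s'.loc u).refs = (s.loc u).refs) := by
  -- Covers the events whose only effect on the stored sets is the sanity check, which changes
  -- neither `Mem` nor `Nb`.
  have aux : ∀ x : NodeState V I, x.nbr = (sanitize u (s.loc u)).nbr →
      x.tmp = (sanitize u (s.loc u)).tmp → x.mode = (s.loc u).mode →
      (∀ b, x.Mem u b ↔ s.Mem u b) ∧ (x.mode = (s.loc u).mode → ∀ b, x.Nb u b ↔ s.Nb u b) := by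
    intro x h1 h2 h3
    refine ⟨fun b => (Mem_congr h1 h2).trans Mem_sanitize, fun _ b => ?_⟩
    rcases hm : (s.loc u).mode
    · rw [State.Nb, Nb_of_staying (h3.trans hm), Nb_of_staying hm]
      exact (Mem_congr h1 h2).trans Mem_sanitize
    · rw [State.Nb, Nb_of_leaving (h3.trans hm), h1]
      exact ⟨fun h => h.1, fun h => ⟨h, (NodeState.Nb.mem h).2⟩⟩
  by_cases hu : s'.loc u = s.loc u
  · simp [State.Mem, State.Nb, hu]
  have hupd : ∀ v rest r, s' = s.update v rest r → u = v ∧ s'.loc u = r.1 := by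
    rintro v rest r rfl
    by_cases huv : u = v
    · subst huv; simp [State.update]
    · exact absurd (by simp [State.update, huv]) hu
  cases h with
  | timeoutStaying v hp hm =>
    obtain ⟨rfl, h⟩ := hupd _ _ _ rfl
    simp only [State.Mem, State.Nb, h]
    exact ⟨(aux _ rfl rfl rfl).1, (aux _ rfl rfl rfl).2, rfl, .inr (.inl rfl)⟩
  | timeoutLeaving v hp hm ho =>
    obtain ⟨rfl, h⟩ := hupd _ _ _ rfl
    simp only [State.Mem, State.Nb, h]
    exact ⟨(aux _ rfl rfl rfl).1, (aux _ rfl rfl rfl).2, rfl, .inr (.inl rfl)⟩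
  | exit v hp hm ho =>
    obtain ⟨rfl, h⟩ := hupd _ _ _ rfl
    rw [h] at hg
    simp [BuildList.exit, show (s.loc u).gone = false from hp] at hg
  | receive v m rest hp hc =>
    obtain ⟨rfl, h⟩ := hupd _ _ _ rfl
    exact absurd rfl (he m)
  | initSearch v dest hp hm =>
    obtain ⟨rfl, h⟩ := hupd _ _ _ rfl
    simp only [State.Mem, State.Nb, h]
    have hs := initSearch_static (D := dest) (x := sanitize u (s.loc u))
    exact ⟨(aux _ hs.1 hs.2.1 hs.2.2.1).1, (aux _ hs.1 hs.2.1 hs.2.2.1).2, hs.2.2.2.2.2,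
      .inr (.inl hs.2.2.2.2.1)⟩
  | leave v hp hm =>
    obtain ⟨rfl, h⟩ := hupd _ _ _ rfl
    simp only [State.Mem, State.Nb, h]
    refine ⟨fun b => Iff.rfl, fun h => ?_, trivial, .inr (.inr ⟨trivial, rfl⟩)⟩
    simp [hm] at h
  | idle hg => exact absurd rfl hu

/-- The origin of a message that is sent in a step in which no node exits. -/
inductive Origin (ident : V ↪o I) (s : State V I) : Event V I → V → Msg V I → Prop
  | probe {u D q} (hm : (s.loc u).mode = .staying) :
      Origin ident s (.timeout u) u (.forwardProbe u D {u} q)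
  | introduce {u v a} (hm : (s.loc u).mode = .staying) (hv : s.Mem u v) (ha : s.Mem u a)
      (hb : Btw u a v) : Origin ident s (.timeout u) a (.introduce v (some u))
  | introduceSelf {u a} (hm : (s.loc u).mode = .staying) (ha : s.Mem u a)
      (hb : ∀ w, s.Mem u w → ¬ Btw u w a) : Origin ident s (.timeout u) a (.introduce u none)
  | req {u a d} (hm : (s.loc u).mode = .leaving) (ha : s.Mem u a) (hd : OnSide d u a) :
      Origin ident s (.timeout u) a (.revAndLinReq d.other)
  | reply {u m₀ a m} (hm : m₀ ∈ s.ch u) (hr : Reply ident u (s.loc u) m₀ a m) :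
      Origin ident s (.receive u m₀) a m

theorem Step.origin (h : Step ident s e s') (hg : ∀ u, (s'.loc u).gone = (s.loc u).gone)
    {a : V} {m : Msg V I} (hs : Sends ident s e a m) : Origin ident s e a m := by
  obtain ⟨r, hr, hmem⟩ := hs
  cases h with
  | timeoutStaying u hp hm =>
    simp only [result, hm, Option.mem_def, Option.some.injEq] at hr
    subst hr
    rcases (send_timeoutStaying hm).1 hmem with ⟨D, -, rfl, rfl⟩ | ⟨v, h1, h2, h3, -, rfl⟩ |
      ⟨h1, h2, rfl⟩
    · exact .probe hm
    · exact .introduce hm h1 h2 h3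
    · exact .introduceSelf hm h1 h2
  | timeoutLeaving u hp hm ho =>
    simp only [result, hm, ho, if_false, Option.mem_def, Option.some.injEq] at hr
    subst hr
    obtain ⟨d, h1, h2, rfl⟩ := send_timeoutLeaving.1 hmem
    exact .req hm h1 h2
  | exit u hp hm ho =>
    have := hg u
    simp [State.update, BuildList.exit, show (s.loc u).gone = false from hp] at this
  | receive u m rest hp hc =>
    simp only [result, Option.mem_def, Option.some.injEq] at hr
    subst hr
    exact .reply (by rw [hc]; exact Multiset.mem_cons_self _ _) (reply_of_act hmem)
  | initSearch u dest hp hm =>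
    simp only [result, Option.mem_def, Option.some.injEq] at hr
    subst hr
    simp at hmem
  | leave u hp hm =>
    simp only [result, Option.mem_def, Option.some.injEq] at hr
    subst hr
    simp at hmem
  | idle hg => simp [result] at hr

end System

/-! ### Invariant: references belong to present nodes. -/

section Invariants

variable {V I : Type*} [LinearOrder V] [LinearOrder I] [Fintype V]
variable {ident : V ↪o I} {s s' : State V I} {e : Event V I}

/-- Values are unique, all references belong to present nodes, and nodes that are not present are
leaving and have no references and empty channels. -/
structure State.Clean (s : State V I) : Prop where
  unique : ∀ u, (s.loc u).ValuesUnique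
  refs : ∀ u, ∀ w ∈ (s.loc u).refs, s.Present w
  msgs : ∀ u, ∀ m ∈ s.ch u, ∀ w ∈ m.refs, s.Present w
  gone : ∀ u, ¬ s.Present u → (s.loc u).mode = .leaving ∧ s.ch u = 0
  empty : ∀ u, ¬ s.Present u → (s.loc u).refs = ∅

theorem Step.loc_eq_or (h : Step ident s e s') (u : V) :
    s'.loc u = s.loc u ∨ s.Present u ∧ ((∃ m, e = .receive u m) ∨ e = .timeout u ∨
      (∃ D, e = .initSearch u D) ∨ e = .leave u) := by
  cases h with
  | idle => exact .inl rfl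
  | timeoutStaying v hp | timeoutLeaving v hp | exit v hp | receive v m _ hp | initSearch v D hp
  | leave v hp =>
    by_cases huv : u = v
    · subst huv; simp [hp]
    · left; simp [State.update, huv]

theorem Step.present_timeout {u : V} (h : Step ident s (.timeout u) s') : s.Present u := by
  cases h <;> assumption

theorem Step.present_receive {u : V} {m : Msg V I} (h : Step ident s (.receive u m) s') :
    s.Present u := by
  cases h; assumption

theorem Step.unique (h : Step ident s e s') (hs : ∀ u, (s.loc u).ValuesUnique) (u : V) :
    (s'.loc u).ValuesUnique := by
  by_cases hu : s'.loc u = s.loc u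
  · rw [hu]; exact hs u
  have hupd : ∀ v rest r, s' = s.update v rest r → u = v ∧ s'.loc u = r.1 := by
    rintro v rest r rfl
    by_cases huv : u = v
    · subst huv; simp [State.update]
    · exact absurd (by simp [State.update, huv]) hu
  have hX := ValuesInjective_sanitize (u := u) (hs u)
  cases h with
  | timeoutStaying v hp hm =>
    obtain ⟨rfl, h⟩ := hupd _ _ _ rfl
    rw [h]; exact hX.unique
  | timeoutLeaving v hp hm ho =>
    obtain ⟨rfl, h⟩ := hupd _ _ _ rfl
    rw [h]; exact hX.unique
  | exit v hp hm ho =>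
    obtain ⟨rfl, h⟩ := hupd _ _ _ rfl
    rw [h]
    intro v hv w hw k hk
    simp [BuildList.exit] at hk
  | receive v m rest hp hc =>
    obtain ⟨rfl, h⟩ := hupd _ _ _ rfl
    rw [h]; exact (act_ValuesInjective (hs u)).unique
  | initSearch v dest hp hm =>
    obtain ⟨rfl, h⟩ := hupd _ _ _ rfl
    rw [h]
    refine NodeState.ValuesInjective.unique ?_
    unfold NodeState.ValuesInjective at *
    dsimp only
    rw [initSearch_static.2.2.2.2.1]
    exact hX
  | leave v hp hm =>
    obtain ⟨rfl, h⟩ := hupd _ _ _ rfl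
    rw [h]; exact hs u
  | idle hg => exact absurd rfl hu

/-- Only known references are sent, and only to known nodes. -/
theorem Origin.known {a : V} {m : Msg V I} (h : Origin ident s e a m) :
    ∃ u, (e = .timeout u ∨ ∃ m₀ ∈ s.ch u, e = .receive u m₀) ∧
      ∀ w, w = a ∨ w ∈ m.refs → w = u ∨ w ∈ (s.loc u).refs ∨
        ∃ m₀ ∈ s.ch u, e = .receive u m₀ ∧ w ∈ m₀.refs := by
  cases h with
  | probe hm =>
    refine ⟨_, .inl rfl, ?_⟩
    simp [Msg.refs]
  | introduce hm hv ha hb =>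
    refine ⟨_, .inl rfl, ?_⟩
    simp only [Msg.refs, Finset.mem_union, Finset.mem_singleton, Option.toFinset_some]
    rintro w (rfl | rfl | rfl)
    exacts [.inr (.inl ha.1), .inr (.inl hv.1), .inl rfl]
  | introduceSelf hm ha hb =>
    refine ⟨_, .inl rfl, ?_⟩
    simp only [Msg.refs, Finset.mem_union, Finset.mem_singleton, Option.toFinset_none]
    rintro w (rfl | rfl | h)
    exacts [.inr (.inl ha.1), .inl rfl, by simp at h]
  | req hm ha hd =>
    refine ⟨_, .inl rfl, ?_⟩
    simp only [Msg.refs, Finset.notMem_empty, or_false]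
    rintro w rfl
    exact .inr (.inl ha.1)
  | @reply u m₀ a m hm hr =>
    refine ⟨u, .inr ⟨m₀, hm, rfl⟩, ?_⟩
    suffices H : ∀ w, w = a ∨ w ∈ m.refs → w = u ∨ s.Mem u w ∨ w ∈ m₀.refs from
      fun w hw => (H w hw).imp_right fun h => h.imp (fun h => h.1) fun h => ⟨m₀, hm, rfl, h⟩
    intro w hw
    cases hr with
    | revAndLin _ _ hN =>
      simp only [Msg.refs, hN] at hw ⊢
      rcases hw with hw | hw
      exacts [.inr (.inr (by simpa using hw)), .inr (.inl hw.1.mem)]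
    | @hop s₀ D next q _ hD ha =>
      simp only [Msg.refs, Finset.mem_union, Finset.mem_singleton] at hw ⊢
      have aux : ∀ w, w ∈ nextSet ident u D next (s.loc u) →
          w = u ∨ s.Mem u w ∨ w = s₀ ∨ w ∈ next := fun w hw =>
        (mem_nextSet.1 hw).elim (fun h => .inr (.inr (.inr h.1))) fun h => .inr (.inl h.1.mem)
      rcases hw with rfl | rfl | hw
      exacts [aux _ (nearest_eq_some.1 ha).1, .inr (.inr (.inl rfl)), aux _ hw]
    | self hn _ _ =>
      simp only [Msg.refs, Finset.mem_singleton] at hw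
      rcases hw with rfl | rfl
      exacts [.inl rfl, .inr (.inr hn)]
    | delegate ha _ _ =>
      simp only [Msg.refs, Finset.mem_singleton] at hw ⊢
      rcases hw with rfl | rfl
      exacts [.inr (.inl ha.mem), .inr (.inr rfl)]
    | inward _ ha _ =>
      simp only [Msg.refs, Finset.mem_singleton] at hw ⊢
      rcases hw with rfl | rfl
      exacts [.inr (.inl ha), .inr (.inr rfl)]
    | linearize _ _ =>
      simp only [Msg.refs, Finset.mem_union, Finset.mem_singleton, Option.toFinset_some] at hw ⊢
      tauto
    | ack _ ha _ _ _ =>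
      simp only [Msg.refs, Finset.mem_singleton] at hw
      rcases hw with rfl | rfl
      exacts [.inr (.inl ha), .inl rfl]
    | introduce ha _ _ =>
      simp only [Msg.refs, Finset.mem_union, Finset.mem_singleton, Option.toFinset_none,
        Finset.notMem_empty, or_false] at hw
      rcases hw with rfl | rfl
      exacts [.inr (.inl ha), .inl rfl]
    | success _ =>
      simp only [Msg.refs, Finset.mem_union, Finset.mem_singleton] at hw ⊢
      tauto
    | fail =>
      simp only [Msg.refs, Finset.mem_union, Finset.mem_singleton, Finset.notMem_empty] at hw ⊢
      tauto
    | search _ =>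
      simp only [Msg.refs, Finset.mem_singleton] at hw ⊢
      tauto

/-- By `Origin.known` the acting node only uses its own reference, stored ones, and those in the
message that it processes; all of them belong to present nodes. -/
theorem Step.clean_of_gone_eq (h : Step ident s e s') (hs : s.Clean)
    (hg : ∀ u, (s'.loc u).gone = (s.loc u).gone) : s'.Clean := by
  have hP : ∀ u, s'.Present u ↔ s.Present u := fun u => by simp only [State.Present, hg u]
  have hO : ∀ a m, Sends ident s e a m → ∀ w, w = a ∨ w ∈ m.refs → s.Present w := by
    intro a m hm w hw
    obtain ⟨u, he, hk⟩ := (h.origin hg hm).known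
    have hu : s.Present u := by
      rcases he with rfl | ⟨m₀, -, rfl⟩
      exacts [h.present_timeout, h.present_receive]
    rcases hk w hw with rfl | hk | ⟨m₀, hm₀, -, hk⟩
    exacts [hu, hs.refs _ _ hk, hs.msgs _ _ hm₀ _ hk]
  refine ⟨h.unique hs.unique, fun u w hw => (hP w).2 ?_, fun u m hm w hw => (hP w).2 ?_,
    fun u hu => ?_, fun u hu => ?_⟩
  · rcases h.loc_eq_or u with h' | ⟨hu, h'⟩
    · rw [h'] at hw; exact hs.refs _ _ hw
    · by_cases hwu : w = u
      · rwa [hwu]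
      by_cases he : ∃ m, e = .receive u m
      · obtain ⟨m, rfl⟩ := he
        by_cases hb : s.Mem u w
        · exact hs.refs _ _ hb.1
        · have := h.loc_receive ▸ (⟨hw, hwu⟩ : s'.Mem u w)
          exact hs.msgs _ _ h.mem_of_receive _ (act_gain this hb).1
      · push Not at he
        exact hs.refs _ _ (((h.loc_of_not_receive (hg u) he).1 w).1 ⟨hw, hwu⟩).1
  · rcases h.mem_ch hm with hm | hm
    · exact hs.msgs _ _ hm _ hw
    · exact hO _ _ hm _ (.inr hw)
  · rw [hP] at hu
    have hloc : s'.loc u = s.loc u := (h.loc_eq_or u).resolve_right fun h => hu h.1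
    refine ⟨hloc ▸ (hs.gone u hu).1, Multiset.eq_zero_of_forall_notMem fun m hm => ?_⟩
    rcases h.mem_ch hm with hm | hm
    · simp [(hs.gone u hu).2] at hm
    · exact hu (hO _ _ hm _ (.inl rfl))
  · rw [hP] at hu
    rw [(h.loc_eq_or u).resolve_right fun h => hu h.1, hs.empty u hu]

/-- The facts about a step in which `u` exits. -/
theorem Step.exit_spec (h : Step ident s e s') (hg : ¬ ∀ u, (s'.loc u).gone = (s.loc u).gone) :
    ∃ u, e = .timeout u ∧ s.Present u ∧ (s.loc u).mode = .leaving ∧ s.Nidec u ∧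
      (s'.loc u).gone = true ∧ (s'.loc u).refs = ∅ ∧ (s'.loc u).mode = .leaving ∧
      (∀ v, v ≠ u → s'.loc v = s.loc v) ∧
      ∀ a m, m ∈ s'.ch a ↔ m ∈ s.ch a ∨ ∃ b, s.Mem u a ∧ s.Mem u b ∧ m = .introduce b none := by
  cases h with
  | exit u hp hm ho =>
    refine ⟨u, rfl, hp, hm, ho, by simp [State.update, BuildList.exit], ?_, ?_, ?_, ?_⟩
    · simp [State.update, BuildList.exit, NodeState.refs]
    · simp [State.update, BuildList.exit, hm]
    · intro v hv; simp [State.update, hv]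
    · intro a m
      simp only [State.update, Function.update_eq_self, Multiset.mem_add, Multiset.mem_map,
        Multiset.mem_filter]
      refine or_congr Iff.rfl ?_
      constructor
      · rintro ⟨⟨a', m'⟩, ⟨h1, rfl⟩, rfl⟩
        exact send_exit.1 h1
      · intro h1
        exact ⟨(a, m), ⟨send_exit.2 h1, rfl⟩, rfl⟩
  | idle => simp at hg
  | timeoutStaying v _ hm | timeoutLeaving v _ hm | initSearch v _ _ hm | leave v _ hm =>
    refine absurd (fun u => ?_) hg
    by_cases huv : u = v
    · subst huv
      simp [State.update, BuildList.timeoutStaying, BuildList.timeoutLeaving, sanitize,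
        initSearch_static.2.2.2.1]
    · simp [State.update, huv]
  | receive v m rest hp hc =>
    refine absurd (fun u => ?_) hg
    by_cases huv : u = v
    · subst huv
      simp [State.update, act_static.2]
    · simp [State.update, huv]

/-- In an exit the oracle guarantees that no other node refers to the exiting node, and the
introductions that it sends mention only its neighbours. -/
theorem Step.clean (h : Step ident s e s') (hs : s.Clean) : s'.Clean := by
  by_cases hg : ∀ u, (s'.loc u).gone = (s.loc u).gone
  · exact h.clean_of_gone_eq hs hg
  obtain ⟨u, rfl, hu, hm, ho, h1, h2, h3, h4, h5⟩ := h.exit_spec hg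
  have hP : ∀ w, w ≠ u → s.Present w → s'.Present w := fun w hw h => by
    simpa only [State.Present, h4 w hw] using h
  refine ⟨h.unique hs.unique, fun v w hw => ?_, fun v m hm w hw => ?_, fun v hv => ?_,
    fun v hv => ?_⟩
  · by_cases hv : v = u
    · subst hv; simp [h2] at hw
    · rw [h4 v hv] at hw
      refine hP _ ?_ (hs.refs _ _ hw)
      rintro rfl
      exact (ho.2 v hv).1 hw
  · rcases (h5 _ _).1 hm with hmv | ⟨b, ha, hb, rfl⟩
    · refine hP _ ?_ (hs.msgs _ _ hmv _ hw)
      rintro rfl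
      by_cases hv : v = w
      · subst hv; simp [ho.1] at hmv
      · exact (ho.2 v hv).2 m hmv hw
    · simp [Msg.refs] at hw
      subst hw
      exact hP _ hb.2 (hs.refs _ _ hb.1)
  · by_cases hvu : v = u
    · subst hvu
      refine ⟨h3, Multiset.eq_zero_of_forall_notMem fun m hm => ?_⟩
      rcases (h5 _ _).1 hm with hm | ⟨b, ha, -, -⟩
      · simp [ho.1] at hm
      · exact ha.2 rfl
    · have hv' : ¬ s.Present v := fun h => hv (hP _ hvu h)
      refine ⟨by rw [h4 v hvu]; exact (hs.gone v hv').1,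
        Multiset.eq_zero_of_forall_notMem fun m hm => ?_⟩
      rcases (h5 _ _).1 hm with hm | ⟨b, ha, -, -⟩
      · simp [(hs.gone v hv').2] at hm
      · exact hv' (hs.refs _ _ ha.1)
  · by_cases hvu : v = u
    · rw [hvu, h2]
    · rw [h4 v hvu]
      exact hs.empty v fun h => hv (hP _ hvu h)

theorem State.IsInitial.clean (hs : s.IsInitial) : s.Clean :=
  ⟨fun u v hv w hw k => hs.unique u v hv w hw k, fun _ w _ => hs.present w,
    fun _ _ _ w _ => hs.present w, fun u hu => absurd (hs.present u) hu,
    fun u hu => absurd (hs.present u) hu⟩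

end Invariants

/-! ### Preservation of weak connectivity. -/

section Connectivity

variable {V I : Type*} [LinearOrder V] [LinearOrder I] [Fintype V]
variable {ident : V ↪o I} {s s' : State V I} {e : Event V I}

/-- The references of a message in the channel of `a` that give rise to implicit edges, apart from
those of probes. -/
def Msg.linkRefs (a : V) : Msg V I → Finset V
  | .introduce v w => if v = a then ∅ else {v} ∪ w.toFinset
  | .forwardProbe _ _ _ _ => ∅
  | .search _ _ => ∅
  | m => m.refs

/-- `a` has an edge to `b ≠ a` that does not come from a probe. -/
def State.Link (s : State V I) (a b : V) : Prop :=
  s.Mem a b ∨ b ≠ a ∧ ∃ m ∈ s.ch a, b ∈ m.linkRefs a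

theorem State.Link.ne {a b : V} (h : s.Link a b) : b ≠ a := h.elim (fun h => h.2) fun h => h.1

theorem Step.link_of_tempDelegate (h : Step ident s e s') {a b : V} (hb : b ≠ a)
    (hs : Sends ident s e a (.tempDelegate b)) : s'.Link a b :=
  .inr ⟨hb, _, h.mem_ch_of_sends hs, by simp [Msg.linkRefs, Msg.refs]⟩

theorem Step.mem_or_sends (h : Step ident s e s')
    (hg : ∀ u, (s'.loc u).gone = (s.loc u).gone) {a b : V} (hm : s.Mem a b) :
    s'.Mem a b ∨
    (e = .receive a (.linearize b) ∧ (s.loc a).mode = .staying ∧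
      ∃ z, s.Mem a z ∧ Btw a z b) ∨
    (∃ N k, e = .receive a (.revAndLin N k) ∧ (s.loc a).uniqueValues b = some k ∧
      ((s.loc a).mode = .staying ∨ a < b) ∧ Sends ident s e b (.introduce a none)) := by
  by_cases hr : ∃ m, e = .receive a m
  · obtain ⟨m, rfl⟩ := hr
    by_cases hm' : s'.Mem a b
    · exact .inl hm'
    · right
      rw [State.Mem, h.loc_receive] at hm'
      rcases act_loss hm' hm with ⟨rfl, h1, h2⟩ | ⟨N, k, rfl, h1, h2, h3⟩
      · exact .inl ⟨rfl, h1, h2⟩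
      · exact .inr ⟨N, k, rfl, h1, h2, sends_receive.2 h3⟩
  · push Not at hr
    exact .inl (((h.loc_of_not_receive (hg a) hr).1 b).2 hm)

/-- The fate of a reference in a message that is processed. -/
theorem Step.received {a b : V} {m : Msg V I} (h : Step ident s (.receive a m) s')
    (hba : b ≠ a) (hb : b ∈ m.linkRefs a) :
    s'.Mem a b ∨ (m ≠ .tempDelegate b ∧ Sends ident s (.receive a m) a (.tempDelegate b)) ∨
    (∃ y, Btw a y b ∧ s'.Mem a y ∧ Sends ident s (.receive a m) y (.tempDelegate b)) ∨
    ∃ N k, m = .revAndLin N k ∧ Sends ident s (.receive a m) b (.introduce a none) := by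
  have hloc := h.loc_receive
  have memI : (act ident a m (sanitize a (s.loc a))).1.Mem a b → s'.Mem a b := fun h' => by
    rwa [State.Mem, hloc]
  simp only [sends_receive]
  cases m <;> simp only [Msg.linkRefs, Finset.notMem_empty] at hb <;> simp only [act] at memI ⊢
  case introduce v w =>
    split_ifs at hb with hva
    · simp at hb
    simp only [Finset.mem_union, Finset.mem_singleton, Option.mem_toFinset, Option.mem_def] at hb
    rcases hmode : (s.loc a).mode
    · rcases w with _ | w
      · refine .inr (.inl ⟨by simp, send_introduce.2 ⟨hva, hmode, .inr ⟨rfl, rfl, ?_⟩⟩⟩)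
        rw [hb.resolve_right (by simp)]
      · rcases hb with rfl | hb
        · exact .inl (memI (mem_introduce.2 (.inr ⟨hba, hva, .inl ⟨hmode, by simp, rfl⟩⟩)))
        · exact .inr (.inl ⟨by simp,
            send_introduce.2 ⟨hva, hmode, .inl ⟨b, hb, .inr ⟨rfl, rfl⟩⟩⟩⟩)
    · exact .inl (memI (mem_introduce.2 (.inr ⟨hba, hva, .inr ⟨hmode, hb⟩⟩)))
  case linearize v =>
    simp only [Msg.refs, Finset.mem_singleton] at hb
    subst hb
    rcases hmode : (s.loc a).mode
    · exact .inr (.inl ⟨by simp, send_linearize_self hba hmode⟩)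
    · exact .inl (memI (mem_linearize.2 (.inr ⟨hmode, .inr ⟨hba, rfl⟩⟩)))
  case tempDelegate v =>
    simp only [Msg.refs, Finset.mem_singleton] at hb
    subst hb
    rcases tempDelegate_effect (I := I) (s.loc a) hba with h1 | ⟨y, h1, h2, h3⟩
    · exact .inl (memI h1)
    · refine .inr (.inr (.inl ⟨y, h2, ?_, h3⟩))
      rw [State.Mem, hloc]
      exact mem_tempDelegate.2 (.inl h1)
  case revAndLinReq => simp [Msg.refs] at hb
  case revAndLinAck v k =>
    simp only [Msg.refs, Finset.mem_singleton] at hb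
    subst hb
    rcases hmode : (s.loc a).mode
    · exact .inr (.inl ⟨by simp, send_revAndLinAck.2 ⟨hba, .inl ⟨hmode, rfl, rfl⟩⟩⟩)
    · exact .inl (memI (mem_revAndLinAck.2 (.inr ⟨hmode, hba, rfl⟩)))
  case revAndLin N k =>
    simp only [Msg.refs] at hb
    rcases mem_revAndLin_or (u := a) (k := k) (x := s.loc a) (.inr hb) hba with
      h1 | ⟨-, h1⟩ | ⟨-, -, -, h1⟩
    · exact .inl (memI h1)
    · exact .inr (.inl ⟨by simp, h1⟩)
    · exact .inr (.inr (.inr ⟨N, k, rfl, h1⟩))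
  case initSearch => simp [Msg.refs] at hb
  case probeSuccess D q n =>
    simp only [Msg.refs, Finset.mem_singleton] at hb
    subst hb
    exact .inr (.inl ⟨by simp, probeSuccess_send⟩)
  case probeFail => simp [Msg.refs] at hb

/-- In a step an edge either persists, or is reversed, or is split. -/
theorem Step.link (h : Step ident s e s') (hg : ∀ u, (s'.loc u).gone = (s.loc u).gone)
    {a b : V} (hl : s.Link a b) :
    s'.Link a b ∨ s'.Link b a ∨ ∃ y, Btw a y b ∧ s'.Link a y ∧ s'.Link y b := by
  have hba := hl.ne
  have rev : Sends ident s e b (.introduce a none) → s'.Link b a := fun hs =>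
    .inr ⟨hba.symm, _, h.mem_ch_of_sends hs, by simp [Msg.linkRefs, hba.symm]⟩
  rcases hl with hm | ⟨-, m, hm, hb⟩
  · rcases h.mem_or_sends hg hm with hm' | ⟨rfl, hst, -⟩ | ⟨N, k, rfl, -, -, hs⟩
    · exact .inl (.inl hm')
    · exact .inl (h.link_of_tempDelegate hba (sends_receive.2 (send_linearize_self hba hst)))
    · exact .inr (.inl (rev hs))
  by_cases hr : e = .receive a m
  · subst hr
    rcases h.received hba hb with h1 | ⟨-, h1⟩ | ⟨y, h1, h2, h3⟩ | ⟨N, k, -, h1⟩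
    · exact .inl (.inl h1)
    · exact .inl (h.link_of_tempDelegate hba h1)
    · exact .inr (.inr ⟨y, h1, .inl h2, h.link_of_tempDelegate h1.ne_right.symm h3⟩)
    · exact .inr (.inl (rev h1))
  · exact .inl (.inr ⟨hba, m, h.mem_ch_of_ne hm hr, hb⟩)

/-- A probe in the channel of `a` that is not to visit nodes beyond its destination. -/
def InRange (ident : V ↪o I) (a : V) (D : I) (next : Finset V) : Prop :=
  D = ident a ∨ ∀ v ∈ next, NotBeyond (probeSide (ident a) D) D (ident v)

theorem probeSide_eq {D : I} {a : V} (hD : D ≠ ident a) :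
    (ident a < D ∧ probeSide (ident a) D = .right) ∨
      (D < ident a ∧ probeSide (ident a) D = .left) := by
  unfold probeSide
  rcases lt_or_gt_of_ne hD with h | h
  · exact .inr ⟨h, if_neg h.not_gt⟩
  · exact .inl ⟨h, if_pos h⟩

/-- A node adds only neighbours not beyond `D`. Since `y` itself is not beyond `D`, the direction of
travel at `y` is unchanged unless `y` is the destination. -/
theorem InRange.hop {a y : V} {D : I} {next : Finset V} {x : NodeState V I}
    (h : InRange ident a D next) (hD : D ≠ ident a)
    (hy : nearest (probeSide (ident a) D) (nextSet ident a D next x) = some y) :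
    (∀ v ∈ nextSet ident a D next x, NotBeyond (probeSide (ident a) D) D (ident v)) ∧
    InRange ident y D (nextSet ident a D next x) := by
  have h1 : ∀ v ∈ nextSet ident a D next x, NotBeyond (probeSide (ident a) D) D (ident v) :=
    fun v hv => (mem_nextSet.1 hv).elim (fun hv => (h.resolve_left hD) v hv.1) fun hv => hv.2.2
  refine ⟨h1, ?_⟩
  by_cases hDy : D = ident y
  · exact .inl hDy
  · have hyD := h1 y (nearest_eq_some.1 hy).1
    have : probeSide (ident y) D = probeSide (ident a) D := by
      rcases probeSide_eq hD with ⟨-, h⟩ | ⟨-, h⟩ <;> rcases probeSide_eq hDy with ⟨h', h2⟩ | ⟨h', h2⟩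
        <;> rw [h] at hyD <;> simp only [NotBeyond] at hyD <;> rw [h, h2]
      · exact absurd hyD (not_le_of_gt h')
      · exact absurd hyD (not_le_of_gt h')
    exact .inr (this ▸ h1)

/-- The node that passes a probe on keeps an edge to the receiver `y`. If `y` is neither saved nor
delegated, some neighbour `z` equals `y` or lies between; in the latter case `z` would not be beyond
`D` either and would precede `y` in the set, contrary to the choice of `y`. -/
theorem forwardProbe_hop {u y t : V} {D : I} {next : Finset V} {q : ℕ} {x : NodeState V I}
    (h : InRange ident u D next) (hD : D ≠ ident u)
    (hy : nearest (probeSide (ident u) D) (nextSet ident u D next x) = some y) :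
    (y, Msg.forwardProbe t D (nextSet ident u D next x) q) ∈
      (forwardProbe ident u t D next q (sanitize u x)).2 ∧
    ((forwardProbe ident u t D next q (sanitize u x)).1.Mem u y ∨
      (u, Msg.tempDelegate y) ∈ (forwardProbe ident u t D next q (sanitize u x)).2) := by
  have hyu := ne_of_mem_nextSet (nearest_eq_some.1 hy).1
  rcases forwardProbe_cases ident u t D next q x with ⟨h0, -⟩ | ⟨-, h0, -⟩ |
    ⟨-, y', hy', h'⟩
  · exact absurd h0 hD
  · rw [nearest_eq_none.2 h0] at hy
    simp at hy
  · rw [hy, Option.some.injEq] at hy'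
    subst hy'
    rcases h' with ⟨-, h'⟩ | ⟨-, -, h'⟩ | ⟨hs, hc, h'⟩
    · rw [h']; simp
    · rw [h']
      exact ⟨by simp, .inl ⟨mem_refs_save.2 (.inr (by simp)), hyu⟩⟩
    · refine ⟨by rw [h']; simp, .inl (forwardProbe_mem ?_)⟩
      rw [closer_sanitize hs] at hc
      push Not at hc
      obtain ⟨z, hz, hzy⟩ := hc
      by_cases hzy' : z = y
      · exact hzy' ▸ hz.mem
      · have hb := hzy hzy'
        have hzs := hb.onSide.2 hs
        have hyD := (h.hop hD hy).1 y (nearest_eq_some.1 hy).1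
        have : z ∈ nextSet ident u D next x := by
          refine mem_nextSet.2 (.inr ⟨hz, hzs, ?_⟩)
          rcases hd : probeSide (ident u) D <;> rw [hd] at hyD hs <;>
            simp only [NotBeyond, OnSide] at hyD hs ⊢ <;> unfold Btw at hb
          · exact hyD.trans (ident.monotone (by grind))
          · exact (ident.monotone (by grind)).trans hyD
        exact absurd ((onSide_other_iff_btw hzs hs).2 hb) ((nearest_eq_some.1 hy).2 z this)

theorem State.Link.edge {a b : V} (h : s.Link a b) : s.Edge ident a b := by
  rcases h with h | ⟨-, m, hm, hb⟩
  · exact .inl h.1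
  · refine .inr ⟨m, hm, ?_⟩
    cases m <;> simp only [Msg.linkRefs, Msg.edgeRefs, Finset.notMem_empty] at * <;> assumption

theorem State.Edge.cases {a b : V} (hab : b ≠ a) (h : s.Edge ident a b) :
    s.Link a b ∨ ∃ t D next q, Msg.forwardProbe t D next q ∈ s.ch a ∧
      InRange ident a D next ∧ (b = t ∨ b ∈ next) := by
  rcases h with h | ⟨m, hm, hb⟩
  · exact .inl (.inl ⟨h, hab⟩)
  · cases m
    case forwardProbe t D next q =>
      simp only [Msg.edgeRefs] at hb
      split_ifs at hb with hc
      · exact .inr ⟨t, D, next, q, hm, hc, by simpa using hb⟩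
      · simp at hb
    all_goals
      exact .inl (.inr ⟨hab, _, hm, by simpa only [Msg.edgeRefs, Msg.linkRefs] using hb⟩)

theorem eqvGen_of_forall {α : Type*} {r r' : α → α → Prop}
    (h : ∀ a b, r a b → Relation.EqvGen r' a b) {a b : α} (hab : Relation.EqvGen r a b) :
    Relation.EqvGen r' a b := by
  induction hab with
  | rel _ _ h' => exact h _ _ h'
  | refl => exact .refl _
  | symm _ _ _ ih => exact .symm _ _ ih
  | trans _ _ _ _ _ ih1 ih2 => exact .trans _ _ _ ih1 ih2

/-- Edges from probes are the only ones not settled by `Step.link`. A probe that ends leaves its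
references behind as delegations to the node itself; one that is passed on carries them to a node
with which the sender keeps an edge. -/
theorem Step.edge (h : Step ident s e s') (hg : ∀ u, (s'.loc u).gone = (s.loc u).gone)
    {a b : V} (hab : s.Edge ident a b) : Relation.EqvGen (s'.Edge ident) a b := by
  by_cases hne : b = a
  · subst hne; exact .refl _
  rcases hab.cases hne with hl | ⟨t, D, next, q, hm, hc, hb⟩
  · rcases h.link hg hl with h1 | h1 | ⟨y, -, h1, h2⟩
    · exact .rel _ _ h1.edge
    · exact .symm _ _ (.rel _ _ h1.edge)
    · exact .trans _ _ _ (.rel _ _ h1.edge) (.rel _ _ h2.edge)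
  by_cases hr : e = .receive a (.forwardProbe t D next q)
  swap
  · refine .rel _ _ (.inr ⟨_, h.mem_ch_of_ne hm hr, ?_⟩)
    simp only [Msg.edgeRefs]
    unfold InRange at hc
    rw [if_pos hc]
    simpa using hb
  subst hr
  have hloc := h.loc_receive
  simp only [act] at hloc
  have tdI : ∀ c, (a, Msg.tempDelegate c) ∈
      (forwardProbe ident a t D next q (sanitize a (s.loc a))).2 →
      Relation.EqvGen (s'.Edge ident) a c := fun c h' => by
    by_cases hc : c = a
    · subst hc; exact .refl _
    · exact .rel _ _ (h.link_of_tempDelegate hc (sends_receive.2 h')).edge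
  by_cases hD : D = ident a
  · apply tdI
    rcases forwardProbe_cases ident a t D next q (s.loc a) with ⟨-, h'⟩ | ⟨h', -⟩ | ⟨h', -⟩
    · rw [h']
      simp only [Multiset.mem_add, mem_sendAllTo, Multiset.insert_eq_cons, Multiset.mem_cons,
        Multiset.mem_singleton, Prod.mk.injEq]
      rcases hb with rfl | hb
      exacts [.inr (.inr ⟨trivial, rfl⟩), .inl ⟨trivial, b, hb, rfl⟩]
    · exact absurd hD h'
    · exact absurd hD h'
  · rcases hn : nearest (probeSide (ident a) D) (nextSet ident a D next (s.loc a)) with _ | y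
    · rw [nearest_eq_none] at hn
      have hbt : b = t := hb.resolve_right fun hb => by
        have : b ∈ nextSet ident a D next (s.loc a) := mem_nextSet.2 (.inl ⟨hb, hne⟩)
        simp [hn] at this
      subst hbt
      apply tdI
      rcases forwardProbe_cases ident a b D next q (s.loc a) with ⟨h', -⟩ | ⟨-, -, h'⟩ |
        ⟨-, y, h', -⟩
      · exact absurd h' hD
      · rw [h']; simp
      · rw [nearest_eq_none.2 hn] at h'
        simp at h'
    · obtain ⟨h1, h2⟩ := forwardProbe_hop (t := t) (q := q) hc hD hn
      refine .trans _ y _ ?_ ?_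
      · rcases h2 with h2 | h2
        · rw [← hloc] at h2
          exact .rel _ _ (.inl h2.1)
        · exact tdI _ h2
      · refine .rel _ _ (.inr ⟨_, h.mem_ch_of_sends (sends_receive.2 h1), ?_⟩)
        have hr := (hc.hop hD hn).2
        unfold InRange at hr
        simp only [Msg.edgeRefs]
        rw [if_pos hr]
        simp only [Finset.mem_union, Finset.mem_singleton]
        exact hb.imp id fun hb => mem_nextSet.2 (.inl ⟨hb, hne⟩)

/-- The present nodes are connected. -/
def State.Connected (ident : V ↪o I) (s : State V I) : Prop :=
  ∀ u v, s.Present u → s.Present v → Relation.EqvGen (s.Edge ident) u v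

/-- When `u` exits, the oracle ensures that all its edges are stored references of `u`, and its
former neighbours become pairwise connected. Paths through `u` can thus be rerouted. -/
theorem Step.connected (h : Step ident s e s') (hc : s.Connected ident) :
    s'.Connected ident := by
  by_cases hg : ∀ u, (s'.loc u).gone = (s.loc u).gone
  · intro u v hu hv
    simp only [State.Present, hg] at hu hv
    exact eqvGen_of_forall (fun a b => h.edge hg) (hc u v hu hv)
  obtain ⟨u, rfl, hu, hm, ho, h1, h2, h3, h4, h5⟩ := h.exit_spec hg
  intro a b ha hb
  have hau : ∀ c, s'.Present c → c ≠ u ∧ s.Present c := by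
    intro c hc
    have hcu : c ≠ u := by rintro rfl; simp [State.Present, h1] at hc
    exact ⟨hcu, by simpa only [State.Present, h4 c hcu] using hc⟩
  -- `P` is an invariant along paths of the old graph: at a vertex other than `u` it says that the
  -- vertex is still connected to `a`, and at `u` that all former neighbours of `u` are.
  let P : V → Prop := fun x => (x ≠ u → Relation.EqvGen (s'.Edge ident) a x) ∧
    (x = u → ∀ c, s.Mem u c → Relation.EqvGen (s'.Edge ident) a c)
  have key : ∀ x y, s.Edge ident x y → (P x ↔ P y) := by
    intro x y hxy
    by_cases hxu : x = u
    · subst hxu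
      by_cases hyx : y = x
      · subst hyx; rfl
      have hy : s.Mem x y := by
        rcases hxy with hxy | ⟨m, hm, -⟩
        · exact ⟨hxy, hyx⟩
        · simp [ho.1] at hm
      refine ⟨fun hP => ⟨fun _ => hP.2 rfl y hy, fun h => absurd h hyx⟩,
        fun hP => ⟨fun h => absurd rfl h, fun _ c hc => ?_⟩⟩
      refine .trans _ y _ (hP.1 hyx) ?_
      by_cases hcy : c = y
      · subst hcy; exact .refl _
      · refine .rel _ _ (.inr ⟨.introduce c none, (h5 _ _).2 (.inr ⟨c, hy, hc, rfl⟩), ?_⟩)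
        simp [Msg.edgeRefs, hcy]
    · have hyu : y ≠ u := by
        rintro rfl
        rcases hxy with hxy | ⟨m, hm, hxy⟩
        · exact (ho.2 x hxu).1 hxy
        · refine (ho.2 x hxu).2 m hm ?_
          cases m <;> simp only [Msg.edgeRefs, Msg.refs] at hxy ⊢ <;>
            first | exact hxy | (split_ifs at hxy <;> first | exact hxy | simp at hxy) | simp at hxy
      have hE : s'.Edge ident x y := by
        rcases hxy with hxy | ⟨m, hm, hxy⟩
        · left; rwa [h4 x hxu]
        · exact .inr ⟨m, (h5 _ _).2 (.inl hm), hxy⟩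
      refine ⟨fun hP => ⟨fun _ => .trans _ _ _ (hP.1 hxu) (.rel _ _ hE), fun h => absurd h hyu⟩,
        fun hP => ⟨fun _ => .trans _ _ _ (hP.1 hyu) (.symm _ _ (.rel _ _ hE)),
          fun h => absurd h hxu⟩⟩
  have key' : ∀ x y, Relation.EqvGen (s.Edge ident) x y → (P x ↔ P y) := by
    intro x y hxy
    induction hxy with
    | rel _ _ h' => exact key _ _ h'
    | refl => rfl
    | symm _ _ _ ih => exact ih.symm
    | trans _ _ _ _ _ ih1 ih2 => exact ih1.trans ih2
  obtain ⟨ha1, ha2⟩ := hau a ha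
  obtain ⟨hb1, hb2⟩ := hau b hb
  exact ((key' a b (hc a b ha2 hb2)).1 ⟨fun _ => .refl _, fun h => absurd h ha1⟩).1 hb1

theorem State.WeaklyConnected.connected (h : s.WeaklyConnected ident) : s.Connected ident := by
  intro u v hu hv
  clear hu hv
  obtain ⟨p⟩ := h u v
  induction p with
  | nil => exact .refl _
  | cons hadj _ ih =>
    refine .trans _ _ _ ?_ ih
    rw [SimpleGraph.fromRel_adj] at hadj
    exact hadj.2.elim (.rel _ _) fun h => .symm _ _ (.rel _ _ h)

end Connectivity

open Filter

/-! ### Settled suffixes and the extinction of messages. -/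

section Settled

variable {V I : Type*} [LinearOrder V] [LinearOrder I] [Fintype V]

/-- Used in the form: a reference that is not stored forever and is eventually never gained back is
eventually absent. -/
theorem eventually_of_frequently {P : ℕ → Prop} (h : ∀ᶠ t in atTop, P t → P (t + 1))
    (h' : ∃ᶠ t in atTop, P t) : ∀ᶠ t in atTop, P t := by
  obtain ⟨N, hN⟩ := eventually_atTop.1 h
  obtain ⟨M, hM, hP⟩ := frequently_atTop.1 h' N
  exact eventually_atTop.2 ⟨M, fun t ht => Nat.le_induction hP
    (fun n hn hp => hN n (hM.trans hn) hp) t ht⟩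

/-- A computation in which no node changes its mode or exits. -/
structure Settled (ident : V ↪o I) (σ : ℕ → State V I) (e : ℕ → Event V I) : Prop where
  comp : IsComputation ident σ e
  clean : ∀ t, (σ t).Clean
  mode : ∀ t u, ((σ t).loc u).mode = ((σ 0).loc u).mode
  gone : ∀ t u, ((σ t).loc u).gone = ((σ 0).loc u).gone

theorem Step.mode_leaving {ident : V ↪o I} {s s' : State V I} {e : Event V I}
    (h : Step ident s e s') {u : V} (hu : (s.loc u).mode = .leaving) :
    (s'.loc u).mode = .leaving := by
  by_cases hus : s'.loc u = s.loc u
  · rw [hus, hu]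
  cases h with
  | timeoutStaying v | timeoutLeaving v | exit v | receive v | initSearch v | leave v =>
    by_cases huv : u = v
    · subst huv
      simp [State.update, BuildList.timeoutStaying, BuildList.timeoutLeaving, BuildList.exit, hu,
        act_static.1, initSearch_static.2.2.1]
    · exact absurd (by simp [State.update, huv]) hus
  | idle => exact absurd rfl hus

theorem Step.gone_true {ident : V ↪o I} {s s' : State V I} {e : Event V I}
    (h : Step ident s e s') {u : V} (hu : (s.loc u).gone = true) : (s'.loc u).gone = true := by
  rcases h.loc_eq_or u with h' | ⟨h', -⟩
  · rw [h', hu]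
  · simp [State.Present, hu] at h'

theorem IsComputation.tail {ident : V ↪o I} {σ : ℕ → State V I} {e : ℕ → Event V I}
    (h : IsComputation ident σ e) (T : ℕ) :
    IsComputation ident (fun t => σ (T + t)) (fun t => e (T + t)) where
  step n := h.step (T + n)
  timeout_fair := by
    rintro u ⟨N, hN⟩ n
    obtain ⟨k, hk, hk'⟩ := h.timeout_fair u ⟨T + N, fun k hk => by
      have := hN (k - T) (by omega)
      simpa [show T + (k - T) = k by omega] using this⟩ (T + n)
    exact ⟨k - T, by omega, by simpa [show T + (k - T) = k by omega] using hk'⟩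
  receipt_fair := by
    intro n u m hu hm
    obtain ⟨k, hk, hk'⟩ := h.receipt_fair (T + n) u m hu hm
    exact ⟨k - T, by omega, by simpa [show T + (k - T) = k by omega] using hk'⟩

theorem IsComputation.clean {ident : V ↪o I} {σ : ℕ → State V I} {e : ℕ → Event V I}
    (h : IsComputation ident σ e) (h0 : (σ 0).Clean) (t : ℕ) : (σ t).Clean := by
  induction t with
  | zero => exact h0
  | succ t ih => exact (h.step t).clean ih

theorem IsComputation.connected {ident : V ↪o I} {σ : ℕ → State V I} {e : ℕ → Event V I}
    (h : IsComputation ident σ e) (h1 : (σ 0).Connected ident) (t : ℕ) :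
    (σ t).Connected ident := by
  induction t with
  | zero => exact h1
  | succ t ih => exact (h.step t).connected ih

theorem eventually_const_of_stable {P : ℕ → Prop} (h : ∀ t, P t → P (t + 1)) :
    ∃ N, ∀ t ≥ N, (P t ↔ P N) := by
  by_cases hP : ∃ N, P N
  · obtain ⟨N, hN⟩ := hP
    exact ⟨N, fun t ht => iff_of_true (Nat.le_induction hN (fun n _ => h n) t ht) hN⟩
  · push Not at hP
    exact ⟨0, fun t _ => iff_of_false (hP _) (hP _)⟩

/-- Being leaving and being gone are both stable, and there are finitely many nodes. -/
theorem IsComputation.exists_settled {ident : V ↪o I} {σ : ℕ → State V I} {e : ℕ → Event V I}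
    (h : IsComputation ident σ e) (h0 : (σ 0).Clean) :
    ∃ T, Settled ident (fun t => σ (T + t)) (fun t => e (T + t)) := by
  choose N hN using fun u => eventually_const_of_stable
    (P := fun t => ((σ t).loc u).mode = .leaving) fun t => (h.step t).mode_leaving
  choose M hM using fun u => eventually_const_of_stable
    (P := fun t => ((σ t).loc u).gone = true) fun t => (h.step t).gone_true
  refine ⟨Finset.univ.sup N + Finset.univ.sup M, h.tail _, fun t => h.clean h0 _,
    fun t u => ?_, fun t u => ?_⟩
  · have h1 := Finset.le_sup (f := N) (Finset.mem_univ u)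
    have h2 := (hN u (Finset.univ.sup N + Finset.univ.sup M + t) (by omega)).trans
      (hN u (Finset.univ.sup N + Finset.univ.sup M + 0) (by omega)).symm
    generalize ((σ _).loc u).mode = a at h2 ⊢
    generalize ((σ _).loc u).mode = b at h2 ⊢
    cases a <;> cases b <;> simp_all
  · have h1 := Finset.le_sup (f := M) (Finset.mem_univ u)
    have h2 := (hM u (Finset.univ.sup N + Finset.univ.sup M + t) (by omega)).trans
      (hM u (Finset.univ.sup N + Finset.univ.sup M + 0) (by omega)).symm
    exact Bool.eq_iff_iff.2 h2

variable {ident : V ↪o I} {σ : ℕ → State V I} {e : ℕ → Event V I}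

theorem Settled.step (H : Settled ident σ e) (t : ℕ) : Step ident (σ t) (e t) (σ (t + 1)) :=
  H.comp.step t

theorem Settled.gone_succ (H : Settled ident σ e) (t : ℕ) (u : V) :
    ((σ (t + 1)).loc u).gone = ((σ t).loc u).gone := (H.gone _ u).trans (H.gone _ u).symm

theorem Settled.mode_succ (H : Settled ident σ e) (t : ℕ) (u : V) :
    ((σ (t + 1)).loc u).mode = ((σ t).loc u).mode := (H.mode _ u).trans (H.mode _ u).symm

theorem Settled.origin (H : Settled ident σ e) {t : ℕ} {a : V} {m : Msg V I}
    (h : Sends ident (σ t) (e t) a m) : Origin ident (σ t) (e t) a m :=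
  (H.step t).origin (H.gone_succ t) h

theorem Settled.present_of_mem_ch (H : Settled ident σ e) {t : ℕ} {a : V} {m : Msg V I}
    (h : m ∈ (σ t).ch a) : (σ t).Present a := by
  by_contra hc
  simp [((H.clean t).gone a hc).2] at h

theorem Settled.receive (H : Settled ident σ e) {t : ℕ} {a : V} {m : Msg V I}
    (h : m ∈ (σ t).ch a) : ∃ k ≥ t, e k = .receive a m :=
  H.comp.receipt_fair t a m (H.present_of_mem_ch h) h

theorem Settled.receive_sent (H : Settled ident σ e) {t : ℕ} {a : V} {m : Msg V I}
    (h : Sends ident (σ t) (e t) a m) : ∃ k > t, e k = .receive a m :=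
  H.receive ((H.step t).mem_ch_of_sends h)

theorem Settled.present_iff (H : Settled ident σ e) {u : V} (t : ℕ) :
    (σ t).Present u ↔ (σ 0).Present u := by
  simp only [State.Present, H.gone t]

theorem Settled.timeout (H : Settled ident σ e) {u : V} (hu : (σ 0).Present u) (n : ℕ) :
    ∃ k ≥ n, e k = .timeout u :=
  H.comp.timeout_fair u ⟨0, fun k _ => (H.present_iff k).2 hu⟩ n

open Classical in
/-- If bad messages are only created when bad messages of a larger rank are processed, and messages
do not turn bad, then eventually there are no bad messages. -/
theorem Settled.flush (H : Settled ident σ e) (Bad : ℕ → V → Msg V I → Prop)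
    (rank : V → Msg V I → ℕ) (R : ℕ) (hR : ∀ a m, rank a m ≤ R)
    (hanti : ∀ᶠ t in atTop, ∀ a m, m ∈ (σ t).ch a → Bad (t + 1) a m → Bad t a m)
    (hnew : ∀ᶠ t in atTop, ∀ a m, Origin ident (σ t) (e t) a m → Bad (t + 1) a m →
      ∃ u m₀, e t = .receive u m₀ ∧ Bad t u m₀ ∧ rank a m < rank u m₀) :
    ∀ᶠ t in atTop, ∀ a, ∀ m ∈ (σ t).ch a, ¬ Bad t a m := by
  -- Descending elimination: eventually no bad message has a rank above `R - j`. The case `j = R +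
  -- 1` leaves none at all.
  suffices key : ∀ j, ∀ᶠ t in atTop, ∀ a, ∀ m ∈ (σ t).ch a, Bad t a m → rank a m + j ≤ R by
    filter_upwards [key (R + 1)] with t ht a m hm hb
    have := ht a m hm hb
    omega
  intro j
  induction j with
  | zero => exact .of_forall fun t a m _ _ => hR a m
  | succ j ih =>
    -- The bad messages of the largest rank that still occurs. A new one would need a bad cause of
    -- larger rank, so this multiset can only shrink.
    let F : ℕ → V → Multiset (Msg V I) := fun t a =>
      ((σ t).ch a).filter fun m => Bad t a m ∧ rank a m + j = R
    obtain ⟨T, hT⟩ := eventually_atTop.1 (ih.and (hanti.and hnew))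
    have key : ∀ t ≥ T, ∀ a, F (t + 1) a ≤ F t a ∧
        ∀ m, e t = .receive a m → m ∈ F t a → m ::ₘ F (t + 1) a ≤ F t a := by
      intro t ht a
      obtain ⟨h1, h2, h3⟩ := hT t ht
      obtain ⟨res, new, c1, c2, c3⟩ := (H.step t).ch_spec
      have hFr : F (t + 1) a ≤ (res a).filter fun m => Bad t a m ∧ rank a m + j = R := by
        have hres : res a ≤ (σ t).ch a := by
          rcases c3 a with ⟨m, -, hm⟩ | ⟨-, hm⟩
          · rw [hm]; exact Multiset.le_cons_self _ _
          · exact hm.le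
        have hnew0 : (new a).filter (fun m => Bad (t + 1) a m ∧ rank a m + j = R) = 0 := by
          rw [Multiset.filter_eq_nil]
          rintro m hm ⟨hb, hr⟩
          have ho := H.origin ((c2 a m).1 hm)
          obtain ⟨u, m₀, he, hb₀, hlt⟩ := h3 a m ho hb
          have hm₀ : m₀ ∈ (σ t).ch u := by
            have := H.step t
            rw [he] at this
            exact this.mem_of_receive
          have := h1 u m₀ hm₀ hb₀
          omega
        have : F (t + 1) a = (res a).filter fun m => Bad (t + 1) a m ∧ rank a m + j = R := by
          simp only [F, c1 a, Multiset.filter_add, hnew0, add_zero]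
        rw [this, Multiset.le_filter]
        refine ⟨Multiset.filter_le _ _, fun m hm => ?_⟩
        rw [Multiset.mem_filter] at hm
        exact ⟨h2 a m (Multiset.mem_of_le hres hm.1) hm.2.1, hm.2.2⟩
      rcases c3 a with ⟨m, hm1, hm2⟩ | ⟨hm1, hm2⟩
      · have hF : F t a = (m ::ₘ res a).filter fun m => Bad t a m ∧ rank a m + j = R := by
          simp only [F, hm2]
        rw [hF]
        refine ⟨hFr.trans (Multiset.filter_le_filter _ (Multiset.le_cons_self _ _)), ?_⟩
        intro m' hm' hmem
        rw [hm1] at hm'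
        simp only [Event.receive.injEq, true_and] at hm'
        subst hm'
        rw [Multiset.mem_filter] at hmem
        rw [Multiset.filter_cons_of_pos (p := fun m => Bad t a m ∧ rank a m + j = R) _ hmem.2]
        exact (Multiset.cons_le_cons_iff _).2 hFr
      · have hF : F t a = (res a).filter fun m => Bad t a m ∧ rank a m + j = R := by
          simp only [F, hm2]
        rw [hF]
        exact ⟨hFr, fun m hm => absurd hm (hm1 m)⟩
    have hzero : ∀ a, ∀ᶠ t in atTop, F t a = 0 := by
      intro a
      -- From the time at which the cardinality is minimal the multiset is constant. Were it
      -- nonempty, fair receipt of one of its elements would shrink it further.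
      have hne : (Set.range fun t => (F (T + t) a).card).Nonempty := ⟨_, 0, rfl⟩
      obtain ⟨n, hn⟩ := Nat.sInf_mem hne
      have hmin : ∀ t ≥ T + n, (F (T + n) a).card ≤ (F t a).card := by
        intro t ht
        have : (F t a).card ∈ Set.range fun t => (F (T + t) a).card :=
          ⟨t - T, by simp [show T + (t - T) = t by omega]⟩
        exact hn.le.trans (Nat.sInf_le this)
      have hle : ∀ t ≥ T, ∀ k ≥ t, F k a ≤ F t a := fun t ht k hk =>
        Nat.le_induction le_rfl (fun k hk ih => (key k (ht.trans hk) a).1.trans ih) k hk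
      have heq : ∀ t ≥ T + n, F t a = F (T + n) a := fun t ht =>
        Multiset.eq_of_le_of_card_le (hle _ (by omega) _ ht) (hmin t ht)
      refine eventually_atTop.2 ⟨T + n, fun t ht => ?_⟩
      refine Multiset.eq_zero_of_forall_notMem fun m hm => ?_
      obtain ⟨k, hk, hek⟩ := H.receive (Multiset.mem_filter.1 hm).1
      have hmk : m ∈ F k a := by rwa [heq k (by omega), ← heq t ht]
      have := Multiset.card_le_card ((key k (by omega) a).2 m hek hmk)
      rw [heq k (by omega), heq (k + 1) (by omega), Multiset.card_cons] at this
      omega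
    filter_upwards [ih, eventually_all.2 hzero] with t h1 h2 a m hm hb
    have h3 := h1 a m hm hb
    by_contra hc
    have : m ∈ F t a := Multiset.mem_filter.2 ⟨hm, hb, by omega⟩
    simp [h2 a] at this

end Settled

/-! ### Effects of the actions in a settled computation. -/

section Effects

variable {V I : Type*} [LinearOrder V] [LinearOrder I] [Fintype V]

theorem revAndLinReq_sends {u a : V} {d : Side} {x : NodeState V I}
    (hd : x.mode = .staying ∨ d = .right) (ha : x.Mem u a) (hs : OnSide d u a) :
    ∃ k, (revAndLinReq u d (sanitize u x)).1.uniqueValues a = some k ∧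
      (a, Msg.revAndLinAck u k) ∈ (revAndLinReq u d (sanitize u x)).2 := by
  suffices h : ∃ k, (revAndLinReq u d (sanitize u x)).1.uniqueValues a = some k ∧
      k ≤ (revAndLinReq u d (sanitize u x)).1.counter by
    obtain ⟨k, h1, h2⟩ := h
    exact ⟨k, h1, send_revAndLinReq.2 ⟨hd, ha, hs, k, h1, h2, rfl⟩⟩
  have hmem : a ∈ (sanitize u x).nbr d ∪ (sanitize u x).tmp d :=
    mem_nbr_or_tmp_sanitize.2 ⟨ha, hs⟩
  obtain ⟨k, hk⟩ := exists_assignValues (x := sanitize u x) hmem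
  have hk' := assignValues_le_counter hk
  refine ⟨k, ?_⟩
  rcases hm : x.mode <;> cases d <;> simp only [revAndLinReq, sanitize_mode, hm]
  · exact ⟨hk, hk'⟩
  · exact ⟨hk, hk'⟩
  · simp [hm] at hd
  · exact ⟨hk, hk'⟩

variable {ident : V ↪o I} {σ : ℕ → State V I} {e : ℕ → Event V I}

/-- `u` is staying. -/
def Stays (σ : ℕ → State V I) (u : V) : Prop := ((σ 0).loc u).mode = .staying

/-- `u` is leaving, but has not exited. -/
def Leaves (σ : ℕ → State V I) (u : V) : Prop :=
  ((σ 0).loc u).mode = .leaving ∧ (σ 0).Present u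

theorem Settled.stays_iff (H : Settled ident σ e) {t : ℕ} {u : V} :
    ((σ t).loc u).mode = .staying ↔ Stays σ u := by rw [H.mode t, Stays]

theorem Settled.mode_of_leaves (H : Settled ident σ e) {t : ℕ} {u : V} (hu : Leaves σ u) :
    ((σ t).loc u).mode = .leaving := by rw [H.mode t]; exact hu.1

theorem Settled.stays_present (H : Settled ident σ e) {u : V} (hu : Stays σ u) :
    (σ 0).Present u := by
  by_contra hc
  have := ((H.clean 0).gone u hc).1
  rw [Stays, this] at hu
  simp at hu

theorem Leaves.not_stays {u : V} (hu : Leaves σ u) : ¬ Stays σ u := by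
  simp [Stays, hu.1]

theorem stays_or_leaves {u : V} (hu : (σ 0).Present u) :
    Stays σ u ∨ Leaves σ u := by
  rcases h : ((σ 0).loc u).mode
  exacts [.inl h, .inr ⟨h, hu⟩]

theorem Settled.step_of (H : Settled ident σ e) {t : ℕ} {ev : Event V I} (h : e t = ev) :
    Step ident (σ t) ev (σ (t + 1)) := h ▸ H.step t

theorem Settled.leaves_of_receive (H : Settled ident σ e) {t : ℕ} {u : V} {m : Msg V I}
    (h : e t = .receive u m) (hm : ((σ t).loc u).mode = .leaving) : Leaves σ u :=
  ⟨(H.mode t u) ▸ hm, (H.present_iff t).1 (H.step_of h).present_receive⟩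

theorem Settled.leaves_of_timeout (H : Settled ident σ e) {t : ℕ} {u : V}
    (h : e t = .timeout u) (hm : ((σ t).loc u).mode = .leaving) : Leaves σ u :=
  ⟨(H.mode t u) ▸ hm, (H.present_iff t).1 (H.step_of h).present_timeout⟩

theorem Settled.gain (H : Settled ident σ e) {t : ℕ} {y b : V} (h : (σ (t + 1)).Mem y b)
    (h' : ¬ (σ t).Mem y b) : ∃ m, e t = .receive y m ∧ m ∈ (σ t).ch y ∧ b ∈ m.refs ∧
      (Stays σ y → (∃ w, m = .introduce b (some w)) ∨ (∃ N k, m = .revAndLin N k ∧ b ∈ N) ∨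
        ∀ z, (σ t).Mem y z → z ≠ b ∧ ¬ Btw y z b) := by
  by_cases hr : ∃ m, e t = .receive y m
  · obtain ⟨m, hr⟩ := hr
    have hst := H.step_of hr
    rw [State.Mem, hst.loc_receive] at h
    obtain ⟨h1, h2⟩ := act_gain h h'
    refine ⟨m, hr, hst.mem_of_receive, h1, fun hs => ?_⟩
    rw [← H.stays_iff (t := t)] at hs
    simpa only [Nb_of_staying hs] using h2 hs
  · push Not at hr
    exact absurd ((((H.step t).loc_of_not_receive (H.gone_succ t y) hr).1 b).1 h) h'

theorem Settled.loss (H : Settled ident σ e) {t : ℕ} {y b : V} (h : (σ t).Mem y b)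
    (h' : ¬ (σ (t + 1)).Mem y b) :
    (e t = .receive y (.linearize b) ∧ Stays σ y ∧ ∃ z, (σ t).Mem y z ∧ Btw y z b) ∨
    (∃ N k, e t = .receive y (.revAndLin N k) ∧ ((σ t).loc y).uniqueValues b = some k ∧
      (Stays σ y ∨ y < b)) := by
  rcases (H.step t).mem_or_sends (H.gone_succ t) h with h1 | ⟨h1, h2, h3⟩ | ⟨N, k, h1, h2, h3, -⟩
  · exact absurd h1 h'
  · exact .inl ⟨h1, H.stays_iff.1 h2, h3⟩
  · exact .inr ⟨N, k, h1, h2, h3.imp_left H.stays_iff.1⟩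

theorem Settled.gain_nb (H : Settled ident σ e) {t : ℕ} {y b : V} (hy : Leaves σ y)
    (h : (σ (t + 1)).Nb y b) (h' : ¬ (σ t).Nb y b) :
    ∃ N k, e t = .receive y (.revAndLin N k) ∧ b ∈ N := by
  by_cases hr : ∃ m, e t = .receive y m
  · obtain ⟨m, hr⟩ := hr
    rw [State.Nb, (H.step_of hr).loc_receive] at h
    obtain ⟨N, k, rfl, hb⟩ := act_Nb_gain (H.mode_of_leaves hy) h h'
    exact ⟨N, k, hr, hb⟩
  · push Not at hr
    exact absurd ((((H.step t).loc_of_not_receive (H.gone_succ t y) hr).2.1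
      (H.mode_succ t y) b).1 h) h'

theorem Settled.counter_le (H : Settled ident σ e) (t : ℕ) (y : V) :
    ((σ t).loc y).counter ≤ ((σ (t + 1)).loc y).counter := by
  by_cases hr : ∃ m, e t = .receive y m
  · obtain ⟨m, hr⟩ := hr
    rw [(H.step_of hr).loc_receive]
    exact counter_le_act
  · push Not at hr
    exact ((H.step t).loc_of_not_receive (H.gone_succ t y) hr).2.2.1.ge

theorem Settled.value_eq (H : Settled ident σ e) {t : ℕ} {y b : V} {k : ℕ}
    (h : ((σ (t + 1)).loc y).uniqueValues b = some k) :
    ((σ t).loc y).uniqueValues b = some k ∨ ((σ t).loc y).counter < k := by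
  by_cases hr : ∃ m, e t = .receive y m
  · obtain ⟨m, hr⟩ := hr
    rw [(H.step_of hr).loc_receive] at h
    exact (act_value_eq h).imp_left fun h => h.1
  · push Not at hr
    left
    rcases ((H.step t).loc_of_not_receive (H.gone_succ t y) hr).2.2.2 with h' | h' | ⟨h', -⟩
    · rwa [h'] at h
    · rw [h'] at h
      exact sanitize_value_eq h
    · rwa [h'] at h

theorem Settled.value_succ (H : Settled ident σ e) {t : ℕ} {y b : V} {k : ℕ}
    (h : ((σ t).loc y).uniqueValues b = some k) (hb : (σ t).Mem y b) :
    ((σ (t + 1)).loc y).uniqueValues b = some k := by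
  by_cases hr : ∃ m, e t = .receive y m
  · obtain ⟨m, hr⟩ := hr
    rw [(H.step_of hr).loc_receive]
    exact act_value h hb
  · push Not at hr
    rcases ((H.step t).loc_of_not_receive (H.gone_succ t y) hr).2.2.2 with h' | h' | ⟨h', -⟩
    · rwa [h']
    · rw [h', sanitize_value hb, h]
    · rwa [h']

/-! ### What the actions do -/

theorem Settled.timeout_stays (H : Settled ident σ e) {t : ℕ} {y b : V} (he : e t = .timeout y)
    (hy : Stays σ y) (hb : (σ t).Mem y b) :
    ((∀ w, (σ t).Mem y w → ¬ Btw y w b) ∧ Sends ident (σ t) (e t) b (.introduce y none)) ∨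
    ∃ z, (σ t).Mem y z ∧ Btw y z b ∧ Sends ident (σ t) (e t) z (.introduce b (some y)) := by
  have hm := (H.stays_iff (t := t)).2 hy
  have hS : ∀ a m, (a, m) ∈ (timeoutStaying y (sanitize y ((σ t).loc y))).2 →
      Sends ident (σ t) (e t) a m := fun a m h => by
    rw [he]
    exact ⟨_, by simp only [result, hm]; rfl, h⟩
  by_cases hn : ∀ w, (σ t).Mem y w → ¬ Btw y w b
  · exact .inl ⟨hn, hS _ _ ((send_timeoutStaying hm).2 (.inr (.inr ⟨hb, hn, rfl⟩)))⟩
  · right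
    push Not at hn
    obtain ⟨w, hw, hwb⟩ := hn
    obtain ⟨d, hd⟩ := exists_onSide hb.2
    rw [State.Mem, ← Nb_of_staying hm] at hw
    obtain ⟨z, hz⟩ := exists_nextInward hd hw hwb
    obtain ⟨h1, h2, h3⟩ := (nextInward_sanitize hd).1 hz
    simp only [Nb_of_staying hm] at h1 h3
    exact ⟨z, h1, h2, hS _ _ ((send_timeoutStaying hm).2 (.inr (.inl ⟨b, hb, h1, h2, h3, rfl⟩)))⟩

/-- Otherwise the Timeout would be an exit, which does not occur in a settled computation. This is
the source of the final contradiction about leaving nodes. -/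
theorem Settled.not_nidec (H : Settled ident σ e) {t : ℕ} {y : V} (he : e t = .timeout y)
    (hy : Leaves σ y) : ¬ (σ t).Nidec y := by
  have hm := H.mode_of_leaves (t := t) hy
  have hst := H.step_of he
  intro ho
  generalize hs : σ (t + 1) = s' at hst
  have hg := H.gone_succ t y
  rw [hs] at hg
  cases hst with
  | timeoutStaying _ _ h => simp [hm] at h
  | timeoutLeaving _ _ _ h => exact h ho
  | exit _ hp => simp [State.update, BuildList.exit, show _ = false from hp] at hg

theorem Settled.timeout_leaves (H : Settled ident σ e) {t : ℕ} {y b : V} {d : Side}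
    (he : e t = .timeout y) (hy : Leaves σ y) (hb : (σ t).Mem y b) (hd : OnSide d y b) :
    Sends ident (σ t) (e t) b (.revAndLinReq d.other) := by
  have hm := H.mode_of_leaves (t := t) hy
  have ho := H.not_nidec he hy
  rw [he]
  refine ⟨_, by simp only [result, hm, ho, if_false]; rfl, ?_⟩
  exact send_timeoutLeaving.2 ⟨d, hb, hd, rfl⟩

theorem Settled.receive_req (H : Settled ident σ e) {t : ℕ} {y b : V} {d : Side}
    (he : e t = .receive y (.revAndLinReq d)) (hy : Stays σ y ∨ d = .right)
    (hb : (σ t).Mem y b) (hd : OnSide d y b) :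
    ∃ k, ((σ (t + 1)).loc y).uniqueValues b = some k ∧
      Sends ident (σ t) (e t) b (.revAndLinAck y k) := by
  rw [← H.stays_iff (t := t)] at hy
  obtain ⟨k, h1, h2⟩ := revAndLinReq_sends hy hb hd
  refine ⟨k, ?_, ?_⟩
  · rw [(H.step_of he).loc_receive]; exact h1
  · rw [he, sends_receive]; exact h2

theorem Settled.receive_ack (H : Settled ident σ e) {t : ℕ} {g y : V} {k : ℕ}
    (he : e t = .receive g (.revAndLinAck y k)) (hg : Leaves σ g) (hy : y ≠ g) :
    ∃ N, (∀ n ∈ N, (σ t).Nb g n ∧ Btw y g n) ∧ Sends ident (σ t) (e t) y (.revAndLin N k) := by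
  have hm := H.mode_of_leaves (t := t) hg
  obtain ⟨d, hd⟩ := exists_onSide hy
  have : (y, Msg.revAndLin ((sanitize g ((σ t).loc g)).nbr d.other) k) ∈
      (act ident g (.revAndLinAck y k) (sanitize g ((σ t).loc g))).2 := by
    simp only [act, revAndLinAck, sideOf_eq_some.2 hd, sanitize_mode, hm]
    simp
  refine ⟨_, fun n hn => ?_, by rw [he, sends_receive]; exact this⟩
  obtain ⟨-, ⟨h, -⟩ | ⟨-, -, N, h1, h2⟩⟩ := send_revAndLinAck.1 this
  · simp [hm] at h
  · simp only [Msg.revAndLin.injEq, and_true] at h1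
    exact (h2 n).1 (h1 ▸ hn)

theorem Settled.receive_revAndLin (H : Settled ident σ e) {t : ℕ} {y g : V} {N : Finset V} {k : ℕ}
    (he : e t = .receive y (.revAndLin N k)) (hg : (σ t).Mem y g)
    (hk : ((σ t).loc y).uniqueValues g = some k) (hN : ∀ n ∈ N, Btw y g n) :
    (Stays σ y → ¬ (σ (t + 1)).Mem y g) ∧
    (Leaves σ y → y < g → (σ t).Nb y g → ¬ (σ (t + 1)).Nb y g) ∧
    (Leaves σ y → y < g → ¬ (σ t).Nb y g → ¬ (σ (t + 1)).Mem y g) := by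
  have h := revAndLin_drop ((H.clean t).unique y) hg hk hN
  have hl := (H.step_of he).loc_receive
  simp only [State.Mem, State.Nb, hl]
  exact ⟨fun hs => h.1 (H.stays_iff.2 hs), fun hl => h.2.1 (H.mode_of_leaves hl),
    fun hl => h.2.2 (H.mode_of_leaves hl)⟩

theorem Settled.receive_introduce (H : Settled ident σ e) {t : ℕ} {z b y : V}
    (he : e t = .receive z (.introduce b (some y))) (hb : b ≠ z) :
    (Stays σ z → Sends ident (σ t) (e t) y (.linearize b)) ∧
    (Leaves σ z → y ≠ z → (σ (t + 1)).Mem z y) := by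
  refine ⟨fun hz => ?_, fun hz hy => ?_⟩
  · rw [he, sends_receive]
    exact send_introduce.2 ⟨hb, H.stays_iff.2 hz, .inl ⟨y, rfl, .inl ⟨rfl, rfl⟩⟩⟩
  · rw [State.Mem, (H.step_of he).loc_receive]
    exact mem_introduce.2 (.inr ⟨hy, hb, .inr ⟨H.mode_of_leaves hz, .inr rfl⟩⟩)

theorem Settled.receive_introduce_none (H : Settled ident σ e) {t : ℕ} {z y : V}
    (he : e t = .receive z (.introduce y none)) (hy : y ≠ z) (hz : Leaves σ z) :
    (σ (t + 1)).Mem z y := by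
  rw [State.Mem, (H.step_of he).loc_receive]
  exact mem_introduce.2 (.inr ⟨hy, hy, .inr ⟨H.mode_of_leaves hz, .inl rfl⟩⟩)

theorem Settled.receive_linearize (H : Settled ident σ e) {t : ℕ} {y b z : V}
    (he : e t = .receive y (.linearize b)) (hy : Stays σ y) (hz : (σ t).Mem y z)
    (hb : Btw y z b) : ¬ (σ (t + 1)).Mem y b := by
  rw [State.Mem, (H.step_of he).loc_receive]
  simp only [act]
  rw [mem_linearize, H.stays_iff]
  rintro (⟨-, -, h⟩ | ⟨h, -⟩)
  · exact h ⟨rfl, z, hz, hb⟩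
  · rw [← H.stays_iff (t := t), h] at hy
    simp at hy

/-! ### Which references are lost -/

/-- An acknowledgement sent by the protocol carries a value not above the sender's counter whose
only owner is the addressee. The RevAndLin answering it comes from that addressee, which is leaving.
Fake initial values are flushed, so eventually RevAndLin never deletes a reference to a staying
node. -/
theorem Settled.owner_leaves (H : Settled ident σ e) :
    ∀ᶠ t in atTop, ∀ y N k b, e t = .receive y (.revAndLin N k) →
      ((σ t).loc y).uniqueValues b = some k → ¬ Stays σ b := by
  let Bad : ℕ → V → Msg V I → Prop := fun t a m =>
    (∃ v x, m = .revAndLinAck v x ∧ ¬ (x ≤ ((σ t).loc v).counter ∧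
      ∀ w, ((σ t).loc v).uniqueValues w = some x → w = a)) ∨
    (∃ N x, m = .revAndLin N x ∧ ¬ (x ≤ ((σ t).loc a).counter ∧
      ∀ w, ((σ t).loc a).uniqueValues w = some x → ¬ Stays σ w))
  let rank : V → Msg V I → ℕ := fun _ m => match m with
    | .revAndLinAck _ _ => 1
    | _ => 0
  -- Fresh values exceed the counter, so the set of owners of a value not above the counter cannot
  -- grow.
  have stable : ∀ (t : ℕ) (v : V) (x : ℕ) (P : V → Prop), (x ≤ ((σ t).loc v).counter ∧
      ∀ w, ((σ t).loc v).uniqueValues w = some x → P w) → (x ≤ ((σ (t + 1)).loc v).counter ∧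
      ∀ w, ((σ (t + 1)).loc v).uniqueValues w = some x → P w) := by
    rintro t v x P ⟨h1, h2⟩
    refine ⟨h1.trans (H.counter_le t v), fun w hw => ?_⟩
    rcases H.value_eq hw with h | h
    · exact h2 w h
    · omega
  have key := H.flush Bad rank 1 (fun a m => by cases m <;> simp [rank])
    (.of_forall fun t a m _ hb => by
      rcases hb with ⟨v, x, rfl, hb⟩ | ⟨N, x, rfl, hb⟩
      · exact .inl ⟨v, x, rfl, fun h => hb (stable t v x _ h)⟩
      · exact .inr ⟨N, x, rfl, fun h => hb (stable t a x _ h)⟩)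
    (.of_forall fun t a m ho hb => by
      rcases hb with ⟨v, x, rfl, hb⟩ | ⟨N, x, rfl, hb⟩
      · generalize he : e t = ev at ho
        cases ho with
        | reply _ hr =>
          cases hr with
          | ack hd ha hs hk hc =>
            rw [(H.step_of he).loc_receive] at hb
            refine absurd ⟨hc, fun w hw => ?_⟩ hb
            exact act_ValuesInjective ((H.clean t).unique v) w a x hw hk
      · generalize he : e t = ev at ho
        cases ho with
        | @reply u _ _ _ _ hr =>
          cases hr with
          | revAndLin hm ha hN =>
            refine ⟨u, _, rfl, .inl ⟨a, x, rfl, fun h => hb ?_⟩, by simp [rank]⟩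
            refine stable t a x _ ⟨h.1, fun w hw => ?_⟩
            rw [h.2 w hw]
            exact (H.leaves_of_receive he hm).not_stays)
  filter_upwards [key] with t ht y N k b he hk hs
  have h2 : ¬ ¬ (k ≤ ((σ t).loc y).counter ∧
      ∀ w, ((σ t).loc y).uniqueValues w = some k → ¬ Stays σ w) := fun hn =>
    ht y _ (H.step_of he).mem_of_receive (.inr ⟨N, k, rfl, hn⟩)
  exact (not_not.1 h2).2 b hk hs

theorem Settled.mem_stays_succ (H : Settled ident σ e) :
    ∀ᶠ t in atTop, ∀ y z, Stays σ z → (σ t).Mem y z → (σ (t + 1)).Mem y z ∨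
      (e t = .receive y (.linearize z) ∧ Stays σ y ∧ ∃ w, (σ t).Mem y w ∧ Btw y w z) := by
  filter_upwards [H.owner_leaves] with t ht y z hz hm
  by_contra hc
  push Not at hc
  rcases H.loss hm hc.1 with ⟨h1, h2, w, h3⟩ | ⟨N, k, h1, h2, -⟩
  · exact hc.2 h1 h2 w h3.1 h3.2
  · exact ht y N k z h1 h2 hz

/-- A leaving node ignores the removal part of Linearize, and its RevAndLin removes only nodes on
its right. -/
theorem Settled.leaves_mem_left (H : Settled ident σ e) {t : ℕ} {y z : V} (hy : Leaves σ y)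
    (hz : z < y) (h : (σ t).Mem y z) : (σ (t + 1)).Mem y z := by
  by_contra hc
  rcases H.loss h hc with ⟨-, h2, -⟩ | ⟨N, k, -, -, h3 | h3⟩
  · exact hy.not_stays h2
  · exact hy.not_stays h3
  · exact absurd h3 hz.not_gt

theorem Settled.leaves_mem_stays (H : Settled ident σ e) :
    ∀ᶠ t in atTop, ∀ y z, Leaves σ y → (Stays σ z ∨ z < y) → (σ t).Mem y z →
      (σ (t + 1)).Mem y z := by
  filter_upwards [H.mem_stays_succ] with t ht y z hy hz hm
  rcases hz with hz | hz
  · exact (ht y z hz hm).resolve_right fun h => hy.not_stays h.2.1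
  · exact H.leaves_mem_left hy hz hm

end Effects

/-! ### Every hop lowers the rank of a probe. -/

section Probes

variable {V I : Type*} [LinearOrder V] [LinearOrder I] [Fintype V]

/-- `i` lies between `j` and `k`, inclusively. -/
def Within (j i k : I) : Prop := (j ≤ i ∧ i ≤ k) ∨ (k ≤ i ∧ i ≤ j)

open Classical in
/-- A bound for the number of nodes that still pass on a probe in the channel of `a`. -/
noncomputable def probeRank (ident : V ↪o I) (a : V) (D : I) (next : Finset V) : ℕ :=
  if ∀ v ∈ next, Within (ident a) (ident v) D then
    (Finset.univ.filter fun v => v ≠ a ∧ Within (ident a) (ident v) D).card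
  else if InRange ident a D next then Fintype.card V + 1
  else if ∀ v ∈ next, v = a ∨ OnSide (probeSide (ident a) D) a v then
    Fintype.card V + 2 + (Finset.univ.filter fun v => OnSide (probeSide (ident a) D) a v).card
  else 2 * Fintype.card V + 3

variable {ident : V ↪o I} {u a : V} {D : I} {next : Finset V} {x : NodeState V I}

theorem nextSet_beyond (ha : nearest (probeSide (ident u) D) (nextSet ident u D next x) = some a)
    {b : V} (hb : b ∈ nextSet ident u D next x) : b = a ∨ OnSide (probeSide (ident u) D) a b := by
  have := (nearest_eq_some.1 ha).2 b hb
  revert this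
  cases probeSide (ident u) D <;> simp only [OnSide, Side.other] <;> grind

theorem hop_within (hD : D ≠ ident u) (hw : ∀ v ∈ next, Within (ident u) (ident v) D)
    (ha : nearest (probeSide (ident u) D) (nextSet ident u D next x) = some a) :
    (∀ v ∈ nextSet ident u D next x, Within (ident a) (ident v) D) ∧
    Within (ident u) (ident a) D ∧
    ∀ v ∈ nextSet ident u D next x, v = a ∨ Btw u a v := by
  have hall : ∀ v ∈ nextSet ident u D next x, Within (ident u) (ident v) D ∧ v ≠ u := by
    intro v hv
    rcases mem_nextSet.1 hv with h | ⟨h, hs, hn⟩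
    · exact ⟨hw v h.1, h.2⟩
    · refine ⟨?_, h.mem.2⟩
      rcases probeSide_eq hD with ⟨h1, h2⟩ | ⟨h1, h2⟩ <;> rw [h2] at hs hn
      · exact .inl ⟨(ident.monotone (le_of_lt hs)), hn⟩
      · exact .inr ⟨hn, (ident.monotone (le_of_lt hs))⟩
  have haw := hall a (nearest_eq_some.1 ha).1
  refine ⟨fun v hv => ?_, haw.1, fun v hv => ?_⟩
  · have h1 := (hall v hv).1
    have h2 := haw.1
    have h3 := nextSet_beyond ha hv
    rcases probeSide_eq hD with ⟨h4, h5⟩ | ⟨h4, h5⟩ <;> rw [h5] at h3 <;> simp only [OnSide] at h3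
    · have : ident a ≤ ident v := ident.monotone (by grind)
      unfold Within at *; grind
    · have : ident v ≤ ident a := ident.monotone (by grind)
      unfold Within at *; grind
  · refine (nextSet_beyond ha hv).imp_right fun h3 => ?_
    have h2 := haw.1
    have hne : ident a ≠ ident u := fun h => haw.2 (ident.injective h)
    rcases probeSide_eq hD with ⟨h4, h5⟩ | ⟨h4, h5⟩ <;> rw [h5] at h3 <;> simp only [OnSide] at h3
    · have : ident u < ident a := by unfold Within at *; grind
      exact .inl ⟨ident.lt_iff_lt.1 this, h3⟩
    · have : ident a < ident u := by unfold Within at *; grind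
      exact .inr ⟨h3, ident.lt_iff_lt.1 this⟩

theorem probeRank_le (ident : V ↪o I) (a : V) (D : I) (next : Finset V) :
    probeRank ident a D next ≤ 2 * Fintype.card V + 3 := by
  classical
  unfold probeRank
  split_ifs
  · exact (Finset.card_le_univ _).trans (by omega)
  · omega
  · have := Finset.card_le_univ (Finset.univ.filter fun v => OnSide (probeSide (ident a) D) a v)
    omega
  · exact le_rfl

theorem probeRank_within_le (h : ∀ v ∈ next, Within (ident a) (ident v) D) :
    probeRank ident a D next ≤ Fintype.card V := by
  classical
  unfold probeRank
  rw [if_pos h]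
  exact Finset.card_le_univ _

theorem probeRank_inRange_le (h : InRange ident a D next) :
    probeRank ident a D next ≤ Fintype.card V + 1 := by
  classical
  unfold probeRank
  split_ifs
  · exact (Finset.card_le_univ _).trans (by omega)
  · omega

/-- If the direction of travel flips at `a`, then `a` has passed `D`, and the remaining nodes lie
still farther that way. In the new direction none of them is beyond `D`. -/
theorem hop_inRange_or (hD : D ≠ ident u)
    (ha : nearest (probeSide (ident u) D) (nextSet ident u D next x) = some a) :
    InRange ident a D (nextSet ident u D next x) ∨ (D ≠ ident a ∧
      probeSide (ident a) D = probeSide (ident u) D) := by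
  by_cases hDa : D = ident a
  · exact .inl (.inl hDa)
  by_cases hs : probeSide (ident a) D = probeSide (ident u) D
  · exact .inr ⟨hDa, hs⟩
  refine .inl (.inr fun v hv => ?_)
  have h3 := nextSet_beyond ha hv
  rcases probeSide_eq hD with ⟨h4, h5⟩ | ⟨h4, h5⟩ <;> rw [h5] at h3 hs <;>
    simp only [OnSide] at h3 <;>
    rcases probeSide_eq hDa with ⟨h6, h7⟩ | ⟨h6, h7⟩ <;> rw [h7] at hs ⊢ <;> simp only [NotBeyond]
  · exact absurd rfl hs
  · exact h6.le.trans (ident.monotone (by grind))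
  · exact (ident.monotone (show v ≤ a by grind)).trans h6.le
  · exact absurd rfl hs

/-- The cases of `probeRank` are stages that a probe descends. While all targets lie between its
holder and `D`, each hop shortens that interval. A probe that is in range but has targets behind
reaches this stage in one hop, as the rearmost target is visited first. A probe not in range either
becomes so or moves on with all targets ahead, and then the number of nodes ahead decreases. The
summand `Fintype.card V + 2` separates this stage from the earlier bounds, and `2 * Fintype.card V +
3` exceeds all of them. -/
theorem probeRank_hop (hD : D ≠ ident u)
    (ha : nearest (probeSide (ident u) D) (nextSet ident u D next x) = some a) :
    probeRank ident a D (nextSet ident u D next x) < probeRank ident u D next := by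
  classical
  by_cases h1 : ∀ v ∈ next, Within (ident u) (ident v) D
  · obtain ⟨h2, h3, -⟩ := hop_within hD h1 ha
    have hau := ne_of_mem_nextSet (nearest_eq_some.1 ha).1
    have hne : ident a ≠ ident u := fun h => hau (ident.injective h)
    unfold probeRank
    rw [if_pos h1, if_pos h2]
    refine Finset.card_lt_card (Finset.ssubset_iff_of_subset ?_ |>.2 ⟨a, ?_, ?_⟩)
    · intro v hv
      simp only [Finset.mem_filter, Finset.mem_univ, true_and] at hv ⊢
      have hv' : ident v ≠ ident a := fun h => hv.1 (ident.injective h)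
      refine ⟨?_, ?_⟩
      · rintro rfl
        unfold Within at *; grind
      · unfold Within at *; grind
    · simp only [Finset.mem_filter, Finset.mem_univ, true_and]
      exact ⟨hau, h3⟩
    · simp
  by_cases h2 : InRange ident u D next
  · have h3 := (h2.hop hD ha).1
    have h4 : ∀ v ∈ nextSet ident u D next x, Within (ident a) (ident v) D := by
      intro v hv
      have h5 := h3 v hv
      have h6 := nextSet_beyond ha hv
      rcases probeSide_eq hD with ⟨-, h⟩ | ⟨-, h⟩ <;> rw [h] at h5 h6 <;>
        simp only [OnSide, NotBeyond] at h5 h6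
      · exact .inl ⟨ident.monotone (by grind), h5⟩
      · exact .inr ⟨h5, ident.monotone (by grind)⟩
    have h5 := probeRank_within_le h4
    have : probeRank ident u D next = Fintype.card V + 1 := by
      unfold probeRank; rw [if_neg h1, if_pos h2]
    omega
  have h0 : Fintype.card V + 2 ≤ probeRank ident u D next := by
    unfold probeRank; rw [if_neg h1, if_neg h2]
    split_ifs <;> omega
  rcases hop_inRange_or hD ha with h3 | ⟨hDa, hs⟩
  · have := probeRank_inRange_le h3
    omega
  by_cases h3 : InRange ident a D (nextSet ident u D next x)
  · have := probeRank_inRange_le h3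
    omega
  have h4 : ∀ v ∈ nextSet ident u D next x, v = a ∨ OnSide (probeSide (ident a) D) a v :=
    fun v hv => hs ▸ nextSet_beyond ha hv
  have h5 : ¬ ∀ v ∈ nextSet ident u D next x, Within (ident a) (ident v) D := by
    intro h
    refine h3 (.inr fun v hv => ?_)
    have h6 := h v hv
    have h7 := h4 v hv
    rcases probeSide_eq hDa with ⟨h8, h⟩ | ⟨h8, h⟩ <;> rw [h] at h7 ⊢ <;>
      simp only [OnSide, NotBeyond] at h7 ⊢ <;> unfold Within at h6 <;> grind
  have h6 : probeRank ident a D (nextSet ident u D next x) = Fintype.card V + 2 +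
      (Finset.univ.filter fun v => OnSide (probeSide (ident a) D) a v).card := by
    unfold probeRank
    rw [if_neg h5, if_neg h3, if_pos h4]
  rw [h6]
  by_cases h7 : ∀ v ∈ next, v = u ∨ OnSide (probeSide (ident u) D) u v
  · have : probeRank ident u D next = Fintype.card V + 2 +
        (Finset.univ.filter fun v => OnSide (probeSide (ident u) D) u v).card := by
      unfold probeRank
      rw [if_neg h1, if_neg h2, if_pos h7]
    rw [this]
    have hau : OnSide (probeSide (ident u) D) u a := by
      rcases mem_nextSet.1 (nearest_eq_some.1 ha).1 with h | ⟨-, h, -⟩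
      · exact (h7 a h.1).resolve_left h.2
      · exact h
    refine Nat.add_lt_add_left (Finset.card_lt_card
      (Finset.ssubset_iff_of_subset ?_ |>.2 ⟨a, ?_, ?_⟩)) _
    · intro v hv
      simp only [Finset.mem_filter, Finset.mem_univ, true_and] at hv ⊢
      rw [hs] at hv
      revert hv hau
      cases probeSide (ident u) D <;> simp only [OnSide] <;> grind
    · simpa using hau
    · simp only [Finset.mem_filter, Finset.mem_univ, true_and]
      exact fun h => h.ne rfl
  · have : probeRank ident u D next = 2 * Fintype.card V + 3 := by
      unfold probeRank
      rw [if_neg h1, if_neg h2, if_neg h7]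
    have := Finset.card_le_univ (Finset.univ.filter fun v => OnSide (probeSide (ident a) D) a v)
    omega

variable {σ : ℕ → State V I} {e : ℕ → Event V I}

/-- Eventually the probes are well-formed, and belong to staying nodes. -/
theorem Settled.probes (H : Settled ident σ e) :
    ∀ᶠ t in atTop, ∀ a s D next q, Msg.forwardProbe s D next q ∈ (σ t).ch a →
      Stays σ s ∧ ∀ v ∈ next, Within (ident a) (ident v) D := by
  let Bad : ℕ → V → Msg V I → Prop := fun _ a m => ∃ s D next q,
    m = .forwardProbe s D next q ∧
      ¬ (Stays σ s ∧ ∀ v ∈ next, Within (ident a) (ident v) D)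
  let rank : V → Msg V I → ℕ := fun a m => match m with
    | .forwardProbe _ D next _ => probeRank ident a D next
    | _ => 0
  have key := H.flush Bad rank (2 * Fintype.card V + 3)
    (fun a m => by cases m <;> simp [rank, probeRank_le])
    (.of_forall fun t a m _ h => h)
    (.of_forall fun t a m ho hb => by
      obtain ⟨s, D, next, q, rfl, hb⟩ := hb
      generalize he : e t = ev at ho
      cases ho with
      | probe hm =>
        refine absurd ⟨H.stays_iff.1 hm, fun v hv => ?_⟩ hb
        rw [Finset.mem_singleton] at hv
        subst hv
        unfold Within
        grind
      | @reply u _ _ _ _ hr =>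
        cases hr with
        | @hop _ _ next _ _ hD ha =>
          refine ⟨u, _, rfl, ⟨s, D, next, q, rfl, fun h => hb ⟨h.1, ?_⟩⟩, probeRank_hop hD ha⟩
          exact (hop_within hD h.2 ha).1)
  filter_upwards [key] with t ht a s D next q hm
  exact by_contra fun h => ht a _ hm ⟨s, D, next, q, rfl, h⟩

end Probes

/-! ### Edge reversal: staying nodes do not keep leaving ones. -/

section Reversal

variable {V I : Type*} [LinearOrder V] [LinearOrder I] [Fintype V]

theorem Btw.trans {y a b c : V} (h : Btw y a b) (h' : Btw y b c) : Btw y a c := by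
  unfold Btw at *; grind

/-- Minimal elements are those closest to `y`, so induction proceeds from `y` outward. For
`wellFounded_btw_outer` minimal means farthest from `g`, and induction proceeds inward. -/
theorem wellFounded_btw (y : V) : WellFounded fun a b => Btw y a b :=
  have : IsTrans V fun a b => Btw y a b := ⟨fun _ _ _ => Btw.trans⟩
  have : Std.Irrefl fun a b => Btw y a b := ⟨fun _ h => h.ne_right rfl⟩
  Finite.wellFounded_of_trans_of_irrefl _

theorem wellFounded_btw_outer (g : V) : WellFounded fun a b => Btw a b g :=
  have : IsTrans V fun a b => Btw a b g := ⟨fun _ _ _ h h' => by unfold Btw at *; grind⟩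
  have : Std.Irrefl fun a b => Btw a b g := ⟨fun _ h => h.ne_left rfl⟩
  Finite.wellFounded_of_trans_of_irrefl _

variable {ident : V ↪o I} {σ : ℕ → State V I} {e : ℕ → Event V I}

/-- Either `y` eventually stores no staying node on its way to `b`, or it stores one forever. -/
theorem Settled.inner (H : Settled ident σ e) {y : V} (hy : Stays σ y) (b : V) :
    (∀ᶠ t in atTop, ∀ z, Stays σ z → Btw y z b → ¬ (σ t).Mem y z) ∨
    ∃ z, Stays σ z ∧ Btw y z b ∧ ∀ᶠ t in atTop, (σ t).Mem y z := by
  by_cases hZ : ∃ z, Stays σ z ∧ Btw y z b ∧ ∃ᶠ t in atTop, (σ t).Mem y z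
  swap
  · left
    push Not at hZ
    refine eventually_all.2 fun z => ?_
    by_cases h : Stays σ z ∧ Btw y z b
    · filter_upwards [hZ z h.1 h.2] with t ht _ _ using ht
    · exact .of_forall fun t h1 h2 => absurd ⟨h1, h2⟩ h
  right
  -- Among the staying nodes on the way to `b` that are stored infinitely often, the closest one is
  -- eventually never removed.
  obtain ⟨z, ⟨hz, hzb, hf⟩, hmin⟩ := (wellFounded_btw y).has_min
    {z | Stays σ z ∧ Btw y z b ∧ ∃ᶠ t in atTop, (σ t).Mem y z} hZ
  refine ⟨z, hz, hzb, eventually_of_frequently ?_ hf⟩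
  have hno : ∀ᶠ t in atTop, ∀ a, Stays σ a → Btw y a z → ¬ (σ t).Mem y a := by
    refine eventually_all.2 fun a => ?_
    by_cases h : Stays σ a ∧ Btw y a z
    · have : ¬ ∃ᶠ t in atTop, (σ t).Mem y a := fun hf =>
        hmin a ⟨h.1, h.2.trans hzb, hf⟩ h.2
      filter_upwards [not_frequently.1 this] with t ht _ _ using ht
    · exact .of_forall fun t h1 h2 => absurd ⟨h1, h2⟩ h
  -- Only Linearize(`z`) can remove `z`. It answers an Introduce(`z`, `y`) at a staying node, which
  -- `y` would have to store strictly before `z`; by minimality this has stopped.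
  let Bad : ℕ → V → Msg V I → Prop := fun _ a m =>
    (a = y ∧ m = .linearize z) ∨ (Stays σ a ∧ m = .introduce z (some y))
  let rank : V → Msg V I → ℕ := fun _ m => match m with
    | .introduce _ _ => 1
    | _ => 0
  have key := H.flush Bad rank 1 (fun a m => by cases m <;> simp [rank])
    (.of_forall fun t a m _ h => h) (by
      filter_upwards [hno] with t ht a m ho hb
      rcases hb with ⟨rfl, rfl⟩ | ⟨ha, rfl⟩
      · generalize he : e t = ev at ho
        cases ho with
        | @reply u _ _ _ _ hr =>
          cases hr with
          | linearize hm hv =>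
            exact ⟨u, _, rfl, .inr ⟨H.stays_iff.1 hm, rfl⟩, by simp [rank]⟩
      · generalize he : e t = ev at ho
        cases ho with
        | introduce hm hv ha' hb => exact absurd ha' (ht a ha hb)
        | reply _ hr => cases hr)
  filter_upwards [key, H.mem_stays_succ] with t h1 h2 hm
  exact (h2 y z hz hm).resolve_right fun h =>
    h1 y _ (H.step_of h.1).mem_of_receive (.inl ⟨rfl, rfl⟩)

/-- A request makes `y` send an acknowledgement with a value to `g`, and the leaving `g` returns
that value in a RevAndLin. Because `y` stores `g` all the while, the value still belongs to `g` on
arrival. Callers contrast the conclusion with the assumed permanence of the reference. -/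
theorem Settled.reversal (H : Settled ident σ e) {y g : V} {d : Side} (hg : Leaves σ g)
    (hd : OnSide d y g) (hy : Stays σ y ∨ d = .right)
    (hr : ∃ᶠ t in atTop, e t = .receive y (.revAndLinReq d))
    (hm : ∀ᶠ t in atTop, (σ t).Mem y g) : ∃ᶠ t in atTop,
      (Stays σ y → ¬ (σ (t + 1)).Mem y g) ∧
      (Leaves σ y → y < g → (σ t).Nb y g → ¬ (σ (t + 1)).Nb y g) ∧
      (Leaves σ y → y < g → ¬ (σ t).Nb y g → ¬ (σ (t + 1)).Mem y g) := by
  obtain ⟨T, hT⟩ := eventually_atTop.1 hm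
  refine frequently_atTop.2 fun n => ?_
  obtain ⟨t, ht, he⟩ := frequently_atTop.1 hr (max T n)
  have hle : T ≤ t ∧ n ≤ t := by omega
  obtain ⟨k, hk, hs⟩ := H.receive_req he hy (hT t hle.1) hd
  have hval : ∀ j ≥ t + 1, ((σ j).loc y).uniqueValues g = some k := fun j hj =>
    Nat.le_induction hk (fun i hi h => H.value_succ h (hT i (by omega))) j hj
  obtain ⟨t2, ht2, he2⟩ := H.receive_sent hs
  obtain ⟨N, hN, hs2⟩ := H.receive_ack he2 hg hd.ne.symm
  obtain ⟨t3, ht3, he3⟩ := H.receive_sent hs2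
  exact ⟨t3, by omega, H.receive_revAndLin he3 (hT t3 (by omega)) (hval t3 (by omega))
    fun n hn => (hN n hn).2⟩

theorem Settled.frequently_req (H : Settled ident σ e) {y z : V} {d : Side} (hz : Leaves σ z)
    (hd : OnSide d z y) (hm : ∀ᶠ t in atTop, (σ t).Mem z y) :
    ∃ᶠ t in atTop, e t = .receive y (.revAndLinReq d.other) := by
  obtain ⟨T, hT⟩ := eventually_atTop.1 hm
  refine frequently_atTop.2 fun n => ?_
  obtain ⟨t, ht, he⟩ := H.timeout hz.2 (max T n)
  obtain ⟨k, hk, he'⟩ := H.receive_sent (H.timeout_leaves he hz (hT t (by omega)) hd)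
  exact ⟨k, by omega, he'⟩

/-- A staying node does not store a leaving node forever. -/
theorem Settled.not_forever (H : Settled ident σ e) {y g : V} (hy : Stays σ y)
    (hg : Leaves σ g) : ¬ ∀ᶠ t in atTop, (σ t).Mem y g := by
  intro hm
  obtain ⟨T, hT⟩ := eventually_atTop.1 (hm.and H.leaves_mem_stays)
  obtain ⟨d, hd⟩ := exists_onSide (hT T le_rfl).1.2
  -- A leaving `z` on that side would keep `y` forever and request reversals forever, one of which
  -- would delete `g`. The request is for side `d`, as `y` lies on the opposite side of `z`.
  have knows : ∀ z, Leaves σ z → OnSide d y z → ∀ t ≥ T, ¬ (σ t).Mem z y := by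
    intro z hz hdz t ht hzy
    have h1 : ∀ᶠ t in atTop, (σ t).Mem z y := eventually_atTop.2 ⟨t, fun j hj =>
      Nat.le_induction hzy (fun i hi h => (hT i (by omega)).2 z y hz (.inl hy) h) j hj⟩
    have h2 := H.frequently_req hz (onSide_other.2 hdz) h1
    rw [other_other] at h2
    obtain ⟨i, hi, h3⟩ := ((H.reversal hg hd (.inl hy) h2 hm).and_eventually
      (eventually_ge_atTop T)).exists
    exact hi.1 hy (hT (i + 1) (by omega)).1
  have hlv : ∀ t ≥ T, ∀ z, e t = .timeout y → Leaves σ z → Btw y z g →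
      ¬ Sends ident (σ t) (e t) z (.introduce g (some y)) := by
    intro t ht z he hz hb hs
    obtain ⟨k, hk, he'⟩ := H.receive_sent hs
    exact knows z hz (hb.onSide.2 hd) (k + 1) (by omega)
      ((H.receive_introduce he' hb.ne_right.symm).2 hz hb.ne_left.symm)
  have hself : ∀ t ≥ T, ¬ Sends ident (σ t) (e t) g (.introduce y none) := by
    intro t ht hs
    obtain ⟨k, hk, he'⟩ := H.receive_sent hs
    exact knows g hg hd (k + 1) (by omega) (H.receive_introduce_none he' hd.ne.symm hg)
  have hpres : ∀ t z, (σ t).Mem y z → Stays σ z ∨ Leaves σ z := fun t z hz =>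
    stays_or_leaves ((H.present_iff t).1 ((H.clean t).refs y z hz.1))
  -- If no staying node on the way to `g` is stored in the long run, the introduction at Timeout
  -- goes to a leaving node, which then learns of `y`. Otherwise it may reach a staying node, whose
  -- answer Linearize(`g`) does delete `g`, because the permanent `z₀` is closer.
  rcases H.inner hy g with h | ⟨z₀, hz₀, hb₀, h⟩
  · obtain ⟨T', hT'⟩ := eventually_atTop.1 h
    obtain ⟨t, ht, he⟩ := H.timeout (H.stays_present hy) (max T T')
    rcases H.timeout_stays he hy (hT t (by omega)).1 with ⟨-, hs⟩ | ⟨z, hz, hb, hs⟩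
    · exact hself t (by omega) hs
    · rcases hpres t z hz with h' | h'
      · exact hT' t (by omega) z h' hb hz
      · exact hlv t (by omega) z he h' hb hs
  · obtain ⟨T', hT'⟩ := eventually_atTop.1 h
    obtain ⟨t, ht, he⟩ := H.timeout (H.stays_present hy) (max T T')
    rcases H.timeout_stays he hy (hT t (by omega)).1 with ⟨-, hs⟩ | ⟨z, hz, hb, hs⟩
    · exact hself t (by omega) hs
    · rcases hpres t z hz with h' | h'
      · obtain ⟨k, hk, he'⟩ := H.receive_sent hs
        obtain ⟨j, hj, hej⟩ := H.receive_sent ((H.receive_introduce he' hb.ne_right.symm).1 h')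
        exact H.receive_linearize hej hy (hT' j (by omega)) hb₀ (hT (j + 1) (by omega)).1
      · exact hlv t (by omega) z he h' hb hs

end Reversal

/-! ### Every leaving node exits. -/

section Leaving

variable {V I : Type*} [LinearOrder V] [LinearOrder I] [Fintype V]
variable {ident : V ↪o I} {σ : ℕ → State V I} {e : ℕ → Event V I}

/-- `g` is leaving, no leaving node right of `g` ever stores `g`, and the leaving nodes left of `g`
are asked to reverse their right edges again and again. -/
structure Exposed (σ : ℕ → State V I) (e : ℕ → Event V I) (g : V) : Prop where
  leaves : Leaves σ g
  not_mem : ∀ y, Leaves σ y → g < y → ∀ t, ¬ (σ t).Mem y g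
  req : ∀ y, Leaves σ y → y < g → ∃ᶠ t in atTop, e t = .receive y (.revAndLinReq .right)

/-- `g` is the leftmost leaving node that no leaving node on its right ever stores; the rightmost
leaving node qualifies vacuously, so there is one. A leaving `y` left of `g` fails the condition:
some leaving node on its right stores `y`, keeps it forever as a left reference, and sends requests
at every Timeout. -/
theorem Settled.exists_exposed (H : Settled ident σ e) {u : V} (hu : Leaves σ u) :
    ∃ g, Exposed σ e g := by
  let S : Set V := {u | Leaves σ u ∧ ∀ y, Leaves σ y → u < y → ∀ t, ¬ (σ t).Mem y u}
  have hS : S.Nonempty := by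
    obtain ⟨m, hm, hmax⟩ := Set.exists_max_image {u | Leaves σ u} id (Set.toFinite _) ⟨u, hu⟩
    exact ⟨m, hm, fun y hy hlt => absurd (hmax y hy) (not_le_of_gt hlt)⟩
  obtain ⟨g, hg, hmin⟩ := Set.exists_min_image S id (Set.toFinite _) hS
  refine ⟨g, hg.1, hg.2, fun y hy hyg => ?_⟩
  have : y ∉ S := fun h => absurd (hmin y h) (not_le_of_gt hyg)
  simp only [S, Set.mem_ofPred_eq, not_and, not_forall, not_not] at this
  obtain ⟨w, hw, hyw, t, hm⟩ := this hy
  have hm' : ∀ᶠ t in atTop, (σ t).Mem w y := eventually_atTop.2 ⟨t, fun j hj =>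
    Nat.le_induction hm (fun i _ h => H.leaves_mem_left hw hyw h) j hj⟩
  exact H.frequently_req (d := .left) hw hyw hm'

variable {g : V}

/-- An exposed node eventually does not send its own reference. -/
theorem Settled.exposed_flush (H : Settled ident σ e) (hg : Exposed σ e g) :
    ∀ᶠ t in atTop, Msg.revAndLinReq .right ∉ (σ t).ch g ∧
      (∀ a k, Msg.revAndLinAck g k ∉ (σ t).ch a) ∧ ∀ N k, Msg.revAndLin N k ∉ (σ t).ch g := by
  -- A causal chain without a source: requests for the right side could reach `g` only from leaving
  -- nodes on its right that store `g`. Without them `g` sends no acknowledgements, and without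
  -- these nobody answers `g` with RevAndLin.
  let Bad : ℕ → V → Msg V I → Prop := fun _ a m =>
    (a = g ∧ m = .revAndLinReq .right) ∨ (∃ k, m = .revAndLinAck g k) ∨
      (a = g ∧ ∃ N k, m = .revAndLin N k)
  let rank : V → Msg V I → ℕ := fun _ m => match m with
    | .revAndLinReq _ => 2
    | .revAndLinAck _ _ => 1
    | _ => 0
  have hns := hg.leaves.not_stays
  have key := H.flush Bad rank 2 (fun a m => by cases m <;> simp [rank])
    (.of_forall fun t a m _ h => h)
    (.of_forall fun t a m ho hb => by
      rcases hb with ⟨rfl, rfl⟩ | ⟨k, rfl⟩ | ⟨rfl, N, k, rfl⟩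
      · generalize he : e t = ev at ho
        generalize hmm : Msg.revAndLinReq Side.right = mm at ho
        cases ho with
        | @req u _ d hm ha hd =>
          cases d
          · exact absurd ha (hg.not_mem _ (H.leaves_of_timeout he hm) hd t)
          · simp [Side.other] at hmm
        | reply _ hr => subst hmm; cases hr
        | _ => simp at hmm
      · generalize he : e t = ev at ho
        cases ho with
        | reply _ hr =>
          cases hr with
          | @ack dir _ _ hd ha hs hk hc =>
            rcases hd with hd | rfl
            · exact absurd (H.stays_iff.1 hd) hns
            · exact ⟨_, _, rfl, .inl ⟨rfl, rfl⟩, by simp [rank]⟩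
      · generalize he : e t = ev at ho
        cases ho with
        | reply _ hr =>
          cases hr with
          | revAndLin hm ha hN => exact ⟨_, _, rfl, .inr (.inl ⟨_, rfl⟩), by simp [rank]⟩)
  filter_upwards [key] with t ht
  exact ⟨fun h => ht g _ h (.inl ⟨rfl, rfl⟩), fun a k h => ht a _ h (.inr (.inl ⟨k, rfl⟩)),
    fun N k h => ht g _ h (.inr (.inr ⟨rfl, N, k, rfl⟩))⟩

/-- A list containing `g` that is sent to `y` comes from a leaving `u` between `y` and `g` with `g`
in `Left` or `Right`. If `u` is right of `g` this contradicts exposure, so a hypothesis on the left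
side is enough. -/
theorem Settled.no_list (H : Settled ident σ e) (hg : Exposed σ e g) {y : V}
    (h : ∀ u, Leaves σ u → u < g → Btw y u g → ∀ᶠ t in atTop, ¬ (σ t).Nb u g) :
    ∀ᶠ t in atTop, ∀ N k, g ∈ N → Msg.revAndLin N k ∉ (σ t).ch y := by
  have h' : ∀ᶠ t in atTop, ∀ u, Leaves σ u → Btw y u g → ¬ (σ t).Nb u g := by
    refine eventually_all.2 fun u => ?_
    by_cases hu : Leaves σ u ∧ Btw y u g
    · rcases lt_trichotomy u g with hlt | rfl | hlt
      · filter_upwards [h u hu.1 hlt hu.2] with t ht _ _ using ht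
      · exact absurd rfl hu.2.ne_right
      · exact .of_forall fun t _ _ hn => hg.not_mem u hu.1 hlt t hn.mem
    · exact .of_forall fun t h1 h2 => absurd ⟨h1, h2⟩ hu
  have key := H.flush (fun _ a m => a = y ∧ ∃ N k, g ∈ N ∧ m = .revAndLin N k) (fun _ _ => 0) 0
    (fun _ _ => le_rfl) (.of_forall fun t a m _ h => h) (by
      filter_upwards [h'] with t ht a m ho hb
      obtain ⟨rfl, N, k, hN, rfl⟩ := hb
      generalize he : e t = ev at ho
      cases ho with
      | reply _ hr =>
        cases hr with
        | revAndLin hm ha hN' =>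
          obtain ⟨h1, h2⟩ := (hN' g).1 hN
          exact absurd h1 (ht _ (H.leaves_of_receive he hm) h2))
  filter_upwards [key] with t ht N k hN hm
  exact ht y _ hm ⟨rfl, N, k, hN, rfl⟩

/-- Induction from `g` outward. A leaving `y` can gain `g` in `Right` only from a list of a leaving
node closer to `g`, and by induction such lists stop. The recurring requests then reverse the edge,
after which it is not regained. -/
theorem Settled.not_nb (H : Settled ident σ e) (hg : Exposed σ e g) (y : V) :
    Leaves σ y → y < g → ∀ᶠ t in atTop, ¬ (σ t).Nb y g := by
  induction y using (wellFounded_btw g).induction with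
  | _ y ih =>
  intro hy hyg
  have h1 := H.no_list hg (y := y) fun u hu hug hb => ih u hb.symm hu hug
  by_contra hc
  have hf : ∃ᶠ t in atTop, (σ t).Nb y g := by
    simpa only [Filter.Frequently] using hc
  have hstab : ∀ᶠ t in atTop, ¬ (σ t).Nb y g → ¬ (σ (t + 1)).Nb y g := by
    filter_upwards [h1] with t ht hn hn'
    obtain ⟨N, k, he, hN⟩ := H.gain_nb hy hn' hn
    exact ht N k hN (H.step_of he).mem_of_receive
  have hall : ∀ᶠ t in atTop, (σ t).Nb y g := by
    by_contra hc'
    exact hc (eventually_of_frequently hstab (not_eventually.1 hc'))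
  obtain ⟨T, hT⟩ := eventually_atTop.1 hall
  obtain ⟨t, ht, ht'⟩ := ((H.reversal (d := .right) hg.leaves hyg (.inr rfl) (hg.req y hy hyg)
    (hall.mono fun t ht => ht.mem)).and_eventually (eventually_ge_atTop T)).exists
  exact ht.2.1 hy hyg (hT t ht') (hT (t + 1) (by omega))

theorem Settled.leaves_not_nb (H : Settled ident σ e) (hg : Exposed σ e g) :
    ∀ᶠ t in atTop, ∀ u, Leaves σ u → u ≠ g → ¬ (σ t).Nb u g := by
  refine eventually_all.2 fun u => ?_
  by_cases hu : Leaves σ u ∧ u ≠ g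
  · rcases lt_or_gt_of_ne hu.2 with hlt | hlt
    · filter_upwards [H.not_nb hg u hu.1 hlt] with t ht _ _ using ht
    · exact .of_forall fun t _ _ hn => hg.not_mem u hu.1 hlt t hn.mem
  · exact .of_forall fun t h1 h2 => absurd ⟨h1, h2⟩ hu

/-- `y` has no reference to `g` in its memory or its channel. -/
def State.Quiet (s : State V I) (g y : V) : Prop := ¬ s.Mem y g ∧ ∀ m ∈ s.ch y, g ∉ m.refs

/-- If the nodes beyond `y` are quiet and `y` does not introduce `g` to staying nodes, then the
channel of `y` loses the references to `g`. -/
theorem Settled.tokens (H : Settled ident σ e) (hg : Exposed σ e g) {y : V} (hy : y ≠ g)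
    (hout : ∀ᶠ t in atTop, ∀ a, Btw a y g → (σ t).Quiet g a)
    (hsend : ∀ᶠ t in atTop, Stays σ y → ∀ z, Stays σ z → Btw y z g → (σ t).Mem y z →
      ¬ (σ t).Mem y g) :
    ∀ᶠ t in atTop, ∀ m ∈ (σ t).ch y, g ∉ m.refs := by
  -- Introduce(`g`, `y`) at staying nodes counts as bad too, since it is answered by Linearize(`g`)
  -- to `y`. Other references to `g` in the channel of `y` stem from messages that `y` processes and
  -- turns into TempDelegate, or from nodes farther out, which are quiet.
  let Bad : ℕ → V → Msg V I → Prop := fun _ a m =>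
    (a = y ∧ g ∈ m.refs) ∨ (Stays σ a ∧ m = .introduce g (some y))
  let rank : V → Msg V I → ℕ := fun _ m => match m with
    | .introduce _ _ => 2
    | .tempDelegate _ => 0
    | _ => 1
  have hns := hg.leaves.not_stays
  have key := H.flush Bad rank 2 (fun a m => by cases m <;> simp [rank])
    (.of_forall fun t a m _ h => h) (by
      filter_upwards [hout, hsend, H.exposed_flush hg, H.leaves_not_nb hg,
        H.probes] with t h1 h2 h3 h4 h5 a m ho hb
      generalize he : e t = ev at ho
      rcases hb with ⟨rfl, hb⟩ | ⟨ha, rfl⟩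
      · cases ho with
        | @probe _ D q hm =>
          simp only [Msg.refs, Finset.mem_union, Finset.mem_singleton, or_self] at hb
          exact absurd hb.symm hy
        | @introduce u v _ hm hv ha hb' =>
          simp only [Msg.refs, Finset.mem_union, Finset.mem_singleton, Option.toFinset_some] at hb
          rcases hb with rfl | rfl
          · exact absurd hv (h1 u hb').1
          · exact absurd (H.stays_iff.1 hm) hns
        | introduceSelf hm ha hb' =>
          simp only [Msg.refs, Finset.mem_union, Finset.mem_singleton, Option.toFinset_none,
            Finset.notMem_empty, or_false] at hb
          subst hb
          exact absurd (H.stays_iff.1 hm) hns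
        | req hm ha hd => simp [Msg.refs] at hb
        | @reply u m₀ _ _ hm₀ hr =>
          have hu1 : Btw u a g → (σ t).Mem u g → False := fun h h' => (h1 u h).1 h'
          have hu2 : Btw u a g → g ∉ m₀.refs := fun h => (h1 u h).2 m₀ hm₀
          cases hr with
          | self hn hm hs =>
            simp only [Msg.refs, Finset.mem_singleton] at hb
            subst hb
            refine ⟨_, _, rfl, .inl ⟨rfl, hn⟩, ?_⟩
            cases m₀ <;> simp [rank] at hm ⊢
          | delegate ha hv hu =>
            simp only [Msg.refs, Finset.mem_singleton] at hb hu2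
            subst hb
            rcases hv with hv | hv
            · exact absurd hv hy
            · exact absurd rfl (hu2 hv)
          | inward hm ha hb' =>
            simp only [Msg.refs, Finset.mem_singleton] at hb hu2
            subst hb
            exact absurd rfl (hu2 hb')
          | linearize hm hv =>
            simp only [Msg.refs, Finset.mem_singleton] at hb
            subst hb
            exact ⟨_, _, rfl, .inr ⟨H.stays_iff.1 hm, rfl⟩, by simp [rank]⟩
          | ack hd ha hs hk hc =>
            simp only [Msg.refs, Finset.mem_singleton] at hb
            subst hb
            rcases hd with hd | rfl
            · exact absurd (H.stays_iff.1 hd) hns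
            · exact absurd hm₀ h3.1
          | revAndLin hm ha hN =>
            obtain ⟨h6, h7⟩ := (hN g).1 hb
            exact absurd h6 (h4 u (H.leaves_of_receive he hm) h7.ne_right)
          | introduce ha hk hm =>
            simp only [Msg.refs, Finset.mem_union, Finset.mem_singleton, Option.toFinset_none,
              Finset.notMem_empty, or_false] at hb
            subst hb
            exact absurd hm₀ (h3.2.2 _ _)
          | success hm =>
            simp only [Msg.refs, Finset.mem_singleton] at hb
            subst hb
            exact absurd (H.stays_iff.1 hm) hns
          | fail => simp [Msg.refs] at hb
          | @hop s D next q _ hD ha =>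
            obtain ⟨hs, hw⟩ := h5 _ _ _ _ _ hm₀
            simp only [Msg.refs, Finset.mem_union, Finset.mem_singleton] at hb hu2
            rcases hb with rfl | hb
            · exact absurd hs hns
            rcases (hop_within hD hw ha).2.2 g hb with h | h
            · exact absurd h.symm hy
            · rcases mem_nextSet.1 hb with h' | h'
              · exact absurd (.inr h'.1) (hu2 h)
              · exact absurd h'.1.mem (hu1 h)
          | search hm =>
            simp only [Msg.refs, Finset.mem_singleton] at hb
            subst hb
            exact absurd (H.stays_iff.1 hm) hns
      · cases ho with
        | introduce hm hv ha' hb => exact absurd hv (h2 (H.stays_iff.1 hm) a ha hb ha')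
        | reply _ hr => cases hr)
  filter_upwards [key] with t ht m hm hgm
  exact ht y m hm (.inl ⟨rfl, hgm⟩)

/-- Eventually no node but `g` itself has a reference to an exposed node `g`. -/
theorem Settled.quiet (H : Settled ident σ e) (hg : Exposed σ e g) (y : V) :
    y ≠ g → ∀ᶠ t in atTop, (σ t).Quiet g y := by
  induction y using (wellFounded_btw_outer g).induction with
  | _ y ih =>
  intro hy
  -- The induction hypothesis concerns the nodes farther from `g` than `y` on the same side.
  -- References to `g` are delegated towards `g`, so these are the ones that could feed `y`.
  have hout : ∀ᶠ t in atTop, ∀ a, Btw a y g → (σ t).Quiet g a := by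
    refine eventually_all.2 fun a => ?_
    by_cases ha : Btw a y g
    · filter_upwards [ih a ha ha.ne.symm] with t ht _ using ht
    · exact .of_forall fun t h => absurd h ha
  suffices h : (∀ᶠ t in atTop, ∀ m ∈ (σ t).ch y, g ∉ m.refs) ∧
      ∀ᶠ t in atTop, ¬ (σ t).Mem y g by
    filter_upwards [h.1, h.2] with t h1 h2 using ⟨h2, h1⟩
  have drop : (∀ᶠ t in atTop, ¬ (σ t).Mem y g → ¬ (σ (t + 1)).Mem y g) →
      (¬ ∀ᶠ t in atTop, (σ t).Mem y g) → ∀ᶠ t in atTop, ¬ (σ t).Mem y g :=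
    fun h1 h2 => eventually_of_frequently h1 (not_eventually.1 h2)
  have keep : (∀ᶠ t in atTop, ∀ m ∈ (σ t).ch y, g ∉ m.refs) →
      ∀ᶠ t in atTop, ¬ (σ t).Mem y g → ¬ (σ (t + 1)).Mem y g := fun h => by
    filter_upwards [h] with t ht h1 h2
    obtain ⟨m, -, hm, hgm, -⟩ := H.gain h2 h1
    exact ht m hm hgm
  by_cases hp : (σ 0).Present y
  swap
  · have hp' : ∀ t, ¬ (σ t).Present y := fun t => by rwa [H.present_iff t]
    refine ⟨.of_forall fun t m hm => ?_, .of_forall fun t hm => ?_⟩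
    · simp [((H.clean t).gone y (hp' t)).2] at hm
    · have := hm.1
      simp [(H.clean t).empty y (hp' t)] at this
  rcases stays_or_leaves hp with hs | hl
  · have hnf := H.not_forever hs hg.leaves
    -- In the first case `y` eventually has no staying node to which it could introduce `g`, so its
    -- channel is cleared first and its memory afterwards. In the second case the permanent `z`
    -- blocks saving by comparison, so the memory loses `g` first and the channel follows.
    rcases H.inner hs g with h | ⟨z, hz, hb, h⟩
    · have ht := H.tokens hg hy hout (by
        filter_upwards [h] with t ht _ z hz hb hm using absurd hm (ht z hz hb))
      exact ⟨ht, drop (keep ht) hnf⟩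
    · have hintro : ∀ᶠ t in atTop, ∀ w, Msg.introduce g (some w) ∉ (σ t).ch y := by
        have key := H.flush (fun _ a m => a = y ∧ ∃ w, m = .introduce g (some w)) (fun _ _ => 0) 0
          (fun _ _ => le_rfl) (.of_forall fun t a m _ h => h) (by
            filter_upwards [hout] with t ht a m ho hb
            obtain ⟨rfl, w, rfl⟩ := hb
            generalize he : e t = ev at ho
            cases ho with
            | introduce hm hv ha hb => exact absurd hv (ht _ hb).1
            | reply _ hr => cases hr)
        filter_upwards [key] with t ht w hm using ht y _ hm ⟨rfl, w, rfl⟩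
      have hlist := H.no_list hg (y := y) fun u hu hug _ => H.not_nb hg u hu hug
      have hmem : ∀ᶠ t in atTop, ¬ (σ t).Mem y g := by
        refine drop ?_ hnf
        filter_upwards [hintro, hlist, h] with t h1 h2 h3 h4 h5
        obtain ⟨m, -, hm, -, h6⟩ := H.gain h5 h4
        rcases h6 hs with ⟨w, rfl⟩ | ⟨N, k, rfl, hN⟩ | h6
        · exact h1 w hm
        · exact h2 N k hN hm
        · exact (h6 z h3).2 hb
      exact ⟨H.tokens hg hy hout (by filter_upwards [hmem] with t ht _ _ _ _ _ using ht),
        hmem⟩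
  · have ht := H.tokens hg hy hout (.of_forall fun t h => absurd h hl.not_stays)
    refine ⟨ht, drop (keep ht) fun hall => ?_⟩
    -- For a leaving `y` left of `g`, `Right` is eventually free of `g` by `not_nb`, so a reversal
    -- acts on `TempRight` and removes the last copy.
    rcases lt_or_gt_of_ne hy with hlt | hlt
    · obtain ⟨T, hT⟩ := eventually_atTop.1 (hall.and (H.not_nb hg y hl hlt))
      obtain ⟨t, h1, h2⟩ := ((H.reversal (d := .right) hg.leaves hlt (.inr rfl)
        (hg.req y hl hlt) hall).and_eventually (eventually_ge_atTop T)).exists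
      exact h1.2.2 hl hlt (hT t h2).2 (hT (t + 1) (by omega)).1
    · obtain ⟨T, hT⟩ := eventually_atTop.1 hall
      exact hg.not_mem y hl hlt T (hT T le_rfl)

/-- In a settled computation all present nodes are staying. -/
theorem Settled.no_leaves (H : Settled ident σ e) (u : V) : ¬ Leaves σ u := by
  intro hu
  obtain ⟨g, hg⟩ := H.exists_exposed hu
  have hns := hg.leaves.not_stays
  have hq : ∀ᶠ t in atTop, ∀ y, y ≠ g → (σ t).Quiet g y := by
    refine eventually_all.2 fun y => ?_
    by_cases hy : y = g
    · exact .of_forall fun t h => absurd hy h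
    · filter_upwards [H.quiet hg y hy] with t ht _ using ht
  -- Once all other nodes are quiet and `g` stores nobody's way back to it, `g` receives only
  -- TempDelegate messages that it sends to itself. Each results from another kind of message, so
  -- one drop of rank suffices.
  let rank : V → Msg V I → ℕ := fun _ m => match m with
    | .tempDelegate _ => 0
    | _ => 1
  have key := H.flush (fun _ a _ => a = g) rank 1 (fun a m => by cases m <;> simp [rank])
    (.of_forall fun t a m _ h => h) (by
      filter_upwards [hq, H.probes] with t h1 h2 a m ho hb
      subst hb
      have hq1 : ∀ y, ¬ (σ t).Mem y a := fun y hm => (h1 y hm.2.symm).1 hm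
      generalize he : e t = ev at ho
      cases ho with
      | probe hm => exact absurd (H.stays_iff.1 hm) hns
      | introduce hm hv ha hb => exact absurd ha (hq1 _)
      | introduceSelf hm ha hb => exact absurd ha (hq1 _)
      | req hm ha hd => exact absurd ha (hq1 _)
      | @reply u m₀ _ _ hm₀ hr =>
        have hq2 : u ≠ a → a ∉ m₀.refs := fun hu => (h1 u hu).2 m₀ hm₀
        have hsu : (σ t |>.loc u).mode = .staying → u ≠ a := by
          rintro hm rfl
          exact hns (H.stays_iff.1 hm)
        cases hr with
        | self hn hm hs =>
          refine ⟨_, _, rfl, rfl, ?_⟩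
          cases m₀ <;> simp [rank] at hm ⊢
        | delegate ha hv hu => exact absurd ha.mem (hq1 _)
        | inward hm ha hb => exact absurd ha (hq1 _)
        | linearize hm hv => exact absurd (by simp [Msg.refs]) (hq2 (hsu hm))
        | ack hd ha hs hk hc => exact absurd ha (hq1 _)
        | revAndLin hm ha hN => exact absurd (by simp [Msg.refs]) (hq2 ha.symm)
        | introduce ha hk hm => exact absurd ha (hq1 _)
        | success hm => exact absurd (by simp [Msg.refs]) (hq2 (hsu hm))
        | fail => exact absurd (h2 _ _ _ _ _ hm₀).1 hns
        | hop hD ha =>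
          have h3 := (nearest_eq_some.1 ha).1
          rcases mem_nextSet.1 h3 with h4 | h4
          · exact absurd (by simp [Msg.refs, h4.1]) (hq2 h4.2.symm)
          · exact absurd h4.1.mem (hq1 _)
        | search hm => exact absurd (by simp [Msg.refs]) (hq2 (hsu hm)))
  obtain ⟨T, hT⟩ := eventually_atTop.1 (key.and hq)
  obtain ⟨t, ht, he⟩ := H.timeout hg.leaves.2 T
  refine H.not_nidec he hg.leaves ⟨?_, fun v hv => ⟨fun h => ?_, ?_⟩⟩
  · exact Multiset.eq_zero_of_forall_notMem fun m hm => (hT t ht).1 g m hm rfl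
  · exact ((hT t ht).2 v hv).1 ⟨h, hv.symm⟩
  · exact ((hT t ht).2 v hv).2

end Leaving

/-! ### Linearization of the staying nodes. -/

section Staying

variable {V I : Type*} [LinearOrder V] [LinearOrder I] [Fintype V]
variable {ident : V ↪o I} {σ : ℕ → State V I} {e : ℕ → Event V I}

theorem Settled.present_iff_stays (H : Settled ident σ e) {t : ℕ} {u : V} :
    (σ t).Present u ↔ Stays σ u := by
  rw [H.present_iff t]
  exact ⟨fun h => (stays_or_leaves h).resolve_right (H.no_leaves u), H.stays_present⟩

theorem Settled.stays_left (H : Settled ident σ e) {t : ℕ} {u v : V} (h : (σ t).Mem u v) :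
    Stays σ u := by
  rw [← H.present_iff_stays (t := t)]
  by_contra hc
  have := h.1
  simp [(H.clean t).empty u hc] at this

theorem Settled.stays_right (H : Settled ident σ e) {t : ℕ} {u v : V} (h : (σ t).Mem u v) :
    Stays σ v :=
  H.present_iff_stays.1 ((H.clean t).refs u v h.1)

theorem Settled.no_revAndLin (H : Settled ident σ e) :
    ∀ᶠ t in atTop, ∀ a N k, Msg.revAndLin N k ∉ (σ t).ch a := by
  have key := H.flush (fun _ _ m => ∃ N k, m = .revAndLin N k) (fun _ _ => 0) 0
    (fun _ _ => le_rfl) (.of_forall fun t a m _ h => h) (.of_forall fun t a m ho hb => by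
      obtain ⟨N, k, rfl⟩ := hb
      generalize he : e t = ev at ho
      cases ho with
      | reply _ hr =>
        cases hr with
        | revAndLin hm ha hN => exact absurd (H.leaves_of_receive he hm) (H.no_leaves _))
  filter_upwards [key] with t ht a N k hm using ht a _ hm ⟨N, k, rfl⟩

theorem Settled.link_succ (H : Settled ident σ e) {t : ℕ} {a b : V}
    (h : Relation.EqvGen (σ t).Link a b) : Relation.EqvGen (σ (t + 1)).Link a b := by
  refine eqvGen_of_forall (fun a b hab => ?_) h
  rcases (H.step t).link (H.gone_succ t) hab with h1 | h1 | ⟨y, -, h1, h2⟩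
  · exact .rel _ _ h1
  · exact .symm _ _ (.rel _ _ h1)
  · exact .trans _ _ _ (.rel _ _ h1) (.rel _ _ h2)

/-- Eventually the edges that do not come from probes connect the present nodes. -/
theorem Settled.link_connected (H : Settled ident σ e) (hc : ∀ t, (σ t).Connected ident) :
    ∀ᶠ t in atTop, ∀ u v, (σ t).Present u → (σ t).Present v →
      Relation.EqvGen (σ t).Link u v := by
  -- A probe is bad if some reference in it is not connected to its holder by links. A fresh probe
  -- mentions only its holder, and a forwarded one inherits badness from its predecessor, so bad
  -- probes are flushed by rank.
  let Bad : ℕ → V → Msg V I → Prop := fun t a m => ∃ s D next q, m = .forwardProbe s D next q ∧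
    ¬ ∀ b, b = s ∨ b ∈ next → Relation.EqvGen (σ t).Link a b
  let rank : V → Msg V I → ℕ := fun a m => match m with
    | .forwardProbe _ D next _ => probeRank ident a D next
    | _ => 0
  have key := H.flush Bad rank (2 * Fintype.card V + 3)
    (fun a m => by cases m <;> simp [rank, probeRank_le])
    (.of_forall fun t a m _ h => by
      obtain ⟨s, D, next, q, rfl, h⟩ := h
      exact ⟨s, D, next, q, rfl, fun h' => h fun b hb => H.link_succ (h' b hb)⟩)
    (.of_forall fun t a m ho hb => by
      obtain ⟨s, D, next, q, rfl, hb⟩ := hb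
      generalize he : e t = ev at ho
      cases ho with
      | probe hm =>
        refine absurd (fun b hb => ?_) hb
        rw [Finset.mem_singleton, or_self] at hb
        rw [hb]
        exact .refl _
      | @reply u _ _ _ _ hr =>
        cases hr with
        | @hop _ _ next _ _ hD ha =>
          refine ⟨u, _, rfl, ⟨s, D, next, q, rfl, fun h => hb ?_⟩, probeRank_hop hD ha⟩
          have hu : ∀ b, b = s ∨ b ∈ nextSet ident u D next ((σ t).loc u) →
              Relation.EqvGen (σ t).Link u b := by
            rintro b (hb | hb)
            · exact h b (.inl hb)
            · rcases mem_nextSet.1 hb with hb | hb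
              · exact h b (.inr hb.1)
              · exact .rel _ _ (.inl hb.1.mem)
          exact fun b hb => H.link_succ
            (.trans _ _ _ (.symm _ _ (hu a (.inr (nearest_eq_some.1 ha).1))) (hu b hb)))
  filter_upwards [key] with t ht u v hu hv
  refine eqvGen_of_forall (fun a b hab => ?_) (hc t u v hu hv)
  by_cases hne : b = a
  · rw [hne]; exact .refl _
  rcases hab.cases hne with h | ⟨s, D, next, q, hm, -, hb⟩
  · exact .rel _ _ h
  · by_contra hn
    exact ht a _ hm ⟨s, D, next, q, rfl, fun h => hn (h b hb)⟩

/-- `a` and `b` store each other forever. -/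
def Permanent (σ : ℕ → State V I) (a b : V) : Prop :=
  (∀ᶠ t in atTop, (σ t).Mem a b) ∧ ∀ᶠ t in atTop, (σ t).Mem b a

theorem Permanent.symm {a b : V} (h : Permanent σ a b) : Permanent σ b a := ⟨h.2, h.1⟩

/-- There is an edge between `a` and `b`. -/
def State.Adj (s : State V I) (a b : V) : Prop := s.Link a b ∨ s.Link b a

theorem State.Adj.symm {s : State V I} {a b : V} (h : s.Adj a b) : s.Adj b a := Or.symm h

section Unsplit

variable {a b : V} {T : ℕ}

/-- From time `T` on, no edge between `a` and `b` is split. -/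
def Unsplit (σ : ℕ → State V I) (T : ℕ) (a b : V) : Prop :=
  ∀ y, Btw a y b → ∀ t ≥ T, ∀ t' ≥ T, (σ t).Adj a y → ¬ (σ t').Adj y b

theorem Unsplit.symm (h : Unsplit σ T a b) : Unsplit σ T b a :=
  fun y hy t ht t' ht' h1 h2 => h y hy.symm t' ht' t ht h2.symm h1.symm

/-- When processed, a reference in transit is stored, split off to a node in between, or delegated
to the node itself. With splits excluded, that self-delegation must end in memory, because
processing TempDelegate does not create another one at the same node. -/
theorem Settled.exists_mem (H : Settled ident σ e)
    (hr : ∀ t ≥ T, ∀ a N k, Msg.revAndLin N k ∉ (σ t).ch a) (hu : Unsplit σ T a b) {t : ℕ}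
    (ht : T ≤ t) (h : (σ t).Link a b) : ∃ t' ≥ t, (σ t').Mem a b := by
  have hba := h.ne
  rcases h with h | ⟨-, m, hm, hb⟩
  · exact ⟨t, le_rfl, h⟩
  have key : ∀ j ≥ t, ∀ m, b ∈ m.linkRefs a → e j = .receive a m → (σ (j + 1)).Mem a b ∨
      m ≠ .tempDelegate b ∧ Sends ident (σ j) (e j) a (.tempDelegate b) := by
    intro j hj m hb he
    have hst := H.step_of he
    rw [he]
    rcases hst.received hba hb with h1 | h1 | ⟨y, h1, h2, h3⟩ | ⟨N, k, rfl, -⟩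
    · exact .inl h1
    · exact .inr h1
    · exact absurd (.inl (hst.link_of_tempDelegate h1.ne_right.symm h3))
        (hu y h1 (j + 1) (by omega) (j + 1) (by omega) (.inl (.inl h2)))
    · exact absurd hst.mem_of_receive (hr j (by omega) a N k)
  obtain ⟨j, hj, he⟩ := H.receive hm
  rcases key j hj m hb he with h1 | ⟨-, h1⟩
  · exact ⟨j + 1, by omega, h1⟩
  obtain ⟨i, hi, he'⟩ := H.receive_sent h1
  rcases key i (by omega) _ (by simp [Msg.linkRefs, Msg.refs]) he' with h2 | ⟨h2, -⟩
  · exact ⟨i + 1, by omega, h2⟩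
  · exact absurd rfl h2

/-- The remaining way to lose `b` is Linearize, which would pass `b` to a stored node between `a`
and `b`: a split. -/
theorem Settled.mem_forever (H : Settled ident σ e)
    (hr : ∀ t ≥ T, ∀ a N k, Msg.revAndLin N k ∉ (σ t).ch a) (hu : Unsplit σ T a b) {t : ℕ}
    (ht : T ≤ t) (h : (σ t).Mem a b) : ∀ j ≥ t, (σ j).Mem a b := by
  intro j hj
  refine Nat.le_induction h (fun i hi hm => ?_) j hj
  rcases (H.step i).mem_or_sends (H.gone_succ i) hm with h1 | ⟨he, h1, z, hz, hb⟩ |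
    ⟨N, k, he, -⟩
  · exact h1
  · obtain ⟨y, h2, h3, h4⟩ := send_linearize_inward (I := I) h1 hz hb
    have h5 : Sends ident (σ i) (e i) y (.tempDelegate b) := by
      rw [he]; exact sends_receive.2 h4
    exact absurd (.inl ((H.step i).link_of_tempDelegate h3.ne_right.symm h5))
      (hu y h3 i (by omega) (i + 1) (by omega) (.inl (.inl h2)))
  · exact absurd (H.step_of he).mem_of_receive (hr i (by omega) a N k)

/-- At Timeout `a` introduces itself to `b`. If `b` were not the closest on its side, it would be
introduced to a stored node in between, which again is a split. -/
theorem Settled.exists_mem_symm (H : Settled ident σ e)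
    (hr : ∀ t ≥ T, ∀ a N k, Msg.revAndLin N k ∉ (σ t).ch a) (hu : Unsplit σ T a b) {t : ℕ}
    (ht : T ≤ t) (h : ∀ j ≥ t, (σ j).Mem a b) : ∃ t' ≥ t, (σ t').Mem b a := by
  have hs := H.stays_left (h t le_rfl)
  obtain ⟨j, hj, he⟩ := H.timeout (H.stays_present hs) t
  rcases H.timeout_stays he hs (h j hj) with ⟨-, h1⟩ | ⟨z, hz, hb, h1⟩
  · have hne := (h j hj).2
    obtain ⟨t', h2, h3⟩ := H.exists_mem hr hu.symm (t := j + 1) (by omega)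
      (.inr ⟨hne.symm, _, (H.step j).mem_ch_of_sends h1, by simp [Msg.linkRefs, hne.symm]⟩)
    exact ⟨t', by omega, h3⟩
  · have hne := hb.ne_right.symm
    exact absurd (.inl (.inr ⟨hne, _, (H.step j).mem_ch_of_sends h1, by simp [Msg.linkRefs, hne]⟩))
      (hu z hb j (by omega) (j + 1) (by omega) (.inl (.inl hz)))

theorem Settled.permanent_of_unsplit (H : Settled ident σ e)
    (hr : ∀ t ≥ T, ∀ a N k, Msg.revAndLin N k ∉ (σ t).ch a) (hu : Unsplit σ T a b) {t : ℕ}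
    (ht : T ≤ t) (h : (σ t).Link a b) : Permanent σ a b := by
  obtain ⟨i, hi, h1⟩ := H.exists_mem hr hu ht h
  have h2 := H.mem_forever hr hu (by omega) h1
  obtain ⟨j, hj, h3⟩ := H.exists_mem_symm hr hu (by omega) h2
  exact ⟨eventually_atTop.2 ⟨i, h2⟩,
    eventually_atTop.2 ⟨j, H.mem_forever hr hu.symm (by omega) h3⟩⟩

end Unsplit

/-- Every cut of the present nodes is crossed by a permanent edge. -/
theorem Settled.exists_permanent (H : Settled ident σ e) (hc : ∀ t, (σ t).Connected ident)
    {X : Set V} {u v : V} (hu : Stays σ u) (hv : Stays σ v) (huX : u ∈ X) (hvX : v ∉ X) :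
    ∃ a b, a ∈ X ∧ b ∉ X ∧ Permanent σ a b := by
  classical
  obtain ⟨T, hT⟩ := eventually_atTop.1 ((H.link_connected hc).and H.no_revAndLin)
  -- The minimum is taken over all late times at once, because the two halves that `Unsplit` forbids
  -- may occur at different times.
  let S : Set (ℕ × V × V) := {p | T ≤ p.1 ∧ (σ p.1).Adj p.2.1 p.2.2 ∧ p.2.1 ∈ X ∧ p.2.2 ∉ X}
  let span : V → V → ℕ := fun a b => (Finset.univ.filter fun y => Btw a y b).card
  have hS : S.Nonempty := by
    by_contra hne
    have key : ∀ x y, (σ T).Link x y → (x ∈ X ↔ y ∈ X) := by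
      intro x y hxy
      by_contra hcr
      by_cases hx : x ∈ X
      · exact hne ⟨(T, x, y), le_rfl, .inl hxy, hx, fun hy => hcr (iff_of_true hx hy)⟩
      · exact hne ⟨(T, y, x), le_rfl, .inr hxy,
          by_contra fun hy => hcr (iff_of_false hx hy), hx⟩
    have : ∀ x y, Relation.EqvGen (σ T).Link x y → (x ∈ X ↔ y ∈ X) := by
      intro x y hxy
      induction hxy with
      | rel _ _ h => exact key _ _ h
      | refl => rfl
      | symm _ _ _ ih => exact ih.symm
      | trans _ _ _ _ _ h1 h2 => exact h1.trans h2
    exact hvX ((this u v ((hT T le_rfl).1 u v (H.present_iff_stays.2 hu)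
      (H.present_iff_stays.2 hv))).1 huX)
  obtain ⟨⟨t, a, b⟩, ⟨h1, h2, h3, h4⟩, hmin⟩ :=
    (measure fun p : ℕ × V × V => span p.2.1 p.2.2).wf.has_min S hS
  -- Whichever side of the cut `y` is on, one of the two halves crosses the cut with a smaller span.
  have hun : Unsplit σ T a b := by
    intro y hy i hi j hj h5 h6
    by_cases hyX : y ∈ X
    · refine hmin (j, y, b) ⟨hj, h6, hyX, h4⟩ (Finset.card_lt_card ?_)
      refine Finset.ssubset_iff_of_subset (fun w hw => ?_) |>.2 ⟨y, by simpa using hy, ?_⟩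
      · simp only [Finset.mem_filter, Finset.mem_univ, true_and] at hw ⊢
        unfold Btw at *; grind
      · rw [Finset.mem_filter]; exact fun h => h.2.ne_left rfl
    · refine hmin (i, a, y) ⟨hi, h5, h3, hyX⟩ (Finset.card_lt_card ?_)
      refine Finset.ssubset_iff_of_subset (fun w hw => ?_) |>.2 ⟨y, by simpa using hy, ?_⟩
      · simp only [Finset.mem_filter, Finset.mem_univ, true_and] at hw ⊢
        unfold Btw at *; grind
      · rw [Finset.mem_filter]; exact fun h => h.2.ne_right rfl
  refine ⟨a, b, h3, h4, ?_⟩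
  rcases h2 with h2 | h2
  · exact H.permanent_of_unsplit (fun t ht => (hT t ht).2) hun h1 h2
  · exact (H.permanent_of_unsplit (fun t ht => (hT t ht).2) hun.symm h1 h2).symm

/-- With `c` closer, each Timeout introduces `b` to some stored `z` in between; it is staying and
answers Linearize(`b`), which deletes `b` as `c` is still stored. -/
theorem Settled.not_forever_beyond (H : Settled ident σ e) {a b c : V}
    (hc : ∀ᶠ t in atTop, (σ t).Mem a c) (hb : Btw a c b) : ¬ ∀ᶠ t in atTop, (σ t).Mem a b := by
  intro h
  obtain ⟨T, hT⟩ := eventually_atTop.1 (hc.and h)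
  have hs := H.stays_left (hT T le_rfl).1
  obtain ⟨t, ht, he⟩ := H.timeout (H.stays_present hs) T
  rcases H.timeout_stays he hs (hT t ht).2 with ⟨h1, -⟩ | ⟨z, hz, hzb, h1⟩
  · exact h1 c (hT t ht).1 hb
  · obtain ⟨i, hi, he1⟩ := H.receive_sent h1
    obtain ⟨j, hj, he2⟩ := H.receive_sent
      ((H.receive_introduce he1 hzb.ne_right.symm).1 (H.stays_right hz))
    exact H.receive_linearize he2 hs (hT j (by omega)).1 hb (hT (j + 1) (by omega)).2

theorem Settled.permanent_unique (H : Settled ident σ e) {a b c : V} {d : Side}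
    (hb : Permanent σ a b) (hc : Permanent σ a c) (hdb : OnSide d a b) (hdc : OnSide d a c) :
    b = c := by
  by_contra hne
  have : Btw a b c ∨ Btw a c b := by
    cases d <;> simp only [OnSide, Btw] at * <;> grind
  rcases this with h | h
  · exact H.not_forever_beyond hb.1 h hc.1
  · exact H.not_forever_beyond hc.1 h hb.1

theorem Permanent.stays (H : Settled ident σ e) {a b : V} (h : Permanent σ a b) :
    Stays σ a ∧ Stays σ b := by
  obtain ⟨t, ht⟩ := h.1.exists
  exact ⟨H.stays_left ht, H.stays_right ht⟩

/-- Neighbouring nodes eventually store each other forever. -/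
theorem Settled.permanent_of_lt (H : Settled ident σ e) (hc : ∀ t, (σ t).Connected ident)
    {u v : V} (hu : Stays σ u) (hv : Stays σ v) (huv : u < v)
    (hb : ∀ w, Stays σ w → u < w → ¬ w < v) : Permanent σ u v := by
  obtain ⟨m, hm, hmin⟩ := Set.exists_min_image {u | Stays σ u} id (Set.toFinite _) ⟨u, hu⟩
  let R : V → V → Prop := fun a b => a < b ∧ Permanent σ a b
  have hle : ∀ a b, Relation.ReflTransGen R a b → a ≤ b := by
    intro a b hab
    induction hab with
    | refl => exact le_rfl
    | tail _ h ih => exact ih.trans h.1.le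
  -- Apply the cut property to the set of nodes reachable from the leftmost node `m`. A permanent
  -- edge that leaves this set from `a` to the left would be the edge by which `a` was reached, or
  -- would lead left of `m`; one to the right extends the set.
  have hall : ∀ w, Stays σ w → Relation.ReflTransGen R m w := by
    intro w hw
    by_contra hwX
    obtain ⟨a, b, ha, hbX, hab⟩ := H.exists_permanent hc (X := {w | Relation.ReflTransGen R m w})
      hm hw Relation.ReflTransGen.refl hwX
    obtain ⟨t, ht⟩ := hab.1.exists
    rcases lt_or_gt_of_ne ht.2 with hlt | hlt
    · rcases Relation.ReflTransGen.cases_tail ha with rfl | ⟨c, hmc, hca⟩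
      · exact absurd (hmin b (hab.stays H).2) (not_le_of_gt hlt)
      · have := H.permanent_unique (d := .left) hab hca.2.symm hlt hca.1
        exact hbX (this ▸ hmc)
    · exact hbX (Relation.ReflTransGen.tail ha ⟨hlt, hab⟩)
  -- Permanent right neighbours are unique, so any two nodes reachable from `m` are comparable and
  -- the path from `u` to `v` cannot skip or pass `v`.
  have hru : Relator.RightUnique R := fun a b c h1 h2 =>
    H.permanent_unique (d := .right) h1.2 h2.2 h1.1 h2.1
  rcases Relation.ReflTransGen.total_of_right_unique hru (hall u hu) (hall v hv) with h | h
  · rcases Relation.ReflTransGen.cases_head h with rfl | ⟨w, huw, hwv⟩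
    · exact absurd huv (lt_irrefl _)
    · rcases (hle w v hwv).lt_or_eq with h1 | rfl
      · exact absurd h1 (hb w (huw.2.stays H).2 huw.1)
      · exact huw.2
  · exact absurd (hle v u h) (not_le_of_gt huv)

theorem Settled.permanent (H : Settled ident σ e) (hc : ∀ t, (σ t).Connected ident)
    {u v : V} (hu : Stays σ u) (hv : Stays σ v) (huv : v ≠ u)
    (hb : ∀ w, Stays σ w → ¬ Btw u w v) : Permanent σ u v := by
  rcases lt_or_gt_of_ne huv with h | h
  · exact (H.permanent_of_lt hc hv hu h fun w hw h1 h2 => hb w hw (.inr ⟨h1, h2⟩)).symm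
  · exact H.permanent_of_lt hc hu hv h fun w hw h1 h2 => hb w hw (.inl ⟨h1, h2⟩)

/-- A node eventually stores none but its neighbours. -/
theorem Settled.not_mem_of_btw (H : Settled ident σ e) (hc : ∀ t, (σ t).Connected ident)
    {b : V} (a : V) : Stays σ a → (∃ c, Stays σ c ∧ Btw a c b) →
      ∀ᶠ t in atTop, ¬ (σ t).Mem a b := by
  induction a using (wellFounded_btw_outer b).induction with
  | _ a ih =>
  rintro ha hex
  -- The closest staying node `c` towards `b` is a permanent neighbour of `a`. It forces `b` out of
  -- memory infinitely often, and blocks its return by comparison.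
  obtain ⟨c, ⟨hcs, hcb⟩, hmin⟩ := (wellFounded_btw a).has_min {c | Stays σ c ∧ Btw a c b} hex
  have hperm := (H.permanent hc ha hcs hcb.ne_left fun w hw hb =>
    hmin w ⟨hw, hb.trans hcb⟩ hb).1
  -- An Introduce that makes `a` save `b` unconditionally comes from a node beyond `a` that stores
  -- `b`; by induction there is none left.
  have hout : ∀ᶠ t in atTop, ∀ w, Btw w a b → ¬ (σ t).Mem w b := by
    refine eventually_all.2 fun w => ?_
    by_cases hw : Stays σ w ∧ Btw w a b
    · filter_upwards [ih w hw.2 hw.1 ⟨a, ha, hw.2⟩] with t ht _ using ht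
    · exact .of_forall fun t h1 h2 => hw ⟨H.stays_left h2, h1⟩
  have key := H.flush (fun _ x m => x = a ∧ ∃ w, m = .introduce b (some w)) (fun _ _ => 0) 0
    (fun _ _ => le_rfl) (.of_forall fun t a m _ h => h) (by
      filter_upwards [hout] with t ht x m ho hb
      obtain ⟨rfl, w, rfl⟩ := hb
      generalize he : e t = ev at ho
      cases ho with
      | introduce hm hv ha hb => exact absurd hv (ht _ hb)
      | reply _ hr => cases hr)
  refine eventually_of_frequently ?_ (not_eventually.1 (H.not_forever_beyond hperm hcb))
  filter_upwards [key, H.no_revAndLin, hperm] with t h1 h2 h3 h4 h5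
  obtain ⟨m, -, hm, -, h6⟩ := H.gain h5 h4
  rcases h6 ha with ⟨w, rfl⟩ | ⟨N, k, rfl, -⟩ | h6
  · exact h1 a _ hm ⟨rfl, w, rfl⟩
  · exact h2 a N k hm
  · exact (h6 c h3).2 hcb

/-- Eventually the stored references are those of the neighbours. -/
theorem Settled.mem_iff (H : Settled ident σ e) (hc : ∀ t, (σ t).Connected ident) :
    ∀ᶠ t in atTop, ∀ a b, (σ t).Mem a b ↔
      Stays σ a ∧ Stays σ b ∧ b ≠ a ∧ ∀ w, Stays σ w → ¬ Btw a w b := by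
  refine eventually_all.2 fun a => eventually_all.2 fun b => ?_
  by_cases h : Stays σ a ∧ Stays σ b ∧ b ≠ a
  · by_cases hb : ∃ w, Stays σ w ∧ Btw a w b
    · filter_upwards [H.not_mem_of_btw hc a h.1 hb] with t ht
      obtain ⟨w, hw, hwb⟩ := hb
      exact iff_of_false ht fun h' => h'.2.2.2 w hw hwb
    · have hb' : ∀ w, Stays σ w → ¬ Btw a w b := fun w hw hwb => hb ⟨w, hw, hwb⟩
      filter_upwards [(H.permanent hc h.1 h.2.1 h.2.2 hb').1] with t ht
      exact iff_of_true ht ⟨h.1, h.2.1, h.2.2, hb'⟩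
  · exact .of_forall fun t => iff_of_false
      (fun hm => h ⟨H.stays_left hm, H.stays_right hm, hm.2⟩) fun h' => h ⟨h'.1, h'.2.1, h'.2.2.1⟩

/-- Such a message is sent only by a node that stores two nodes on one side, which has stopped by
`Settled.mem_iff`. -/
theorem Settled.no_introduce (H : Settled ident σ e) (hc : ∀ t, (σ t).Connected ident) :
    ∀ᶠ t in atTop, ∀ a v w, Msg.introduce v (some w) ∉ (σ t).ch a := by
  have key := H.flush (fun _ _ m => ∃ v w, m = .introduce v (some w)) (fun _ _ => 0) 0
    (fun _ _ => le_rfl) (.of_forall fun t a m _ h => h) (by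
      filter_upwards [H.mem_iff hc] with t ht x m ho hb
      obtain ⟨v, w, rfl⟩ := hb
      generalize he : e t = ev at ho
      cases ho with
      | introduce hm hv ha hb =>
        exact absurd hb (((ht _ _).1 hv).2.2.2 _ ((ht _ _).1 ha).2.1)
      | reply _ hr => cases hr)
  filter_upwards [key] with t ht a v w hm using ht a _ hm ⟨v, w, rfl⟩

end Staying

/-! ### Memory in the form produced by the sanity check. -/

section Sane

variable {V I : Type*} [LinearOrder V]

/-- All references are stored on the correct side, and none is stored temporarily. -/
def NodeState.Sane (u : V) (x : NodeState V I) : Prop :=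
  (∀ d, x.tmp d = ∅) ∧ ∀ d, ∀ v ∈ x.nbr d, OnSide d u v

variable {u : V} {x : NodeState V I}

theorem NodeState.Sane.mem_nbr (h : x.Sane u) {b : V} {d : Side} :
    b ∈ x.nbr d ↔ x.Mem u b ∧ OnSide d u b := by
  refine ⟨fun hb => ⟨⟨mem_refs.2 ⟨d, .inl hb⟩, (h.2 d b hb).ne⟩, h.2 d b hb⟩, fun hb => ?_⟩
  obtain ⟨d', hd | hd⟩ := mem_refs.1 hb.1.1
  · exact (h.2 d' b hd).unique hb.2 ▸ hd
  · simp [h.1] at hd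

theorem sane_sanitize (hm : x.mode = .staying) : (sanitize u x).Sane u := by
  simp only [NodeState.Sane, sanitize, hm, implies_true, true_and]
  exact fun d v hv => (Finset.mem_filter.1 hv).2

theorem NodeState.Sane.setNbr (h : x.Sane u) {d : Side} {S : Finset V}
    (hS : ∀ v ∈ S, OnSide d u v) : (x.setNbr d S).Sane u := by
  refine ⟨h.1, fun d' v hv => ?_⟩
  by_cases hd : d' = d
  · subst hd
    simp only [NodeState.setNbr, Function.update_self] at hv
    exact hS v hv
  · simp only [NodeState.setNbr, Function.update_of_ne hd] at hv
    exact h.2 d' v hv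

theorem NodeState.Sane.addNbr (h : x.Sane u) {d : Side} {v : V} (hv : OnSide d u v) :
    (x.setNbr d (x.nbr d ∪ {v})).Sane u :=
  h.setNbr fun w hw => by
    rcases Finset.mem_union.1 hw with hw | hw
    · exact h.2 d w hw
    · rw [Finset.mem_singleton] at hw; rwa [hw]

theorem NodeState.Sane.save (h : x.Sane u) (hm : x.mode = .staying) {d : Side} {v : V}
    (hv : OnSide d u v) : (x.save d {v}).Sane u := by
  simp only [NodeState.save, hm]
  exact h.addNbr hv

theorem NodeState.Sane.congr (h : x.Sane u) {y : NodeState V I} (h1 : y.nbr = x.nbr)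
    (h2 : y.tmp = x.tmp) : y.Sane u := by
  rwa [NodeState.Sane, h1, h2]

variable [LinearOrder I] [Fintype V]

theorem sane_act {ident : V ↪o I} {m : Msg V I} (hm : x.mode = .staying)
    (hr : ∀ N k, m ≠ .revAndLin N k) : (act ident u m (sanitize u x)).1.Sane u := by
  have h := sane_sanitize (u := u) hm
  have hm' : (sanitize u x).mode = .staying := hm
  cases m <;> simp only [act]
  case introduce v w =>
    rcases hs : sideOf u v with _ | d <;> simp only [introduce, hs]
    · exact h
    · cases w <;> simp only [hm']
      · exact h
      · exact h.addNbr (sideOf_eq_some.1 hs)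
  case linearize v =>
    rcases hs : sideOf u v with _ | d <;> simp only [linearize, hs, hm']
    · exact h
    · split
      · exact h
      · split_ifs
        · exact h
        · exact h.setNbr fun w hw => h.2 d w (Finset.mem_sdiff.1 hw).1
  case tempDelegate v =>
    rcases hs : sideOf u v with _ | d <;> simp only [tempDelegate, hs]
    · exact h
    · split_ifs
      · exact h.save hm' (sideOf_eq_some.1 hs)
      · exact h
  case revAndLinReq d => exact h.congr refs_revAndLinReq.1 refs_revAndLinReq.2.1
  case revAndLinAck v k =>
    rcases hs : sideOf u v with _ | d <;> simp only [revAndLinAck, hs, hm']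
    exacts [h, h]
  case revAndLin N k => exact absurd rfl (hr N k)
  case initSearch => exact h.congr initSearch_static.1 initSearch_static.2.1
  case forwardProbe s D next q =>
    rcases forwardProbe_cases ident u s D next q x with ⟨-, h'⟩ | ⟨-, -, h'⟩ |
      ⟨-, y, hy, ⟨-, h'⟩ | ⟨hs, hc, h'⟩ | ⟨-, -, h'⟩⟩ <;> rw [h']
    exacts [h, h, h, h.save hm' hs, h]
  case probeSuccess => exact h.congr probeSuccess_static.1 probeSuccess_static.2.1
  case probeFail => exact h.congr probeFail_static.1 probeFail_static.2.1
  case search => exact h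

end Sane

/-! ### Legitimate states: closure and convergence. -/

section Legitimate

variable {V I : Type*} [LinearOrder V] [LinearOrder I] [Fintype V]
variable {ident : V ↪o I} {s s' : State V I} {e : Event V I}

/-- RevAndLin is excluded because it may add its list to the wrong side. The clause `e ≠ .timeout u`
ensures that a Timeout really establishes sanity, which starts the induction in
`Settled.eventually_sane`. -/
theorem Step.sane (h : Step ident s e s') {u : V} (hm : (s.loc u).mode = .staying)
    (hr : ∀ N k, e ≠ .receive u (.revAndLin N k)) (hl : e ≠ .leave u) :
    (s'.loc u = s.loc u ∧ e ≠ .timeout u) ∨ (s'.loc u).Sane u := by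
  have hsane := sane_sanitize (u := u) hm
  cases h with
  | idle => exact .inl ⟨rfl, by simp⟩
  | timeoutStaying v hp hm' | timeoutLeaving v hp hm' ho | exit v hp hm' ho | receive v m _ hp
  | initSearch v D hp hm' | leave v hp hm' =>
    by_cases huv : u = v
    swap
    · exact .inl ⟨by simp [State.update, huv], fun h => by cases h <;> exact huv rfl⟩
    subst huv
    right
    simp only [State.update, Function.update_self]
    first
    | exact hsane
    | exact sane_act hm fun N k hN => hr N k (by rw [hN])
    | exact hsane.congr initSearch_static.1 initSearch_static.2.1
    | exact absurd rfl hl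
    | exact absurd hm' (by simp [hm])

theorem Step.mode_eq (h : Step ident s e s') (he : ∀ u, e ≠ .leave u) (u : V) :
    (s'.loc u).mode = (s.loc u).mode := by
  cases h with
  | idle => rfl
  | leave v => exact absurd rfl (he v)
  | timeoutStaying v | timeoutLeaving v | exit v | receive v | initSearch v =>
    by_cases huv : u = v
    · subst huv
      simp [State.update, BuildList.timeoutStaying, BuildList.timeoutLeaving, BuildList.exit,
        act_static.1, initSearch_static.2.2.1]
    · simp [State.update, huv]

/-- `b` is the closest present node on one side of `u`. -/
def State.Next (s : State V I) (u b : V) : Prop :=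
  s.Present b ∧ b ≠ u ∧ ∀ w, s.Present w → ¬ Btw u w b

/-- Separates where references are stored (`Sane`) from which ones are stored (`Next`), since the
two are proved by different means. -/
theorem isSortedLine_iff : s.IsSortedLine ↔
    (∀ u, s.Present u ↔ (s.loc u).mode = .staying) ∧
    ∀ u, s.Present u → (s.loc u).Sane u ∧ ∀ b, s.Mem u b ↔ s.Next u b := by
  have key : ∀ u b d, OnSide d u b → ((∀ w, s.Present w → OnSide d u w → ¬ OnSide d.other b w) ↔
      ∀ w, s.Present w → ¬ Btw u w b) := fun u b d hd =>
    ⟨fun h w hw hb => h w hw (hb.onSide.2 hd) ((onSide_other_iff_btw (hb.onSide.2 hd) hd).2 hb),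
      fun h w hw hd' hb => h w hw ((onSide_other_iff_btw hd' hd).1 hb)⟩
  constructor
  · intro h
    refine ⟨h.present_iff, fun u hu => ?_⟩
    have hs : (s.loc u).Sane u := ⟨h.tmp_empty u hu, fun d v hv => ((h.nbr_iff u hu d v).1 hv).2.1⟩
    refine ⟨hs, fun b => ?_⟩
    constructor
    · intro hb
      obtain ⟨d, hd⟩ := exists_onSide hb.2
      obtain ⟨h1, -, h2⟩ := (h.nbr_iff u hu d b).1 (hs.mem_nbr.2 ⟨hb, hd⟩)
      exact ⟨h1, hb.2, (key u b d hd).1 h2⟩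
    · rintro ⟨h1, h2, h3⟩
      obtain ⟨d, hd⟩ := exists_onSide h2
      exact (hs.mem_nbr.1 ((h.nbr_iff u hu d b).2 ⟨h1, hd, (key u b d hd).2 h3⟩)).1
  · rintro ⟨h1, h2⟩
    refine ⟨h1, fun u hu d v => ?_, fun u hu => (h2 u hu).1.1⟩
    rw [(h2 u hu).1.mem_nbr]
    change s.Mem u v ∧ _ ↔ _
    rw [(h2 u hu).2 v]
    constructor
    · rintro ⟨⟨h3, h4, h5⟩, hd⟩
      exact ⟨h3, hd, (key u v d hd).2 h5⟩
    · rintro ⟨h3, hd, h4⟩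
      exact ⟨⟨h3, hd.ne, (key u v d hd).1 h4⟩, hd⟩

theorem Step.isLegitimate (h : Step ident s e s') (hs : s.IsLegitimate)
    (he : ∀ u, e ≠ .leave u) : s'.IsLegitimate := by
  obtain ⟨hp, hl⟩ := isSortedLine_iff.1 hs.line
  have hg : ∀ u, (s'.loc u).gone = (s.loc u).gone := by
    by_contra hc
    obtain ⟨u, -, hu, hm, -⟩ := h.exit_spec hc
    rw [(hp u).1 hu] at hm
    simp at hm
  have hP : ∀ u, s'.Present u ↔ s.Present u := fun u => by simp only [State.Present, hg u]
  have hrl : ∀ u N k, e ≠ .receive u (.revAndLin N k) := by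
    rintro u N k rfl
    exact hs.no_save u h.present_receive _ h.mem_of_receive trivial
  have hrefs : ∀ u, s.Present u → ∀ w ∈ (s.loc u).refs, s.Present w := by
    intro u hu w hw
    by_cases hwu : w = u
    · rwa [hwu]
    · exact (((hl u hu).2 w).1 ⟨hw, hwu⟩).1
  have hmem : ∀ u, s.Present u → ∀ b, s'.Mem u b ↔ s.Mem u b := by
    intro u hu b
    by_cases hr : ∃ m, e = .receive u m
    swap
    · push Not at hr
      exact (h.loc_of_not_receive (hg u) hr).1 b
    obtain ⟨m, rfl⟩ := hr
    have hm := (hp u).1 hu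
    have hnext : ∀ z b, s.Mem u z → s.Mem u b → ¬ Btw u z b := fun z b hz hb =>
      (((hl u hu).2 b).1 hb).2.2 z (((hl u hu).2 z).1 hz).1
    constructor
    · intro h'
      by_contra hb
      rw [State.Mem, h.loc_receive] at h'
      obtain ⟨h1, h2⟩ := act_gain h' hb
      rcases h2 hm with ⟨w, rfl⟩ | ⟨N, k, rfl, -⟩ | h2
      · exact hs.no_save u hu _ h.mem_of_receive trivial
      · exact hrl u N k rfl
      · simp only [Nb_of_staying hm] at h2
        have hbp := hs.refs_present u hu m h.mem_of_receive b h1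
        by_cases hex : ∃ w, s.Present w ∧ Btw u w b
        · obtain ⟨w, ⟨hw, hwb⟩, hmin⟩ := (wellFounded_btw u).has_min _ hex
          refine (h2 w (((hl u hu).2 w).2 ⟨hw, hwb.ne_left, fun z hz hzw => ?_⟩)).2 hwb
          exact hmin z ⟨hz, hzw.trans hwb⟩ hzw
        · push Not at hex
          exact hb (((hl u hu).2 b).2 ⟨hbp, h'.2, hex⟩)
    · intro hb
      by_contra h'
      rw [State.Mem, h.loc_receive] at h'
      rcases act_loss h' hb with ⟨-, -, z, hz, hzb⟩ | ⟨N, k, rfl, -⟩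
      · exact hnext z b hz hb hzb
      · exact hrl u N k rfl
  refine ⟨isSortedLine_iff.2 ⟨fun u => ?_, fun u hu => ?_⟩, fun u hu m hm => ?_,
    fun u hu m hm w hw => ?_⟩
  · rw [hP, h.mode_eq he, hp]
  · rw [hP] at hu
    refine ⟨?_, fun b => ?_⟩
    · rcases h.sane ((hp u).1 hu) (hrl u) (he u) with h1 | h1
      · rw [h1.1]; exact (hl u hu).1
      · exact h1
    · rw [hmem u hu, (hl u hu).2 b]
      simp only [State.Next, hP]
  · rw [hP] at hu
    rcases h.mem_ch hm with hm | hm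
    · exact hs.no_save u hu m hm
    have ho := h.origin hg hm
    intro hsave
    cases ho with
    | introduce hm' hv ha hb =>
      have hpu := (hp _).2 hm'
      exact (((hl _ hpu).2 _).1 hv).2.2 u hu hb
    | probe | introduceSelf | req => exact hsave
    | reply hm₀ hr =>
      cases hr with
      | revAndLin hm' =>
        rw [(hp _).1 h.present_receive] at hm'
        simp at hm'
      | _ => exact hsave
  · rw [hP] at hu ⊢
    rcases h.mem_ch hm with hm | hm
    · exact hs.refs_present u hu m hm w hw
    obtain ⟨v, hv, hk⟩ := (h.origin hg hm).known
    have hvp : s.Present v := by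
      rcases hv with rfl | ⟨m₀, -, rfl⟩
      exacts [h.present_timeout, h.present_receive]
    rcases hk w (.inr hw) with rfl | hk | ⟨m₀, hm₀, -, hk⟩
    exacts [hvp, hrefs v hvp w hk, hs.refs_present v hvp m₀ hm₀ w hk]

variable {σ : ℕ → State V I} {e : ℕ → Event V I}

theorem Settled.eventually_sane (H : Settled ident σ e) :
    ∀ᶠ t in atTop, ∀ u, Stays σ u → ((σ t).loc u).Sane u := by
  refine eventually_all.2 fun u => ?_
  by_cases hu : Stays σ u
  swap
  · exact .of_forall fun t h => absurd h hu
  obtain ⟨T, hT⟩ := eventually_atTop.1 H.no_revAndLin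
  have hstep : ∀ t ≥ T, (((σ (t + 1)).loc u) = (σ t).loc u ∧ e t ≠ .timeout u) ∨
      ((σ (t + 1)).loc u).Sane u := fun t ht => by
    refine (H.step t).sane (H.stays_iff.2 hu) (fun N k he => ?_) fun he => ?_
    · exact hT t ht u N k (H.step_of he).mem_of_receive
    · have hl := H.mode_succ t u
      generalize hs : σ (t + 1) = s' at hl
      have hst := H.step_of he
      rw [hs] at hst
      cases hst with
      | leave _ hp hm => simp [State.update, hm] at hl
  obtain ⟨t, ht, he⟩ := H.timeout (H.stays_present hu) T
  -- One Timeout after the last RevAndLin message makes the memory sane, and no later step spoils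
  -- it.
  have h0 : ((σ (t + 1)).loc u).Sane u := (hstep t ht).resolve_left fun h => h.2 he
  refine eventually_atTop.2 ⟨t + 1, fun j hj _ => Nat.le_induction h0 (fun i hi ih => ?_) j hj⟩
  rcases hstep i (by omega) with h | h
  · rwa [h.1]
  · exact h

theorem Settled.eventually_isLegitimate (H : Settled ident σ e)
    (hc : ∀ t, (σ t).Connected ident) : ∀ᶠ t in atTop, (σ t).IsLegitimate := by
  filter_upwards [H.eventually_sane, H.mem_iff hc, H.no_introduce hc, H.no_revAndLin]
    with t h1 h2 h3 h4
  refine ⟨isSortedLine_iff.2 ⟨fun u => H.present_iff_stays.trans H.stays_iff.symm,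
    fun u hu => ?_⟩, fun u hu m hm hsave => ?_, fun u hu m hm v hv => (H.clean t).msgs u m hm v hv⟩
  · rw [H.present_iff_stays] at hu
    refine ⟨h1 u hu, fun b => ?_⟩
    rw [h2]
    simp only [State.Next, H.present_iff_stays, hu, true_and]
  · cases m with
    | introduce v w =>
      cases w with
      | none => exact hsave
      | some w => exact h3 u v w hm
    | revAndLin N k => exact h4 u N k hm
    | _ => exact hsave

end Legitimate

end BuildList

theorem mainTheorem5 {V I : Type*} [LinearOrder V] [Fintype V] [LinearOrder I] (ident : V ↪o I) :
    (∀ (σ : ℕ → BuildList.State V I) (e : ℕ → BuildList.Event V I),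
      BuildList.IsComputation ident σ e →
      (σ 0).IsInitial → (σ 0).WeaklyConnected ident →
      ∃ n, ∀ k ≥ n, (σ k).IsLegitimate) ∧
    (∀ (s s' : BuildList.State V I) (a : BuildList.Event V I),
      s.IsLegitimate → BuildList.Step ident s a s' → (∀ u, a ≠ .leave u) →
      s'.IsLegitimate) := by
  refine ⟨fun σ e h h0 hc => ?_, fun s s' a hs h ha => h.isLegitimate hs ha⟩
  obtain ⟨T, H⟩ := h.exists_settled h0.clean
  obtain ⟨n, hn⟩ := Filter.eventually_atTop.1
    (H.eventually_isLegitimate fun t => h.connected hc.connected (T + t))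
  refine ⟨T + n, fun k hk => ?_⟩
  have := hn (k - T) (by omega)
  rwa [show T + (k - T) = k by omega] at this
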